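/- **Setting.** Let $T\ge 1$, $n\in\{1,\dots,T\}$, $K\ge 1$. On a probability space let $$X_{t+1}=f_t(X_t,U_t^{1},\dots,U_t^{K},W_t)\ (0\le t<T),\qquad Y_t^j=h_t^j(X_t,Z_t^j)\ (0\le t\le T,\ 1\le j\le K),$$ with measurable $f_t,h_t^j$ and mutually independent $X_0$, $W_0,\dots,W_{T-1}$, $(Z_t^j)_{t\le T,\,j\le K}$. The spaces $\mathbb X_t,\mathbb Y_t^j,\mathbb U_t^j$ are standard Borel; $dx_t$, $dy_t^j$ denote fixed $\sigma$-finite reference measures on $\mathbb X_t$, $\mathbb Y_t^j$. There are jointly measurable probability densities $p_0$, $S_{t+1}$, $Q_t^j$ such that $X_0$ has law $p_0(x)\,dx$, and, for all $x,u$, $f_t(x,u,W_t)$ has law $S_{t+1}(x'|x,u)\,dx'$ and $h_t^j(x,Z_t^j)$ has law $Q_t^j(y|x)\,dy$. The common and private information ($n$-step delayed sharing) are $$\Delta_t=\{Y^j_{0,t-n},U^j_{0,t-n}: 1\le j\le K\},\quad \Lambda_t^j=\{Y^j_{t-n+1,t},U^j_{t-n+1,t-1}\},\quad \Lambda_t^{-k}=\{\Lambda_t^j\}_{j\ne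 k}$$ (negative times are omitted). A strategy of player $j$ is a family of measurable functions $g_t^j$, and $U_t^j=g_t^j(\Delta_t,\Lambda_t^j)$, $0\le t<T$. Integrals $d\lambda_t^{-k}$ are taken against the reference measures in the observation coordinates and against counting measure in the action coordinates; accordingly the delta function at $a$ is $\mu_a(u)=\mathbf 1_{\{u=a\}}$. PDFs of $(X_t,\Lambda_t^{-k})$ are understood with respect to $dx_t\,d\lambda_t^{-k}$. **The operator.** Fix a player $k$ and put $c_t=(y^{-k}_{t-n+1},u^{-k}_{t-n+1})$, the data of the other players in $\delta_{t+1}$ that are not in $\delta_t$ (empty if $t+1<n$); $\lambda_t^{-k}$ is a function of $c_t$ and $\lambda_{t+1}^{-k}$. Define $$\overline{\mathbf T}{}^k_{t+1}\big(y^k_{t+1},u^k_t,\gamma^{-k},c_t,\xi\big)(x_{t+1},\lambda^{-k}_{t+1})=Q^k_{t+1}(y^k_{t+1}|x_{t+1})\prod_{j\ne k}Q^j_{t+1}(y^j_{t+1}|x_{t+1})\int S_{t+1}\big(x_{t+1}|x_t,u_t^k,\gamma^{-k}(\lambda_t^{-k})\big)\prod_{j\neq k}\mu_{\gamma^j(\lambda_t^j)}(u_t^j)\;\xi(x_t,\lambda_t^{-k})\,dx_t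 ,$$ where for $n=1$ the product of delta functions is removed, and $$\mathbf T^k_{t+1}(\cdot)=\frac{\overline{\mathbf T}{}^k_{t+1}(\cdot)}{\int \overline{\mathbf T}{}^k_{t+1}(\cdot)(x_{t+1},\lambda_{t+1}^{-k})\,dx_{t+1}\,d\lambda_{t+1}^{-k}}\quad\text{(zero if the denominator is zero).}$$ **Theorem (Recursion of private a posteriori PDFs).** Fix $k$ and strategies $g^{-k}=(g^j)_{j\neq k}$ of the other players. There are jointly measurable functions $\xi_t^k[\delta_t,\lambda_t^k](x_t,\lambda_t^{-k})$, $0\le t\le T$, depending on $g^{-k}$ but not on $g^k$, such that for all realizations $$\xi_{t+1}^k[\delta_{t+1},\lambda_{t+1}^k]=\mathbf T^k_{t+1}\big(y^k_{t+1},u_t^k,g_t^{-k}(\delta_t,\cdot),c_t,\xi_t^k[\delta_t,\lambda_t^k]\big),\qquad 0\le t<T,$$ $$\xi_0^k[\delta_0,\lambda_0^k](x_0,\lambda_0^{-k})=\mathbf P_0(x_0,y_0^{-k}|y_0^k)=\frac{p_0(x_0)\prod_{j}Q_0^j(y_0^j|x_0)}{\int p_0(x_0)\prod_jQ_0^j(y_0^j|x_0)\,dx_0\,dy_0^{-k}}\quad\text{(zero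 if the denominator is zero)},$$ and, for every strategy $g^k$ of player $k$ and every $t\le T$, for almost every realization $(\delta_t,\lambda_t^k)$ of $(\Delta_t,\Lambda_t^k)$ under $(g^k,g^{-k})$, $\xi^k_t[\delta_t,\lambda^k_t]$ is a PDF of the conditional distribution of $(X_t,\Lambda_t^{-k})$ given $(\Delta_t,\Lambda_t^k)=(\delta_t,\lambda_t^k)$. In particular: (1) the posterior PDF depends on the actions $u^k_{0,t-1}$ of player $k$ (which are part of $(\delta_t,\lambda_t^k)$), but not on the strategy $g^k$. (2) Let $\Xi_t^k$ be the conditional distribution of $(X_t,\Lambda_t^{-k})$ given $(\Delta_t,\Lambda_t^k)$, a random element of the space of measures on the space of pairs $(x_t,\lambda_t^{-k})$. For every $t<T$ there is a Markov kernel $\kappa_t$, depending on $g^{-k}$ but not on $g^k$, such that for every $g^k$ and every measurable set $B$ of measures, almost surely, $$\mathbf P^{g^k,g^{-k}}\big(\Xi_{t+1}^k\in B\,\big|\,\Delta_{0,t},\Lambda^k_{0,t},U^k_{0,t}\big)=\kappa_t\big(\Xi_t^k,\Delta_t,U_t^k;B\big)=\mathbf P^{g^k,g^{-k}}\big(\Xi^k_{t+1}\in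 B\,\big|\,\Xi_t^k,\Delta_t,U_t^k\big).$$ -/

import Mathlib

open MeasureTheory ProbabilityTheory
open scoped ENNReal NNReal

universe uX uY uW uZ uΩ

/-! ### Information pattern -/

section Information

/-- Values of the common information `Δ_t = {Y_{0,t-n}^j, U_{0,t-n}^j : j}`; the times are
`s < t + 1 - n` (truncated subtraction), that is `0 ≤ s ≤ t - n`, and there are none if `t < n`. -/
abbrev Shared {K : ℕ} (n : ℕ) (Y : ℕ → Fin K → Type uY) (U : ℕ → Fin K → Type uX) (t : ℕ) :
    Type (max uX uY) :=
  (s : Finset.range (t + 1 - n)) → (j : Fin K) → Y s.1 j × U s.1 j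

/-- Values of the private information `Λ_t^j = {Y_{t-n+1,t}^j, U_{t-n+1,t-1}^j}`
(times before `0` are omitted). -/
abbrev Private {K : ℕ} (n : ℕ) (Y : ℕ → Fin K → Type uY) (U : ℕ → Fin K → Type uX) (t : ℕ)
    (j : Fin K) : Type (max uX uY) :=
  ((s : Finset.Ico (t + 1 - n) (t + 1)) → Y s.1 j) × ((s : Finset.Ico (t + 1 - n) t) → U s.1 j)

/-- Values of `Λ_t^{-k}`, the private information of all players other than `k`. -/
abbrev PrivateOthers {K : ℕ} (n : ℕ) (Y : ℕ → Fin K → Type uY) (U : ℕ → Fin K → Type uX) (t : ℕ)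
    (k : Fin K) : Type (max uX uY) :=
  (j : {j : Fin K // j ≠ k}) → Private n Y U t j.1

/-- Values of the part `{Y_{t-n+1}^{-k}, U_{t-n+1}^{-k}}` of `Δ_{t+1}` that is not in `Δ_t` and
belongs to the players other than `k` (the index set is `{t + 1 - n}` if `n ≤ t + 1`, and empty
otherwise). -/
abbrev Newly {K : ℕ} (n : ℕ) (Y : ℕ → Fin K → Type uY) (U : ℕ → Fin K → Type uX) (t : ℕ)
    (k : Fin K) : Type (max uX uY) :=
  (s : Finset.Ico (t + 1 - n) (t + 1 + 1 - n)) → (j : {j : Fin K // j ≠ k}) → Y s.1 j.1 × U s.1 j.1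

variable {K n : ℕ} {Y : ℕ → Fin K → Type uY} {U : ℕ → Fin K → Type uX}

/-- The value of `Δ_t` along a sequence of observations and actions. -/
def sharedOf (y : ∀ s j, Y s j) (u : ∀ s j, U s j) (t : ℕ) : Shared n Y U t :=
  fun s j => (y s.1 j, u s.1 j)

/-- The value of `Λ_t^j` along a sequence of observations and actions. -/
def privateOf (y : ∀ s j, Y s j) (u : ∀ s j, U s j) (t : ℕ) (j : Fin K) : Private n Y U t j :=
  (fun s => y s.1 j, fun s => u s.1 j)

/-- The value of the newly shared data along a sequence of observations and actions. -/
def newlyOf (y : ∀ s j, Y s j) (u : ∀ s j, U s j) (t : ℕ) (k : Fin K) : Newly n Y U t k :=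
  fun s j => (y s.1 j.1, u s.1 j.1)

/-- `λ_t^{-k}` is made of the newly shared data and of a part of `λ_{t+1}^{-k}`. -/
def prevOthers {t : ℕ} {k : Fin K} (c : Newly n Y U t k) (l : PrivateOthers n Y U (t + 1) k) :
    PrivateOthers n Y U t k :=
  fun j =>
    (fun s =>
      if hs : s.1 < t + 1 + 1 - n then
        (c ⟨s.1, Finset.mem_Ico.2 ⟨(Finset.mem_Ico.1 s.2).1, hs⟩⟩ j).1
      else
        (l j).1 ⟨s.1, Finset.mem_Ico.2
          ⟨not_lt.1 hs, (Finset.mem_Ico.1 s.2).2.trans (Nat.lt_succ_self _)⟩⟩,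
     fun s =>
      if hs : s.1 < t + 1 + 1 - n then
        (c ⟨s.1, Finset.mem_Ico.2 ⟨(Finset.mem_Ico.1 s.2).1, hs⟩⟩ j).2
      else
        (l j).2 ⟨s.1, Finset.mem_Ico.2
          ⟨not_lt.1 hs, (Finset.mem_Ico.1 s.2).2.trans (Nat.lt_succ_self _)⟩⟩)

/-- Consistency of the reconstruction of `λ_t^{-k}`. -/
theorem prevOthers_newlyOf (y : ∀ s j, Y s j) (u : ∀ s j, U s j) (t : ℕ) (k : Fin K) :
    prevOthers (newlyOf y u t k) (fun j => privateOf y u (t + 1) j.1) =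
      fun j : {j : Fin K // j ≠ k} => (privateOf y u t j.1 : Private n Y U t j.1) := by
  funext j
  refine Prod.ext ?_ ?_ <;> funext s <;> simp [prevOthers, newlyOf, privateOf]

/-- The tuple `(a^k, a^{-k})`. -/
def join {β : Fin K → Type*} (k : Fin K) (a : β k) (b : ∀ j : {j : Fin K // j ≠ k}, β j.1) :
    ∀ j, β j :=
  (Equiv.piSplitAt k β).symm (a, b)

/-- A strategy of player `j`: `U_t^j = g_t(Δ_t, Λ_t^j)`. -/
abbrev Strategy (n : ℕ) (Y : ℕ → Fin K → Type uY) (U : ℕ → Fin K → Type uX) (j : Fin K) :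
    Type (max uX uY) :=
  (t : ℕ) → Shared n Y U t → Private n Y U t j → U t j

/-- Admissible strategies: measurable at the decision times `0, …, T - 1`. -/
def Admissible (T : ℕ) [∀ t j, MeasurableSpace (Y t j)] [∀ t j, MeasurableSpace (U t j)]
    {j : Fin K} (g : Strategy n Y U j) : Prop :=
  ∀ t < T, Measurable fun i : Shared n Y U t × Private n Y U t j => g t i.1 i.2

end Information

/-! ### The system -/

/-- The partially observed system with `n`-step delayed sharing, horizon `T` and `K` players, on
the probability space `(Ω, P)`.  Spaces and functions are indexed by all times `t : ℕ`, but all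
requirements concern only the times of the horizon.  `νX t` and `νY t j` are the reference
measures written `dx_t` and `dy_t^j`. -/
structure TeamModel (T n K : ℕ) {Ω : Type uΩ} [MeasurableSpace Ω] (P : Measure Ω)
    (X : ℕ → Type uX) (Y : ℕ → Fin K → Type uY) (U : ℕ → Fin K → Type uX)
    (W : ℕ → Type uW) (Z : ℕ → Fin K → Type uZ)
    [∀ t, MeasurableSpace (X t)] [∀ t j, MeasurableSpace (Y t j)]
    [∀ t j, MeasurableSpace (U t j)] [∀ t, MeasurableSpace (W t)]
    [∀ t j, MeasurableSpace (Z t j)] where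
  one_le_delay : 1 ≤ n
  delay_le : n ≤ T
  /-- state dynamics `X_{t+1} = f_t(X_t, U_t, W_t)` -/
  f : (t : ℕ) → X t → (∀ j, U t j) → W t → X (t + 1)
  /-- observations `Y_t^j = h_t^j(X_t, Z_t^j)` -/
  h : (t : ℕ) → (j : Fin K) → X t → Z t j → Y t j
  x0 : Ω → X 0
  w : (t : ℕ) → Ω → W t
  z : (t : ℕ) → (j : Fin K) → Ω → Z t j
  measurable_f : ∀ t < T, Measurable fun p : X t × (∀ j, U t j) × W t => f t p.1 p.2.1 p.2.2
  measurable_h : ∀ t ≤ T, ∀ j, Measurable fun p : X t × Z t j => h t j p.1 p.2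
  measurable_x0 : Measurable x0
  measurable_w : ∀ t < T, Measurable (w t)
  measurable_z : ∀ t ≤ T, ∀ j, Measurable (z t j)
  /-- `X_0`, `W_0, …, W_{T-1}` and the `Z_t^j`, `t ≤ T`, are mutually independent -/
  indep : iIndep
    (Sum.elim (fun _ : Unit => MeasurableSpace.comap x0 inferInstance)
      (Sum.elim (fun t : Fin T => MeasurableSpace.comap (w t) inferInstance)
        (fun p : Fin (T + 1) × Fin K => MeasurableSpace.comap (z p.1 p.2) inferInstance))) P
  νX : (t : ℕ) → Measure (X t)
  νY : (t : ℕ) → (j : Fin K) → Measure (Y t j)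
  sigmaFinite_νX : ∀ t ≤ T, SigmaFinite (νX t)
  sigmaFinite_νY : ∀ t ≤ T, ∀ j, SigmaFinite (νY t j)
  /-- the PDF of `X_0` -/
  p0 : X 0 → ℝ≥0
  /-- `S t x' x u` is `S_{t+1}(x' | x, u)` -/
  S : (t : ℕ) → X (t + 1) → X t → (∀ j, U t j) → ℝ≥0
  /-- `Q t j y x` is `Q_t^j(y | x)` -/
  Q : (t : ℕ) → (j : Fin K) → Y t j → X t → ℝ≥0
  measurable_p0 : Measurable p0
  measurable_S : ∀ t < T,
    Measurable fun p : X (t + 1) × X t × (∀ j, U t j) => S t p.1 p.2.1 p.2.2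
  measurable_Q : ∀ t ≤ T, ∀ j, Measurable fun p : Y t j × X t => Q t j p.1 p.2
  law_x0 : P.map x0 = (νX 0).withDensity fun x => (p0 x : ℝ≥0∞)
  law_f : ∀ t < T, ∀ x u,
    P.map (fun ω => f t x u (w t ω)) = (νX (t + 1)).withDensity fun x' => (S t x' x u : ℝ≥0∞)
  law_h : ∀ t ≤ T, ∀ j x,
    P.map (fun ω => h t j x (z t j ω)) = (νY t j).withDensity fun y => (Q t j y x : ℝ≥0∞)

namespace TeamModel

variable {T n K : ℕ} {Ω : Type uΩ} [MeasurableSpace Ω] {P : Measure Ω}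
  {X : ℕ → Type uX} {Y : ℕ → Fin K → Type uY} {U : ℕ → Fin K → Type uX}
  {W : ℕ → Type uW} {Z : ℕ → Fin K → Type uZ}
  [∀ t, MeasurableSpace (X t)] [∀ t j, MeasurableSpace (Y t j)]
  [∀ t j, MeasurableSpace (U t j)] [∀ t, MeasurableSpace (W t)]
  [∀ t j, MeasurableSpace (Z t j)]
  (M : TeamModel T n K P X Y U W Z)

theorem lt_of_mem_shared (M : TeamModel T n K P X Y U W Z) {s t : ℕ} (hs : s ∈ Finset.range (t + 1 - n)) : s < t := by
  have h1 := M.one_le_delay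
  have h2 := Finset.mem_range.1 hs
  omega

/-! #### The closed-loop processes under a strategy profile `g` -/

/-- Simultaneous recursion for the state (`false`) and the tuple of actions (`true`). -/
def run (g : ∀ j, Strategy n Y U j) (ω : Ω) :
    (t : ℕ) → (b : Bool) → Bool.rec (X t) (∀ j, U t j) b
  | 0, false => M.x0 ω
  | t + 1, false => M.f t (run g ω t false) (run g ω t true) (M.w t ω)
  | t, true => fun j =>
      g j t
        (fun s i =>
          have _ : s.1 < t := M.lt_of_mem_shared s.2
          (M.h s.1 i (run g ω s.1 false) (M.z s.1 i ω), run g ω s.1 true i))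
        (fun s => M.h s.1 j (run g ω s.1 false) (M.z s.1 j ω), fun s => run g ω s.1 true j)
termination_by t b => (t, b.toNat)
decreasing_by
  all_goals
    try have h2 := s.2
    try simp only [Finset.mem_range, Finset.mem_Ico] at h2
    simp only [Prod.lex_def, Bool.toNat]
    simp
    try omega

/-- The state `X_t`. -/
def state (g : ∀ j, Strategy n Y U j) (t : ℕ) (ω : Ω) : X t := M.run g ω t false

/-- The action `U_t^j`. -/
def act (g : ∀ j, Strategy n Y U j) (t : ℕ) (j : Fin K) (ω : Ω) : U t j := M.run g ω t true j

/-- The observation `Y_t^j`. -/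
def obs (g : ∀ j, Strategy n Y U j) (t : ℕ) (j : Fin K) (ω : Ω) : Y t j :=
  M.h t j (M.state g t ω) (M.z t j ω)

/-- The common information `Δ_t`. -/
def shared (g : ∀ j, Strategy n Y U j) (t : ℕ) (ω : Ω) : Shared n Y U t :=
  sharedOf (fun s j => M.obs g s j ω) (fun s j => M.act g s j ω) t

/-- The private information `Λ_t^j`. -/
def priv (g : ∀ j, Strategy n Y U j) (t : ℕ) (j : Fin K) (ω : Ω) : Private n Y U t j :=
  privateOf (fun s j => M.obs g s j ω) (fun s j => M.act g s j ω) t j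

theorem state_zero (g : ∀ j, Strategy n Y U j) (ω : Ω) : M.state g 0 ω = M.x0 ω := by
  simp only [state]
  rw [run]

theorem state_succ (g : ∀ j, Strategy n Y U j) (t : ℕ) (ω : Ω) :
    M.state g (t + 1) ω =
      M.f t (M.state g t ω) (fun j => M.act g t j ω) (M.w t ω) := by
  simp only [state, act]
  rw [run]

theorem act_eq (g : ∀ j, Strategy n Y U j) (t : ℕ) (j : Fin K) (ω : Ω) :
    M.act g t j ω = g j t (M.shared g t ω) (M.priv g t j ω) := by
  simp only [act]
  rw [run]
  rfl

/-! #### The private posterior -/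

/-- The information `I_t^k = (Δ_t, Λ_t^k)` of player `k`. -/
def info (g : ∀ j, Strategy n Y U j) (t : ℕ) (k : Fin K) (ω : Ω) :
    Shared n Y U t × Private n Y U t k :=
  (M.shared g t ω, M.priv g t k ω)

/-- The extended state `(X_t, Λ_t^{-k})`. -/
def extState (g : ∀ j, Strategy n Y U j) (t : ℕ) (k : Fin K) (ω : Ω) :
    X t × PrivateOthers n Y U t k :=
  (M.state g t ω, fun j => M.priv g t j.1 ω)

section Posterior

variable [IsProbabilityMeasure P]
  [∀ t, StandardBorelSpace (X t)] [∀ t, Nonempty (X t)]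
  [∀ t j, StandardBorelSpace (Y t j)] [∀ t j, Nonempty (Y t j)]
  [∀ t j, StandardBorelSpace (U t j)] [∀ t j, Nonempty (U t j)]

/-- The regular conditional distribution of `(X_t, Λ_t^{-k})` given `(Δ_t, Λ_t^k)`. -/
noncomputable def posterior (g : ∀ j, Strategy n Y U j) (t : ℕ) (k : Fin K) :
    Kernel (Shared n Y U t × Private n Y U t k) (X t × PrivateOthers n Y U t k) :=
  condDistrib (M.extState g t k) (M.info g t k) P

/-- The process `Ξ_t^k[Δ_t, Λ_t^k]`, with values in the measures on the space of `(x_t, λ_t^{-k})`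
(with the σ-algebra generated by the evaluations on measurable sets). -/
noncomputable def randomPosterior (g : ∀ j, Strategy n Y U j) (t : ℕ) (k : Fin K) (ω : Ω) :
    Measure (X t × PrivateOthers n Y U t k) :=
  M.posterior g t k (M.info g t k ω)

/-- The σ-algebra generated by `Δ_{0,t}, Λ_{0,t}^k, U_{0,t}^k`. -/
abbrev historyAlgebra (g : ∀ j, Strategy n Y U j) (t : ℕ) (k : Fin K) : MeasurableSpace Ω :=
  MeasurableSpace.comap
    (fun ω (s : Finset.range (t + 1)) => (M.shared g s.1 ω, M.priv g s.1 k ω, M.act g s.1 k ω))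
    inferInstance

/-- The triple `(Ξ_t^k, Δ_t, U_t^k)`. -/
noncomputable def markovState (g : ∀ j, Strategy n Y U j) (t : ℕ) (k : Fin K) (ω : Ω) :
    Measure (X t × PrivateOthers n Y U t k) × Shared n Y U t × U t k :=
  (M.randomPosterior g t k ω, M.shared g t ω, M.act g t k ω)

end Posterior

/-! #### Densities and the Bayes operator -/

/-- The integral `∫ F(x_t, λ_t^{-k}) dx_t dλ_t^{-k}`.  Observation coordinates are integrated
against their reference measures.  Action coordinates, which enter only through delta functions,
are integrated against counting measure: the delta function at `a` is then `u ↦ 1_{u = a}`, and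
`∑' u, F u * 1_{u = a} = F a`, whatever the action space. -/
noncomputable def integralExt (t : ℕ) (k : Fin K)
    (F : X t × PrivateOthers n Y U t k → ℝ≥0∞) : ℝ≥0∞ :=
  ∫⁻ x, ∫⁻ y : (j : {j : Fin K // j ≠ k}) → (s : Finset.Ico (t + 1 - n) (t + 1)) → Y s.1 j.1,
      ∑' u : (j : {j : Fin K // j ≠ k}) → (s : Finset.Ico (t + 1 - n) t) → U s.1 j.1,
        F (x, fun j => (y j, u j))
    ∂(Measure.pi fun j => Measure.pi fun s => M.νY s.1 j.1) ∂(M.νX t)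

/-- `q` is a PDF of the measure `μ` of `(x_t, λ_t^{-k})`. -/
def IsPDF (t : ℕ) (k : Fin K) (μ : Measure (X t × PrivateOthers n Y U t k))
    (q : X t × PrivateOthers n Y U t k → ℝ≥0∞) : Prop :=
  Measurable q ∧ ∀ A, MeasurableSet A → μ A = M.integralExt t k (A.indicator q)

/-- Division by the integral; zero if the integral is zero. -/
noncomputable def normalize (t : ℕ) (k : Fin K)
    (q : X t × PrivateOthers n Y U t k → ℝ≥0∞) : X t × PrivateOthers n Y U t k → ℝ≥0∞ :=
  open Classical in
  fun s => if M.integralExt t k q = 0 then 0 else q s / M.integralExt t k q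

/-- The product `Q_t^k(y^k | x_t) ∏_{j ≠ k} Q_t^j(y_t^j | x_t)`, where `y_t^j` is the last
observation in `λ_t^j`. -/
noncomputable def likelihood (t : ℕ) (k : Fin K) (yk : Y t k)
    (s : X t × PrivateOthers n Y U t k) : ℝ≥0∞ :=
  (M.Q t k yk s.1 : ℝ≥0∞) *
    ∏ j : {j : Fin K // j ≠ k},
      (M.Q t j.1 ((s.2 j).1 ⟨t, Finset.mem_Ico.2
        ⟨by have := M.one_le_delay; omega, Nat.lt_succ_self t⟩⟩) s.1 : ℝ≥0∞)

/-- The conditional PDF `P_0(x_0, y_0^{-k} | y_0^k)`. -/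
noncomputable def initialPDF (k : Fin K) (yk : Y 0 k) :
    X 0 × PrivateOthers n Y U 0 k → ℝ≥0∞ :=
  M.normalize 0 k fun s => M.likelihood 0 k yk s * (M.p0 s.1 : ℝ≥0∞)

/-- The product over `j ≠ k` of the delta functions at `u_t^j = a^j`, evaluated at the coordinates
`u_t^j` of `λ_{t+1}^{-k}`.  These coordinates are present only if `n ≥ 2`; otherwise
the product is `1`. -/
noncomputable def deltaProduct {t : ℕ} {k : Fin K} (a : ∀ j : {j : Fin K // j ≠ k}, U t j.1)
    (l : PrivateOthers n Y U (t + 1) k) : ℝ≥0∞ :=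
  if ht : t ∈ Finset.Ico (t + 1 + 1 - n) (t + 1) then
    ∏ j : {j : Fin K // j ≠ k}, ({a j} : Set (U t j.1)).indicator (fun _ => 1) ((l j).2 ⟨t, ht⟩)
  else 1

/-- The unnormalized operator.  The arguments are `y_{t+1}^k`, `u_t^k`, the functions
`γ^j = g_t^j(δ_t, ·)` for `j ≠ k`, the newly shared data `c = (y_{t-n+1}^{-k}, u_{t-n+1}^{-k})`,
through which `λ_t^{-k} = prevOthers c λ_{t+1}^{-k}`, and the previous posterior PDF `q`. -/
noncomputable def bayesUnnormalized (t : ℕ) (k : Fin K) (yk : Y (t + 1) k) (uk : U t k)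
    (γ : ∀ j : {j : Fin K // j ≠ k}, Private n Y U t j.1 → U t j.1) (c : Newly n Y U t k)
    (q : X t × PrivateOthers n Y U t k → ℝ≥0∞) :
    X (t + 1) × PrivateOthers n Y U (t + 1) k → ℝ≥0∞ :=
  fun s =>
    M.likelihood (t + 1) k yk s *
      ∫⁻ x, (M.S t s.1 x (join k uk fun j => γ j (prevOthers c s.2 j)) : ℝ≥0∞) *
        deltaProduct (fun j => γ j (prevOthers c s.2 j)) s.2 *
        q (x, prevOthers c s.2) ∂(M.νX t)

/-- The operator `T_{t+1}^k`. -/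
noncomputable def bayesOperator (t : ℕ) (k : Fin K) (yk : Y (t + 1) k) (uk : U t k)
    (γ : ∀ j : {j : Fin K // j ≠ k}, Private n Y U t j.1 → U t j.1) (c : Newly n Y U t k)
    (q : X t × PrivateOthers n Y U t k → ℝ≥0∞) :
    X (t + 1) × PrivateOthers n Y U (t + 1) k → ℝ≥0∞ :=
  M.normalize (t + 1) k (M.bayesUnnormalized t k yk uk γ c q)

end TeamModel

/-! The PDFs are defined by the recursion itself, so what has to be proved is that they are versions
of the posterior whatever player `k` does. Dropping the normalizations leaves `jointPDF`, a product
of the densities p_0, S, Q and of delta functions at the actions of g^{-k}, with the states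
integrated out. Player `k` enters only through the values u^k.

Under a full strategy profile the actions are functions of the observations (`actOf`). Along such a
path all delta functions equal 1, and `jointPDF` is the joint density of X_t and the observations up
to t with respect to the product reference measure (`lintegral_state_obsPath`). This is an induction
on t in which first Z_{t+1} and then W_t is averaged out, each being independent of what came
before. Next, the observations are split into those visible to player `k` and those hidden from him.
Altering hidden observations changes no visible action, so the information is a function of the
visible observations alone. Integration over the hidden ones is `integralExt`. Hence `jointPDF` is
the density of (information, extended state) over the pushforward μ of the visible reference measure
(`exists_lintegral_info_extState`). Only μ depends on g^k, and it cancels in Bayes' formula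
(`map_info_extState_eq_compProd`).

The Bayes operator is homogeneous of degree one, so normalizing at each step or only at the end
gives the same result as long as the normalizers are neither 0 nor ∞ (`posteriorPDF_eq_normalize`).
The normalizer is the density of the law of the information over μ, which makes this hold almost
surely (`ae_normalizer_ne`).

Action spaces may be uncountable, so counting measure need not be σ-finite and Tonelli is not
available for the action sums. `ConsistentSupport` replaces it: the PDFs vanish unless the hidden
actions are those generated by g^{-k}, so each sum has at most one nonzero term, at the measurable
point `hiddenAct`.

The Markov property needs no densities. The new data of player `k` and the next extended state are a
fixed function of (Δ_t, U_t^k), the present extended state and fresh noise (`nextPair_eq`). Given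
the information, their law is therefore `jointKernel` at (Ξ_t, Δ_t, U_t^k). Disintegrating it over
the new data gives `bayesKernel`, and uniqueness of conditional distributions identifies Ξ_{t+1}
with its value (`ae_randomPosterior_eq`). The law of Ξ_{t+1} given the information thus depends only
on (Ξ_t, Δ_t, U_t^k). By perfect recall the history generates the same σ-algebra as the present
information. -/

set_option linter.unusedSectionVars false

section Information

variable {K n : ℕ} {Y : ℕ → Fin K → Type uY} {U : ℕ → Fin K → Type uX}

/-! ### Paths of observations and actions -/

@[simp] theorem join_self {β : Fin K → Type*} (k : Fin K) (a : β k)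
    (b : ∀ j : {j : Fin K // j ≠ k}, β j.1) : join k a b k = a := by
  simp [join, Equiv.piSplitAt]

@[simp] theorem join_val {β : Fin K → Type*} (k : Fin K) (a : β k)
    (b : ∀ j : {j : Fin K // j ≠ k}, β j.1) (j : {j : Fin K // j ≠ k}) :
    join k a b j.1 = b j := by
  simp [join, Equiv.piSplitAt, j.2]

theorem join_of_ne {β : Fin K → Type*} (k : Fin K) (a : β k)
    (b : ∀ j : {j : Fin K // j ≠ k}, β j.1) {j : Fin K} (hj : j ≠ k) :
    join k a b j = b ⟨j, hj⟩ := join_val k a b ⟨j, hj⟩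

theorem join_eta {β : Fin K → Type*} (k : Fin K) (a : ∀ j, β j) :
    join k (a k) (fun j : {j : Fin K // j ≠ k} => a j.1) = a := by
  funext j
  by_cases hj : j = k
  · subst hj; simp
  · rw [join_of_ne _ _ _ hj]

theorem measurable_join {β : Fin K → Type*} [∀ j, MeasurableSpace (β j)] (k : Fin K) :
    Measurable fun p : β k × (∀ j : {j : Fin K // j ≠ k}, β j.1) => join k p.1 p.2 := by
  refine measurable_pi_iff.2 fun j => ?_
  by_cases hj : j = k
  · subst hj; simpa using measurable_fst
  · simp only [join_of_ne _ _ _ hj]; fun_prop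

theorem sharedOf_congr {y y' : ∀ s j, Y s j} {u u' : ∀ s j, U s j} {t : ℕ}
    (hy : ∀ s < t + 1 - n, ∀ j, y s j = y' s j) (hu : ∀ s < t + 1 - n, ∀ j, u s j = u' s j) :
    (sharedOf y u t : Shared n Y U t) = sharedOf y' u' t := by
  funext s j
  simp only [sharedOf, hy s.1 (Finset.mem_range.1 s.2) j, hu s.1 (Finset.mem_range.1 s.2) j]

theorem privateOf_congr {y y' : ∀ s j, Y s j} {u u' : ∀ s j, U s j} {t : ℕ} {j : Fin K}
    (hy : ∀ s, t + 1 - n ≤ s → s < t + 1 → y s j = y' s j)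
    (hu : ∀ s, t + 1 - n ≤ s → s < t → u s j = u' s j) :
    (privateOf y u t j : Private n Y U t j) = privateOf y' u' t j := by
  refine Prod.ext ?_ ?_ <;> funext s <;> have hs := Finset.mem_Ico.1 s.2 <;>
    simp [privateOf, hy s.1 hs.1, hu s.1 hs.1, hs.2]

theorem newlyOf_congr {y y' : ∀ s j, Y s j} {u u' : ∀ s j, U s j} {t : ℕ} {k : Fin K}
    (hy : ∀ s, t + 1 - n ≤ s → s < t + 1 + 1 - n → ∀ j ≠ k, y s j = y' s j)
    (hu : ∀ s, t + 1 - n ≤ s → s < t + 1 + 1 - n → ∀ j ≠ k, u s j = u' s j) :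
    (newlyOf y u t k : Newly n Y U t k) = newlyOf y' u' t k := by
  funext s j
  have hs := Finset.mem_Ico.1 s.2
  simp [newlyOf, hy s.1 hs.1 hs.2 j.1 j.2, hu s.1 hs.1 hs.2 j.1 j.2]

/-- The information of player `k` along a path. -/
def infoOf (y : ∀ s j, Y s j) (u : ∀ s j, U s j) (t : ℕ) (k : Fin K) :
    Shared n Y U t × Private n Y U t k :=
  (sharedOf y u t, privateOf y u t k)

/-- The private information of the players other than `k` along a path. -/
def othersOf (y : ∀ s j, Y s j) (u : ∀ s j, U s j) (t : ℕ) (k : Fin K) :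
    PrivateOthers n Y U t k :=
  fun j => privateOf y u t j.1

/-- The condition `s < t + 1 - n ∨ j = k` describes the coordinates visible to player `k` at time
`t`. A delay of at least one keeps the shared times below `t`, so the actions need to agree only
before `t`. -/
theorem infoOf_congr {y y' : ∀ s j, Y s j} {u u' : ∀ s j, U s j} {t : ℕ} {k : Fin K}
    (hy : ∀ s < t + 1, ∀ j, (s < t + 1 - n ∨ j = k) → y s j = y' s j)
    (hu : ∀ s < t, ∀ j, (s < t + 1 - n ∨ j = k) → u s j = u' s j) (hn : 1 ≤ n) :
    (infoOf y u t k : Shared n Y U t × Private n Y U t k) = infoOf y' u' t k :=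
  Prod.ext
    (sharedOf_congr (fun s hs j => hy s (by omega) j (Or.inl hs))
      (fun s hs j => hu s (by omega) j (Or.inl hs)))
    (privateOf_congr (fun s _ hs => hy s hs k (Or.inr rfl)) (fun s _ hs => hu s hs k (Or.inr rfl)))

theorem othersOf_congr {y y' : ∀ s j, Y s j} {u u' : ∀ s j, U s j} {t : ℕ} {k : Fin K}
    (hy : ∀ s, t + 1 - n ≤ s → s < t + 1 → ∀ j ≠ k, y s j = y' s j)
    (hu : ∀ s, t + 1 - n ≤ s → s < t → ∀ j ≠ k, u s j = u' s j) :
    (othersOf y u t k : PrivateOthers n Y U t k) = othersOf y' u' t k :=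
  funext fun j => privateOf_congr (fun s h h' => hy s h h' j.1 j.2) (fun s h h' => hu s h h' j.1 j.2)

/-! ### Paths with prescribed information -/

section Path

variable [∀ t j, Nonempty (Y t j)] [∀ t j, Nonempty (U t j)]

/-- A path of observations with prescribed information. -/
noncomputable def pathObs {t : ℕ} {k : Fin K} (i : Shared n Y U t × Private n Y U t k)
    (l : PrivateOthers n Y U t k) : ∀ s j, Y s j := fun s =>
  if h : s < t + 1 - n then fun j => (i.1 ⟨s, Finset.mem_range.2 h⟩ j).1
  else if h' : s < t + 1 then
    join k (i.2.1 ⟨s, Finset.mem_Ico.2 ⟨not_lt.1 h, h'⟩⟩)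
      fun j => (l j).1 ⟨s, Finset.mem_Ico.2 ⟨not_lt.1 h, h'⟩⟩
  else fun _ => Classical.arbitrary _

/-- A path of actions with prescribed information. -/
noncomputable def pathAct {t : ℕ} {k : Fin K} (i : Shared n Y U t × Private n Y U t k)
    (l : PrivateOthers n Y U t k) : ∀ s j, U s j := fun s =>
  if h : s < t + 1 - n then fun j => (i.1 ⟨s, Finset.mem_range.2 h⟩ j).2
  else if h' : s < t then
    join k (i.2.2 ⟨s, Finset.mem_Ico.2 ⟨not_lt.1 h, h'⟩⟩)
      fun j => (l j).2 ⟨s, Finset.mem_Ico.2 ⟨not_lt.1 h, h'⟩⟩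
  else fun _ => Classical.arbitrary _

theorem pathObs_infoOf (y : ∀ s j, Y s j) (u : ∀ s j, U s j) {t : ℕ} {k : Fin K}
    (l : PrivateOthers n Y U t k) {s : ℕ} (hs : s < t + 1) {j : Fin K}
    (hj : s < t + 1 - n ∨ j = k) : pathObs (infoOf y u t k) l s j = y s j := by
  by_cases h : s < t + 1 - n
  · simp [pathObs, h, infoOf, sharedOf]
  · obtain rfl := hj.resolve_left h
    simp [pathObs, h, hs, infoOf, privateOf]

theorem pathAct_infoOf (y : ∀ s j, Y s j) (u : ∀ s j, U s j) {t : ℕ} {k : Fin K}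
    (l : PrivateOthers n Y U t k) {s : ℕ} (hs : s < t) {j : Fin K}
    (hj : s < t + 1 - n ∨ j = k) : pathAct (infoOf y u t k) l s j = u s j := by
  by_cases h : s < t + 1 - n
  · simp [pathAct, h, infoOf, sharedOf]
  · obtain rfl := hj.resolve_left h
    simp [pathAct, h, hs, infoOf, privateOf]

theorem pathObs_othersOf (y : ∀ s j, Y s j) (u : ∀ s j, U s j) {t : ℕ} {k : Fin K}
    (i : Shared n Y U t × Private n Y U t k) {s : ℕ} (hs : s < t + 1) (hs' : t + 1 - n ≤ s)
    {j : Fin K} (hj : j ≠ k) : pathObs i (othersOf y u t k) s j = y s j := by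
  simp [pathObs, not_lt.2 hs', hs, othersOf, privateOf, join_of_ne _ _ _ hj]

theorem pathAct_othersOf (y : ∀ s j, Y s j) (u : ∀ s j, U s j) {t : ℕ} {k : Fin K}
    (i : Shared n Y U t × Private n Y U t k) {s : ℕ} (hs : s < t) (hs' : t + 1 - n ≤ s)
    {j : Fin K} (hj : j ≠ k) : pathAct i (othersOf y u t k) s j = u s j := by
  simp [pathAct, not_lt.2 hs', hs, othersOf, privateOf, join_of_ne _ _ _ hj]

/-- Together with `othersOf_path`: every pair of information and hidden data comes from a path, so
statements about all realizations may be proved along paths. -/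
theorem infoOf_path {t : ℕ} {k : Fin K} (i : Shared n Y U t × Private n Y U t k)
    (l : PrivateOthers n Y U t k) : infoOf (pathObs i l) (pathAct i l) t k = i := by
  refine Prod.ext ?_ (Prod.ext ?_ ?_)
  · funext s j
    have hs := Finset.mem_range.1 s.2
    simp [infoOf, sharedOf, pathObs, pathAct, hs]
  · funext s
    have hs := Finset.mem_Ico.1 s.2
    simp [infoOf, privateOf, pathObs, not_lt.2 hs.1, Nat.le_of_lt_succ hs.2]
  · funext s
    have hs := Finset.mem_Ico.1 s.2
    simp [infoOf, privateOf, pathAct, not_lt.2 hs.1, hs.2]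

theorem othersOf_path {t : ℕ} {k : Fin K} (i : Shared n Y U t × Private n Y U t k)
    (l : PrivateOthers n Y U t k) : othersOf (pathObs i l) (pathAct i l) t k = l := by
  funext j
  refine Prod.ext ?_ ?_ <;> funext s <;> have hs := Finset.mem_Ico.1 s.2 <;>
    simp [othersOf, privateOf, pathObs, pathAct, not_lt.2 hs.1, hs.2, Nat.le_of_lt_succ]

end Path

/-! ### Measurability of paths and of the data read off them -/

section Measurability

variable [∀ t j, MeasurableSpace (Y t j)] [∀ t j, MeasurableSpace (U t j)]

theorem measurable_sharedOf (t : ℕ) :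
    Measurable fun p : (∀ s j, Y s j) × (∀ s j, U s j) =>
      (sharedOf p.1 p.2 t : Shared n Y U t) := by
  unfold sharedOf; fun_prop

theorem measurable_sharedOf_comp {α : Type*} {mα : MeasurableSpace α} {t : ℕ}
    {y : α → ∀ s j, Y s j} {u : α → ∀ s j, U s j}
    (hy : ∀ s < t + 1 - n, ∀ j, Measurable fun a => y a s j)
    (hu : ∀ s < t + 1 - n, ∀ j, Measurable fun a => u a s j) :
    Measurable fun a => (sharedOf (y a) (u a) t : Shared n Y U t) :=
  measurable_pi_iff.2 fun s => measurable_pi_iff.2 fun j =>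
    (hy s.1 (Finset.mem_range.1 s.2) j).prodMk (hu s.1 (Finset.mem_range.1 s.2) j)

theorem measurable_privateOf_comp {α : Type*} {mα : MeasurableSpace α} {t : ℕ} {j : Fin K}
    {y : α → ∀ s j, Y s j} {u : α → ∀ s j, U s j}
    (hy : ∀ s, t + 1 - n ≤ s → s < t + 1 → Measurable fun a => y a s j)
    (hu : ∀ s, t + 1 - n ≤ s → s < t → Measurable fun a => u a s j) :
    Measurable fun a => (privateOf (y a) (u a) t j : Private n Y U t j) :=
  (measurable_pi_iff.2 fun s =>
      hy s.1 (Finset.mem_Ico.1 s.2).1 (Finset.mem_Ico.1 s.2).2).prodMk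
    (measurable_pi_iff.2 fun s => hu s.1 (Finset.mem_Ico.1 s.2).1 (Finset.mem_Ico.1 s.2).2)

theorem measurable_othersOf_comp {α : Type*} {mα : MeasurableSpace α} {t : ℕ} {k : Fin K}
    {y : α → ∀ s j, Y s j} {u : α → ∀ s j, U s j}
    (hy : ∀ s < t + 1, ∀ j, Measurable fun a => y a s j)
    (hu : ∀ s < t, ∀ j, Measurable fun a => u a s j) :
    Measurable fun a => (othersOf (y a) (u a) t k : PrivateOthers n Y U t k) :=
  measurable_pi_iff.2 fun j =>
    measurable_privateOf_comp (fun s _ hs => hy s hs j.1) (fun s _ hs => hu s hs j.1)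

theorem measurable_infoOf_comp {α : Type*} {mα : MeasurableSpace α} {t : ℕ} {k : Fin K} (hn : 1 ≤ n)
    {y : α → ∀ s j, Y s j} {u : α → ∀ s j, U s j}
    (hy : ∀ s < t + 1, ∀ j, Measurable fun a => y a s j)
    (hu : ∀ s < t, ∀ j, Measurable fun a => u a s j) :
    Measurable fun a => (infoOf (y a) (u a) t k : Shared n Y U t × Private n Y U t k) :=
  (measurable_sharedOf_comp (fun s hs => hy s (by omega)) (fun s hs => hu s (by omega))).prodMk
    (measurable_privateOf_comp (fun s _ hs => hy s hs k) (fun s _ hs => hu s hs k))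

theorem measurable_newlyOf (t : ℕ) (k : Fin K) :
    Measurable fun p : (∀ s j, Y s j) × (∀ s j, U s j) =>
      (newlyOf p.1 p.2 t k : Newly n Y U t k) := by
  unfold newlyOf; fun_prop

theorem measurable_prevOthers (t : ℕ) (k : Fin K) :
    Measurable fun p : Newly n Y U t k × PrivateOthers n Y U (t + 1) k => prevOthers p.1 p.2 := by
  refine measurable_pi_iff.2 fun j => Measurable.prodMk ?_ ?_ <;>
  · refine measurable_pi_iff.2 fun s => ?_
    by_cases hs : s.1 < t + 1 + 1 - n <;> simp only [hs, dite_true, dite_false] <;> fun_prop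

variable [∀ t j, Nonempty (Y t j)] [∀ t j, Nonempty (U t j)]

theorem measurable_pathObs (t : ℕ) (k : Fin K) :
    Measurable fun p : (Shared n Y U t × Private n Y U t k) × PrivateOthers n Y U t k =>
      pathObs p.1 p.2 := by
  refine measurable_pi_iff.2 fun s => ?_
  by_cases h : s < t + 1 - n
  · simp only [pathObs, h, dite_true]; fun_prop
  by_cases h' : s < t + 1
  · simp only [pathObs, h, h', dite_true, dite_false]
    refine (measurable_join k).comp (Measurable.prodMk ?_ ?_) <;> fun_prop
  · simp only [pathObs, h, h', dite_false]; fun_prop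

theorem measurable_pathAct (t : ℕ) (k : Fin K) :
    Measurable fun p : (Shared n Y U t × Private n Y U t k) × PrivateOthers n Y U t k =>
      pathAct p.1 p.2 := by
  refine measurable_pi_iff.2 fun s => ?_
  by_cases h : s < t + 1 - n
  · simp only [pathAct, h, dite_true]; fun_prop
  by_cases h' : s < t
  · simp only [pathAct, h, h', dite_true, dite_false]
    refine (measurable_join k).comp (Measurable.prodMk ?_ ?_) <;> fun_prop
  · simp only [pathAct, h, h', dite_false]; fun_prop

end Measurability

/-! ### Actions generated by strategies along a path of observations -/

open Classical in
/-- The actions with time and player in `A` are computed from the strategies, the others are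
prescribed. -/
noncomputable def fill (hn : 1 ≤ n) (A : ℕ → Fin K → Prop) (g : ∀ j, Strategy n Y U j)
    (y : ∀ s j, Y s j) (u : ∀ s j, U s j) (t : ℕ) (j : Fin K) : U t j :=
  if A t j then
    g j t
      (fun s i =>
        have _ : s.1 < t := by have := Finset.mem_range.1 s.2; omega
        (y s.1 i, fill hn A g y u s.1 i))
      (fun s => y s.1 j, fun s => fill hn A g y u s.1 j)
  else u t j
termination_by t
decreasing_by
  · assumption
  · exact (Finset.mem_Ico.1 s.2).2

variable {hn : 1 ≤ n} {A : ℕ → Fin K → Prop} {g : ∀ j, Strategy n Y U j}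

theorem fill_of_mem {y : ∀ s j, Y s j} {u : ∀ s j, U s j} {t : ℕ} {j : Fin K} (h : A t j) :
    fill hn A g y u t j =
      g j t (sharedOf y (fill hn A g y u) t) (privateOf y (fill hn A g y u) t j) := by
  rw [fill, if_pos h]; rfl

theorem fill_of_notMem {y : ∀ s j, Y s j} {u : ∀ s j, U s j} {t : ℕ} {j : Fin K} (h : ¬ A t j) :
    fill hn A g y u t j = u t j := by
  rw [fill, if_neg h]

/-- Uniqueness of the closed loop, by strong induction on time: a strategy at time `s` reads
observations up to `s` and, since the delay is at least one, only actions before `s`. Agreement of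
the observations before `m` therefore suffices. -/
theorem eq_fill {y y' : ∀ s j, Y s j} {u v : ∀ s j, U s j} {m : ℕ}
    (hy : ∀ s < m, ∀ j, y' s j = y s j)
    (hv : ∀ s < m, ∀ j, A s j → v s j = g j s (sharedOf y' v s) (privateOf y' v s j))
    (hu : ∀ s < m, ∀ j, ¬ A s j → v s j = u s j) :
    ∀ s < m, ∀ j, v s j = fill hn A g y u s j := by
  intro s
  induction s using Nat.strong_induction_on with
  | _ s ih =>
    intro hs j
    by_cases h : A s j
    · rw [hv s hs j h, fill_of_mem h,
        sharedOf_congr (y' := y) (u' := fill hn A g y u) (fun r hr i => hy r (by omega) i)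
          (fun r hr i => ih r (by omega) (by omega) i),
        privateOf_congr (y' := y) (u' := fill hn A g y u) (fun r _ hr => hy r (by omega) j)
          (fun r _ hr => ih r (by omega) (by omega) j)]
    · rw [hu s hs j h, fill_of_notMem h]

theorem measurable_fill [∀ t j, MeasurableSpace (Y t j)] [∀ t j, MeasurableSpace (U t j)] {T : ℕ}
    (hg : ∀ t < T, ∀ j, A t j →
      Measurable fun i : Shared n Y U t × Private n Y U t j => g j t i.1 i.2)
    {t : ℕ} (ht : t < T) (j : Fin K) :
    Measurable fun p : (∀ s j, Y s j) × (∀ s j, U s j) => fill hn A g p.1 p.2 t j := by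
  induction t using Nat.strong_induction_on generalizing j with
  | _ t ih =>
    by_cases h : A t j
    · simp only [fill_of_mem h]
      refine (hg t ht j h).comp (Measurable.prodMk ?_ ?_)
      · exact measurable_sharedOf_comp (fun s _ i => by fun_prop)
          fun s hs i => ih s (by omega) (by omega) i
      · exact measurable_privateOf_comp (fun s _ _ => by fun_prop)
          fun s _ hs => ih s (by omega) (by omega) j
    · simp only [fill_of_notMem h]; fun_prop

end Information

namespace TeamModel

variable {T n K : ℕ} {Ω : Type uΩ} [MeasurableSpace Ω] {P : Measure Ω}
  {X : ℕ → Type uX} {Y : ℕ → Fin K → Type uY} {U : ℕ → Fin K → Type uX}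
  {W : ℕ → Type uW} {Z : ℕ → Fin K → Type uZ}
  [∀ t, MeasurableSpace (X t)] [∀ t j, MeasurableSpace (Y t j)]
  [∀ t j, MeasurableSpace (U t j)] [∀ t, MeasurableSpace (W t)]
  [∀ t j, MeasurableSpace (Z t j)]
  (M : TeamModel T n K P X Y U W Z)

/-! ### Integrals over the extended state -/

/-- Values of the hidden observations. -/
abbrev HiddenObs (n : ℕ) (Y : ℕ → Fin K → Type uY) (t : ℕ) (k : Fin K) : Type uY :=
  (j : {j : Fin K // j ≠ k}) → (s : Finset.Ico (t + 1 - n) (t + 1)) → Y s.1 j.1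

/-- Values of the hidden actions. -/
abbrev HiddenAct (n : ℕ) (U : ℕ → Fin K → Type uX) (t : ℕ) (k : Fin K) : Type uX :=
  (j : {j : Fin K // j ≠ k}) → (s : Finset.Ico (t + 1 - n) t) → U s.1 j.1

/-- Reference measure of the hidden observations. -/
noncomputable abbrev hiddenMeasure (t : ℕ) (k : Fin K) : Measure (HiddenObs n Y t k) :=
  Measure.pi fun j => Measure.pi fun s => M.νY s.1 j.1

theorem sigmaFinite_hidden {t : ℕ} (ht : t ≤ T) (k : Fin K) (j : {j : Fin K // j ≠ k})
    (s : Finset.Ico (t + 1 - n) (t + 1)) : SigmaFinite (M.νY s.1 j.1) :=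
  M.sigmaFinite_νY s.1 (by have := (Finset.mem_Ico.1 s.2).2; omega) j.1

theorem sigmaFinite_hiddenMeasure {t : ℕ} (ht : t ≤ T) (k : Fin K) :
    SigmaFinite (M.hiddenMeasure t k) := by
  have := M.sigmaFinite_hidden ht k
  infer_instance

/-- The sum over hidden actions has at most one nonzero term. What remains are integrals against
σ-finite measures at times within the horizon, where Tonelli applies. -/
theorem integralExt_eq_of_support {t : ℕ} {k : Fin K} {F : X t × PrivateOthers n Y U t k → ℝ≥0∞}
    (a : HiddenObs n Y t k → HiddenAct n U t k)
    (hF : ∀ x y u, F (x, fun j => (y j, u j)) ≠ 0 → u = a y) :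
    M.integralExt t k F = ∫⁻ x, ∫⁻ y, F (x, fun j => (y j, a y j)) ∂M.hiddenMeasure t k ∂M.νX t := by
  refine lintegral_congr fun x => lintegral_congr fun y => ?_
  refine tsum_eq_single (a y) fun u hu => ?_
  by_contra h
  exact hu (hF x y u h)

theorem measurable_integralExt {ι : Type*} [MeasurableSpace ι] {t : ℕ} (ht : t ≤ T) {k : Fin K}
    {F : ι → X t × PrivateOthers n Y U t k → ℝ≥0∞} (hFm : Measurable (Function.uncurry F))
    (a : ι → HiddenObs n Y t k → HiddenAct n U t k) (ha : Measurable (Function.uncurry a))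
    (hF : ∀ i x y u, F i (x, fun j => (y j, u j)) ≠ 0 → u = a i y) :
    Measurable fun i => M.integralExt t k (F i) := by
  have := M.sigmaFinite_νX t ht
  have := M.sigmaFinite_hiddenMeasure ht k
  simp only [M.integralExt_eq_of_support (a _) (hF _)]
  refine Measurable.lintegral_prod_right' (f := fun p : ι × X t =>
    ∫⁻ y, F p.1 (p.2, fun j => (y j, a p.1 y j)) ∂M.hiddenMeasure t k) ?_
  refine Measurable.lintegral_prod_right' (f := fun p : (ι × X t) × HiddenObs n Y t k =>
    F p.1.1 (p.1.2, fun j => (p.2 j, a p.1.1 p.2 j))) ?_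
  have h : Measurable fun p : (ι × X t) × HiddenObs n Y t k => a p.1.1 p.2 :=
    ha.comp (by fun_prop : Measurable fun p : (ι × X t) × HiddenObs n Y t k => (p.1.1, p.2))
  refine hFm.comp (by fun_prop : Measurable fun p : (ι × X t) × HiddenObs n Y t k =>
    (p.1.1, (p.1.2, fun j => (p.2 j, a p.1.1 p.2 j))))

theorem integralExt_const_mul {t : ℕ} {k : Fin K} {c : ℝ≥0∞} (hc : c ≠ ∞)
    (F : X t × PrivateOthers n Y U t k → ℝ≥0∞) :
    M.integralExt t k (fun s => c * F s) = c * M.integralExt t k F := by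
  simp only [integralExt, ENNReal.tsum_mul_left, lintegral_const_mul' _ _ hc]

theorem integralExt_mono {t : ℕ} {k : Fin K} {F G : X t × PrivateOthers n Y U t k → ℝ≥0∞}
    (h : ∀ s, F s ≤ G s) : M.integralExt t k F ≤ M.integralExt t k G :=
  lintegral_mono fun _ => lintegral_mono fun _ => ENNReal.tsum_le_tsum fun _ => h _

theorem normalize_const_mul {t : ℕ} {k : Fin K} {c : ℝ≥0∞} (hc : c ≠ ∞) (hc' : c ≠ 0)
    (F : X t × PrivateOthers n Y U t k → ℝ≥0∞) :
    M.normalize t k (fun s => c * F s) = M.normalize t k F := by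
  funext s
  simp only [normalize, M.integralExt_const_mul hc, mul_eq_zero, hc', false_or]
  split_ifs with h
  · rfl
  · exact ENNReal.mul_div_mul_left _ _ hc' hc

theorem normalize_ne_zero {t : ℕ} {k : Fin K} {F : X t × PrivateOthers n Y U t k → ℝ≥0∞} {s}
    (h : M.normalize t k F s ≠ 0) : F s ≠ 0 := by
  intro h0
  simp [normalize, h0] at h

theorem measurable_normalize {ι : Type*} [MeasurableSpace ι] {t : ℕ} {k : Fin K}
    {F : ι → X t × PrivateOthers n Y U t k → ℝ≥0∞} (hF : Measurable (Function.uncurry F))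
    (hI : Measurable fun i => M.integralExt t k (F i)) :
    Measurable (Function.uncurry fun i => M.normalize t k (F i)) := by
  have hI' : Measurable fun p : ι × (X t × PrivateOthers n Y U t k) =>
    M.integralExt t k (F p.1) := hI.comp measurable_fst
  exact Measurable.ite (hI' (measurableSet_singleton 0)) measurable_const (hF.div hI')

/-! ### The Bayes operator -/

theorem measurable_likelihood {t : ℕ} (ht : t ≤ T) (k : Fin K) :
    Measurable fun p : Y t k × (X t × PrivateOthers n Y U t k) => M.likelihood t k p.1 p.2 := by
  unfold likelihood
  have hmem : t ∈ Finset.Ico (t + 1 - n) (t + 1) :=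
    Finset.mem_Ico.2 ⟨by have := M.one_le_delay; omega, Nat.lt_succ_self t⟩
  refine Measurable.mul ?_ (Finset.measurable_prod _ fun j _ => ?_)
  · exact ((M.measurable_Q t ht k).comp (by fun_prop :
      Measurable fun p : Y t k × (X t × PrivateOthers n Y U t k) => (p.1, p.2.1))).coe_nnreal_ennreal
  · exact ((M.measurable_Q t ht j.1).comp (by fun_prop :
      Measurable fun p : Y t k × (X t × PrivateOthers n Y U t k) =>
        ((p.2.2 j).1 ⟨t, hmem⟩, p.2.1))).coe_nnreal_ennreal

theorem measurable_deltaProduct [∀ t j, StandardBorelSpace (U t j)] (t : ℕ) (k : Fin K) :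
    Measurable fun p : (∀ j : {j : Fin K // j ≠ k}, U t j.1) × PrivateOthers n Y U (t + 1) k =>
      deltaProduct p.1 p.2 := by
  unfold deltaProduct
  by_cases ht : t ∈ Finset.Ico (t + 1 + 1 - n) (t + 1)
  · simp only [ht, dite_true]
    refine Finset.measurable_prod _ fun j _ => ?_
    have : Measurable fun p : U t j.1 × U t j.1 =>
        ({p.1} : Set (U t j.1)).indicator (fun _ => (1 : ℝ≥0∞)) p.2 := by
      -- Joint measurability of the delta function is measurability of the diagonal, which standard
      -- Borel action spaces provide.
      have h : MeasurableSet {p : U t j.1 × U t j.1 | p.2 = p.1} :=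
        measurableSet_eq_fun measurable_snd measurable_fst
      exact (measurable_const (a := (1 : ℝ≥0∞))).indicator h
    exact this.comp (by fun_prop :
      Measurable fun p : (∀ j : {j : Fin K // j ≠ k}, U t j.1) × PrivateOthers n Y U (t + 1) k =>
        (p.1 j, (p.2 j).2 ⟨t, ht⟩))
  · simp only [ht, dite_false]; fun_prop

theorem deltaProduct_othersOf {t : ℕ} {k : Fin K} {y : ∀ s j, Y s j} {u : ∀ s j, U s j}
    {a : ∀ j : {j : Fin K // j ≠ k}, U t j.1} (h : ∀ j : {j : Fin K // j ≠ k}, u t j.1 = a j) :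
    deltaProduct a (othersOf y u (t + 1) k : PrivateOthers n Y U (t + 1) k) = 1 := by
  unfold deltaProduct
  split_ifs with ht
  · refine Finset.prod_eq_one fun j _ => ?_
    simp [othersOf, privateOf, h]
  · rfl

/-- The hypothesis `ht` amounts to `2 ≤ n`. For `n = 1` the action at time `t` is already shared at
`t + 1`, and the delta product carries no information. -/
theorem eq_of_deltaProduct_ne_zero {t : ℕ} {k : Fin K} {y : ∀ s j, Y s j} {u : ∀ s j, U s j}
    {a : ∀ j : {j : Fin K // j ≠ k}, U t j.1}
    (h : deltaProduct a (othersOf y u (t + 1) k : PrivateOthers n Y U (t + 1) k) ≠ 0)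
    (ht : t + 1 + 1 - n ≤ t) (j : {j : Fin K // j ≠ k}) : u t j.1 = a j := by
  rw [deltaProduct, dif_pos (Finset.mem_Ico.2 ⟨ht, Nat.lt_succ_self t⟩)] at h
  have := Finset.prod_ne_zero_iff.1 h j (Finset.mem_univ _)
  simpa [othersOf, privateOf] using this

theorem measurable_bayesUnnormalized [∀ t j, StandardBorelSpace (U t j)] {ι : Type*}
    [MeasurableSpace ι] {t : ℕ} (ht : t < T) {k : Fin K} {yk : ι → Y (t + 1) k} {uk : ι → U t k}
    {γ : ι → ∀ j : {j : Fin K // j ≠ k}, Private n Y U t j.1 → U t j.1}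
    {c : ι → Newly n Y U t k} {q : ι → X t × PrivateOthers n Y U t k → ℝ≥0∞}
    (hyk : Measurable yk) (huk : Measurable uk)
    (hγ : ∀ j, Measurable fun p : ι × Private n Y U t j.1 => γ p.1 j p.2)
    (hc : Measurable c) (hq : Measurable (Function.uncurry q)) :
    Measurable (Function.uncurry fun i => M.bayesUnnormalized t k (yk i) (uk i) (γ i) (c i) (q i)) := by
  have := M.sigmaFinite_νX t ht.le
  have hprev : Measurable fun p : ι × (X (t + 1) × PrivateOthers n Y U (t + 1) k) =>
      prevOthers (c p.1) p.2.2 :=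
    (measurable_prevOthers t k).comp (by fun_prop :
      Measurable fun p : ι × (X (t + 1) × PrivateOthers n Y U (t + 1) k) => (c p.1, p.2.2))
  have hact : Measurable fun p : ι × (X (t + 1) × PrivateOthers n Y U (t + 1) k) =>
      fun j => γ p.1 j (prevOthers (c p.1) p.2.2 j) :=
    measurable_pi_iff.2 fun j => (hγ j).comp
      (measurable_fst.prodMk ((measurable_pi_apply j).comp hprev))
  unfold bayesUnnormalized
  refine Measurable.mul ((M.measurable_likelihood (Nat.succ_le_of_lt ht) k).comp (by fun_prop :
    Measurable fun p : ι × (X (t + 1) × PrivateOthers n Y U (t + 1) k) => (yk p.1, p.2))) ?_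
  refine Measurable.lintegral_prod_right' (f := fun p :
    (ι × (X (t + 1) × PrivateOthers n Y U (t + 1) k)) × X t =>
      (M.S t p.1.2.1 p.2 (join k (uk p.1.1) fun j => γ p.1.1 j (prevOthers (c p.1.1) p.1.2.2 j)) : ℝ≥0∞)
      * deltaProduct (fun j => γ p.1.1 j (prevOthers (c p.1.1) p.1.2.2 j)) p.1.2.2
      * q p.1.1 (p.2, prevOthers (c p.1.1) p.1.2.2)) ?_
  refine Measurable.mul (Measurable.mul ?_ ?_) ?_
  · refine ((M.measurable_S t ht).comp ((by fun_prop : Measurable fun p :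
      (ι × (X (t + 1) × PrivateOthers n Y U (t + 1) k)) × X t => p.1.2.1).prodMk
        (measurable_snd.prodMk ((measurable_join k).comp
          ((by fun_prop : Measurable fun p :
      (ι × (X (t + 1) × PrivateOthers n Y U (t + 1) k)) × X t => uk p.1.1).prodMk
            (hact.comp measurable_fst)))))).coe_nnreal_ennreal
  · exact (measurable_deltaProduct t k).comp ((hact.comp measurable_fst).prodMk
      (by fun_prop : Measurable fun p :
        (ι × (X (t + 1) × PrivateOthers n Y U (t + 1) k)) × X t => p.1.2.2))
  · exact hq.comp ((measurable_fst.comp measurable_fst).prodMk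
      (measurable_snd.prodMk (hprev.comp measurable_fst)))

/-- Homogeneity in the prior density; this is what lets intermediate normalizations be postponed. -/
theorem bayesUnnormalized_const_mul {t : ℕ} {k : Fin K} {yk : Y (t + 1) k} {uk : U t k}
    {γ : ∀ j : {j : Fin K // j ≠ k}, Private n Y U t j.1 → U t j.1} {c : Newly n Y U t k}
    {r : ℝ≥0∞} (hr : r ≠ ∞) (q : X t × PrivateOthers n Y U t k → ℝ≥0∞) :
    M.bayesUnnormalized t k yk uk γ c (fun s => r * q s) =
      fun s => r * M.bayesUnnormalized t k yk uk γ c q s := by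
  funext s
  simp only [bayesUnnormalized]
  rw [mul_left_comm, ← lintegral_const_mul' _ _ hr]
  simp only [mul_left_comm r]

/-! ### Recursive families of densities -/

section Recursion

/-- The actions of the players other than `k` in their private information follow `gm`. -/
def Consistent {k : Fin K} (gm : ∀ j : {j : Fin K // j ≠ k}, Strategy n Y U j.1) (t : ℕ)
    (y : ∀ s j, Y s j) (u : ∀ s j, U s j) : Prop :=
  ∀ s, t + 1 - n ≤ s → s < t → ∀ j : {j : Fin K // j ≠ k},
    u s j.1 = gm j s (sharedOf y u s) (privateOf y u s j.1)

/-- A function of the information of player `k` and the extended state is supported on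
consistent paths. -/
def ConsistentSupport {k : Fin K} (gm : ∀ j : {j : Fin K // j ≠ k}, Strategy n Y U j.1) (t : ℕ)
    (F : Shared n Y U t × Private n Y U t k → X t × PrivateOthers n Y U t k → ℝ≥0∞) : Prop :=
  ∀ x y u, F (infoOf y u t k) (x, othersOf y u t k) ≠ 0 → Consistent gm t y u

variable [∀ t j, Nonempty (Y t j)] [∀ t j, Nonempty (U t j)]

/-- The unnormalized initial density. -/
noncomputable def initPDF (k : Fin K) (i : Shared n Y U 0 × Private n Y U 0 k) :
    X 0 × PrivateOthers n Y U 0 k → ℝ≥0∞ :=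
  fun s => M.likelihood 0 k (pathObs i (Classical.arbitrary _) 0 k) s * (M.p0 s.1 : ℝ≥0∞)

/-- The unnormalized Bayes operator, applied to a family of densities. -/
noncomputable def stepPDF {k : Fin K} (gm : ∀ j : {j : Fin K // j ≠ k}, Strategy n Y U j.1) (t : ℕ)
    (q : Shared n Y U t × Private n Y U t k → X t × PrivateOthers n Y U t k → ℝ≥0∞)
    (i : Shared n Y U (t + 1) × Private n Y U (t + 1) k) :
    X (t + 1) × PrivateOthers n Y U (t + 1) k → ℝ≥0∞ :=
  let y : ∀ s j, Y s j := pathObs i (Classical.arbitrary _)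
  let u : ∀ s j, U s j := pathAct i (Classical.arbitrary _)
  M.bayesUnnormalized t k (y (t + 1) k) (u t k) (fun j => gm j t (sharedOf y u t))
    (newlyOf y u t k) (q (infoOf y u t k))

variable {k : Fin K} {gm : ∀ j : {j : Fin K // j ≠ k}, Strategy n Y U j.1}

theorem initPDF_infoOf (y : ∀ s j, Y s j) (u : ∀ s j, U s j) :
    M.initPDF k (infoOf y u 0 k) = fun s => M.likelihood 0 k (y 0 k) s * (M.p0 s.1 : ℝ≥0∞) := by
  funext s
  rw [initPDF, pathObs_infoOf _ _ _ (by omega) (Or.inr rfl)]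

/-- Apart from its density argument, the operator receives only data visible to player `k` at time
`t + 1`, and so does the index of that density. The arbitrary hidden entries used in `stepPDF` are
therefore irrelevant. -/
theorem stepPDF_infoOf (t : ℕ)
    (q : Shared n Y U t × Private n Y U t k → X t × PrivateOthers n Y U t k → ℝ≥0∞)
    (y : ∀ s j, Y s j) (u : ∀ s j, U s j) :
    M.stepPDF gm t q (infoOf y u (t + 1) k) =
      M.bayesUnnormalized t k (y (t + 1) k) (u t k)
        (fun j => gm j t (sharedOf y u t)) (newlyOf y u t k) (q (infoOf y u t k)) := by
  have hn := M.one_le_delay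
  have hy : ∀ s < t + 1 + 1, ∀ j, (s < t + 1 + 1 - n ∨ j = k) →
      pathObs (infoOf y u (t + 1) k : Shared n Y U (t + 1) × Private n Y U (t + 1) k)
        (Classical.arbitrary _) s j = y s j :=
    fun s hs j hj => pathObs_infoOf y u _ hs hj
  have hu : ∀ s < t + 1, ∀ j, (s < t + 1 + 1 - n ∨ j = k) →
      pathAct (infoOf y u (t + 1) k : Shared n Y U (t + 1) × Private n Y U (t + 1) k)
        (Classical.arbitrary _) s j = u s j :=
    fun s hs j hj => pathAct_infoOf y u _ hs hj
  rw [stepPDF]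
  rw [hy (t + 1) (by omega) k (Or.inr rfl), hu t (by omega) k (Or.inr rfl),
    sharedOf_congr (fun s hs j => hy s (by omega) j (Or.inl (by omega)))
      (fun s hs j => hu s (by omega) j (Or.inl (by omega))),
    newlyOf_congr (fun s _ hs j _ => hy s (by omega) j (Or.inl (by omega)))
      (fun s _ hs j _ => hu s (by omega) j (Or.inl (by omega))),
    infoOf_congr (fun s hs j hj => hy s (by omega) j (by omega))
      (fun s hs j hj => hu s (by omega) j (by omega)) hn]

theorem consistentSupport_initPDF : ConsistentSupport gm 0 (M.initPDF k) :=
  fun _ _ _ _ s _ hs => absurd hs (Nat.not_lt_zero s)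

theorem prevOthers_othersOf (y : ∀ s j, Y s j) (u : ∀ s j, U s j) (t : ℕ) (k : Fin K) :
    prevOthers (newlyOf y u t k) (othersOf y u (t + 1) k : PrivateOthers n Y U (t + 1) k) =
      othersOf y u t k :=
  prevOthers_newlyOf y u t k

theorem ConsistentSupport.stepPDF {t : ℕ}
    {q : Shared n Y U t × Private n Y U t k → X t × PrivateOthers n Y U t k → ℝ≥0∞}
    (hq : ConsistentSupport gm t q) : ConsistentSupport gm (t + 1) (M.stepPDF gm t q) := by
  intro x y u h s hs hst j
  rw [stepPDF_infoOf] at h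
  have h1 := right_ne_zero_of_mul h
  simp only [prevOthers_othersOf] at h1
  obtain ⟨x', hx'⟩ : ∃ x', q (infoOf y u t k) (x', othersOf y u t k) ≠ 0 ∧
      deltaProduct (fun j => gm j t (sharedOf y u t) (othersOf y u t k j))
        (othersOf y u (t + 1) k : PrivateOthers n Y U (t + 1) k) ≠ 0 := by
    by_contra hcon
    push Not at hcon
    refine h1 ?_
    rw [← lintegral_zero]
    refine lintegral_congr fun x' => ?_
    by_cases hx : q (infoOf y u t k) (x', othersOf y u t k) = 0
    · rw [hx, mul_zero]
    · rw [hcon x' hx, mul_zero, zero_mul]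
  -- Times before `t` are covered by the support of `q`, whose window starts no later; time `t`
  -- itself is covered by the delta product.
  rcases Nat.lt_succ_iff_lt_or_eq.1 hst with hlt | rfl
  · exact hq x' y u hx'.1 s (by omega) hlt j
  · exact eq_of_deltaProduct_ne_zero hx'.2 hs j

/-- The hidden actions, computed from the information of player `k` and the hidden observations. -/
noncomputable def hiddenAct (hn : 1 ≤ n) (t : ℕ) (k : Fin K)
    (gm : ∀ j : {j : Fin K // j ≠ k}, Strategy n Y U j.1)
    (i : Shared n Y U t × Private n Y U t k) (y : HiddenObs n Y t k) : HiddenAct n U t k :=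
  fun j s => fill hn (fun s j => t + 1 - n ≤ s ∧ j ≠ k)
    (join k (fun _ _ _ => Classical.arbitrary _) gm)
    (pathObs i fun j => (y j, fun _ => Classical.arbitrary _))
    (pathAct i fun j => (y j, fun _ => Classical.arbitrary _)) s.1 j.1

/-- The strategy placed at `k` is a dummy: only actions of the other players are filled in, so
measurability of `gm` suffices. -/
theorem measurable_hiddenAct {hn : 1 ≤ n} {t : ℕ} (ht : t ≤ T) (hgm : ∀ j, Admissible T (gm j)) :
    Measurable (Function.uncurry (hiddenAct hn t k gm)) := by
  refine measurable_pi_iff.2 fun j => measurable_pi_iff.2 fun s => ?_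
  have hs := Finset.mem_Ico.1 s.2
  have hl : Measurable fun p : (Shared n Y U t × Private n Y U t k) × HiddenObs n Y t k =>
      (p.1, (fun j => (p.2 j, fun _ => Classical.arbitrary _) : PrivateOthers n Y U t k)) := by
    fun_prop
  refine (measurable_fill (T := T) (hn := hn) (A := fun s j => t + 1 - n ≤ s ∧ j ≠ k)
    (g := join k (fun _ _ _ => Classical.arbitrary _) gm) ?_ (by omega : s.1 < T) j.1).comp
    (((measurable_pathObs t k).comp hl).prodMk ((measurable_pathAct t k).comp hl))
  intro r hr i hi
  rw [join_of_ne k _ _ hi.2]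
  exact hgm ⟨i, hi.2⟩ r hr

/-- On the support, the actions of the path through `(i, l)` obey `gm` at the hidden indices and are
given by `i` elsewhere before `t`. Uniqueness of `fill` does the rest. -/
theorem ConsistentSupport.eq_hiddenAct {hn : 1 ≤ n} {t : ℕ}
    {F : Shared n Y U t × Private n Y U t k → X t × PrivateOthers n Y U t k → ℝ≥0∞}
    (hF : ConsistentSupport gm t F)
    (i : Shared n Y U t × Private n Y U t k) (x : X t) (y : HiddenObs n Y t k)
    (u : HiddenAct n U t k) (h : F i (x, fun j => (y j, u j)) ≠ 0) :
    u = hiddenAct hn t k gm i y := by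
  set l : PrivateOthers n Y U t k := fun j => (y j, u j) with hl
  have hs := hF x (pathObs i l) (pathAct i l) (by rwa [infoOf_path, othersOf_path])
  funext j s
  have hs' := Finset.mem_Ico.1 s.2
  have key := eq_fill (hn := hn) (A := fun s j => t + 1 - n ≤ s ∧ j ≠ k)
    (g := join k (fun _ _ _ => Classical.arbitrary _) gm) (m := t)
    (y := pathObs i fun j => (y j, fun _ => Classical.arbitrary _)) (y' := pathObs i l)
    (u := pathAct i fun j => (y j, fun _ => Classical.arbitrary _)) (v := pathAct i l)
    (fun s _ j => ?_) ?_ ?_ s.1 hs'.2 j.1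
  · rw [hiddenAct, ← key]
    simp [pathAct, not_lt.2 hs'.1, hs'.2, hl]
  · simp only [pathObs, hl]
  · intro r hr i' hi'
    rw [join_of_ne k _ _ hi'.2]
    exact hs r hi'.1 hr ⟨i', hi'.2⟩
  · intro r hr i' hi'
    simp only [pathAct]
    split_ifs with h1
    · rfl
    -- After the shared times, an action outside the filled set belongs to player `k`, and both
    -- paths read it from `i`.
    · have : i' = k := by
        by_contra hk
        exact hi' ⟨not_lt.1 h1, hk⟩
      subst this
      simp

theorem ConsistentSupport.measurable_integralExt (hgm : ∀ j, Admissible T (gm j)) {t : ℕ}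
    (ht : t ≤ T)
    {F : Shared n Y U t × Private n Y U t k → X t × PrivateOthers n Y U t k → ℝ≥0∞}
    (hF : ConsistentSupport gm t F) (hFm : Measurable (Function.uncurry F)) :
    Measurable fun i => M.integralExt t k (F i) :=
  M.measurable_integralExt ht hFm _ (measurable_hiddenAct (hn := M.one_le_delay) ht hgm)
    fun i x y u h => hF.eq_hiddenAct i x y u h

theorem measurable_initPDF (k : Fin K) :
    Measurable (Function.uncurry (M.initPDF k :
      Shared n Y U 0 × Private n Y U 0 k → X 0 × PrivateOthers n Y U 0 k → ℝ≥0∞)) := by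
  unfold initPDF
  refine Measurable.mul ?_ ?_
  · refine (M.measurable_likelihood (Nat.zero_le T) k).comp (Measurable.prodMk ?_ measurable_snd)
    have h := (measurable_pathObs 0 k).comp (by fun_prop : Measurable fun
      p : (Shared n Y U 0 × Private n Y U 0 k) × (X 0 × PrivateOthers n Y U 0 k) =>
        (p.1, (Classical.arbitrary _ : PrivateOthers n Y U 0 k)))
    exact (measurable_pi_apply k).comp ((measurable_pi_apply 0).comp h)
  · exact (M.measurable_p0.comp (measurable_fst.comp measurable_snd)).coe_nnreal_ennreal

theorem measurable_stepPDF [∀ t j, StandardBorelSpace (U t j)] (hgm : ∀ j, Admissible T (gm j))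
    {t : ℕ} (ht : t < T)
    {q : Shared n Y U t × Private n Y U t k → X t × PrivateOthers n Y U t k → ℝ≥0∞}
    (hq : Measurable (Function.uncurry q)) :
    Measurable (Function.uncurry (M.stepPDF gm t q)) := by
  have hn := M.one_le_delay
  have hy : Measurable fun i : Shared n Y U (t + 1) × Private n Y U (t + 1) k =>
      pathObs i (Classical.arbitrary _) :=
    (measurable_pathObs (t + 1) k).comp (measurable_id.prodMk measurable_const)
  have hu : Measurable fun i : Shared n Y U (t + 1) × Private n Y U (t + 1) k =>
      pathAct i (Classical.arbitrary _) :=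
    (measurable_pathAct (t + 1) k).comp (measurable_id.prodMk measurable_const)
  have hy' : ∀ s j, Measurable fun i : Shared n Y U (t + 1) × Private n Y U (t + 1) k =>
      pathObs i (Classical.arbitrary _) s j := fun s j => by fun_prop
  have hu' : ∀ s j, Measurable fun i : Shared n Y U (t + 1) × Private n Y U (t + 1) k =>
      pathAct i (Classical.arbitrary _) s j := fun s j => by fun_prop
  refine M.measurable_bayesUnnormalized ht (hy' _ _) (hu' _ _) (fun j => ?_)
    ((measurable_newlyOf t k).comp (hy.prodMk hu)) ?_
  · exact (hgm j t ht).comp ((((measurable_sharedOf t).comp (hy.prodMk hu)).comp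
      measurable_fst).prodMk measurable_snd)
  · have : Measurable fun i : Shared n Y U (t + 1) × Private n Y U (t + 1) k =>
        (infoOf (pathObs i (Classical.arbitrary _)) (pathAct i (Classical.arbitrary _)) t k :
          Shared n Y U t × Private n Y U t k) :=
      measurable_infoOf_comp hn (fun s _ j => hy' s j) (fun s _ j => hu' s j)
    exact hq.comp ((this.comp measurable_fst).prodMk measurable_snd)

/-- The private posterior densities. -/
noncomputable def posteriorPDF (gm : ∀ j : {j : Fin K // j ≠ k}, Strategy n Y U j.1) :
    (t : ℕ) → Shared n Y U t × Private n Y U t k → X t × PrivateOthers n Y U t k → ℝ≥0∞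
  | 0, i => M.normalize 0 k (M.initPDF k i)
  | t + 1, i => M.normalize (t + 1) k (M.stepPDF gm t (posteriorPDF gm t) i)

/-- The private posterior densities without normalization. -/
noncomputable def jointPDF (gm : ∀ j : {j : Fin K // j ≠ k}, Strategy n Y U j.1) :
    (t : ℕ) → Shared n Y U t × Private n Y U t k → X t × PrivateOthers n Y U t k → ℝ≥0∞
  | 0 => M.initPDF k
  | t + 1 => M.stepPDF gm t (jointPDF gm t)

theorem consistentSupport_posteriorPDF (t : ℕ) :
    ConsistentSupport gm t (M.posteriorPDF gm t) := by
  induction t with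
  | zero => exact fun x y u h => M.consistentSupport_initPDF x y u (M.normalize_ne_zero h)
  | succ t ih => exact fun x y u h => ih.stepPDF M x y u (M.normalize_ne_zero h)

theorem consistentSupport_jointPDF (t : ℕ) : ConsistentSupport gm t (M.jointPDF gm t) := by
  induction t with
  | zero => exact M.consistentSupport_initPDF
  | succ t ih => exact ih.stepPDF M

theorem measurable_posteriorPDF [∀ t j, StandardBorelSpace (U t j)]
    (hgm : ∀ j, Admissible T (gm j)) {t : ℕ} (ht : t ≤ T) :
    Measurable (Function.uncurry (M.posteriorPDF gm t)) := by
  induction t with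
  | zero =>
    exact M.measurable_normalize (M.measurable_initPDF k)
      (M.consistentSupport_initPDF.measurable_integralExt M hgm ht (M.measurable_initPDF k))
  | succ t ih =>
    have h := M.measurable_stepPDF hgm ht (ih (Nat.le_of_succ_le ht))
    exact M.measurable_normalize h
      (((M.consistentSupport_posteriorPDF t).stepPDF M).measurable_integralExt M hgm ht h)

theorem measurable_jointPDF [∀ t j, StandardBorelSpace (U t j)]
    (hgm : ∀ j, Admissible T (gm j)) {t : ℕ} (ht : t ≤ T) :
    Measurable (Function.uncurry (M.jointPDF gm t)) := by
  induction t with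
  | zero => exact M.measurable_initPDF k
  | succ t ih => exact M.measurable_stepPDF hgm ht (ih (Nat.le_of_succ_le ht))

theorem measurable_integralExt_jointPDF [∀ t j, StandardBorelSpace (U t j)]
    (hgm : ∀ j, Admissible T (gm j)) {t : ℕ} (ht : t ≤ T) :
    Measurable fun i => M.integralExt t k (M.jointPDF gm t i) :=
  (M.consistentSupport_jointPDF t).measurable_integralExt M hgm ht (M.measurable_jointPDF hgm ht)

/-- Along paths with nondegenerate normalizing constants, the recursion with normalization in each
step yields the normalization of the joint densities. -/
theorem posteriorPDF_eq_normalize (y : ∀ s j, Y s j) (u : ∀ s j, U s j) (t : ℕ)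
    (h0 : ∀ s < t, M.integralExt s k (M.jointPDF gm s (infoOf y u s k)) ≠ 0)
    (h1 : ∀ s < t, M.integralExt s k (M.jointPDF gm s (infoOf y u s k)) ≠ ∞) :
    M.posteriorPDF gm t (infoOf y u t k) = M.normalize t k (M.jointPDF gm t (infoOf y u t k)) := by
  induction t with
  | zero => rfl
  | succ t ih =>
    have ih' := ih (fun s hs => h0 s (by omega)) (fun s hs => h1 s (by omega))
    have e0 := h0 t (Nat.lt_succ_self t)
    have e1 := h1 t (Nat.lt_succ_self t)
    -- The normalized density is a constant multiple of the joint density, with a constant different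
    -- from 0 and ∞; it passes through the Bayes operator and cancels in the next normalization.
    have hinv : M.posteriorPDF gm t (infoOf y u t k) = fun s =>
        (M.integralExt t k (M.jointPDF gm t (infoOf y u t k)))⁻¹ *
          M.jointPDF gm t (infoOf y u t k) s := by
      rw [ih']
      funext s
      rw [normalize, if_neg e0, ENNReal.div_eq_inv_mul]
    rw [posteriorPDF, jointPDF, stepPDF_infoOf, stepPDF_infoOf, hinv,
      bayesUnnormalized_const_mul _ (ENNReal.inv_ne_top.2 e0),
      normalize_const_mul _ (ENNReal.inv_ne_top.2 e0) (ENNReal.inv_ne_zero.2 e1)]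

end Recursion

end TeamModel

/-! ### Product measures -/

section Pi

variable {δ : Type*} [DecidableEq δ] {π : δ → Type*} [∀ i, MeasurableSpace (π i)]
  (μ : ∀ i, Measure (π i)) [∀ i, SigmaFinite (μ i)]

theorem lmarginal_prod {F : ∀ i, π i → ℝ≥0∞} (hF : ∀ i, Measurable (F i)) (s : Finset δ)
    (x : ∀ i, π i) :
    (∫⋯∫⁻_s, (fun y => ∏ i ∈ s, F i (y i)) ∂μ) x = ∏ i ∈ s, ∫⁻ z, F i z ∂μ i := by
  induction s using Finset.induction_on generalizing x with
  | empty => simp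
  | insert i s hi ih =>
    have hm : ∀ s : Finset δ, Measurable fun y : ∀ i, π i => ∏ i ∈ s, F i (y i) := fun s =>
      Finset.measurable_prod _ fun i _ => (hF i).comp (measurable_pi_apply i)
    have h : ∀ x, (∫⋯∫⁻_s, (fun y => ∏ i ∈ insert i s, F i (y i)) ∂μ) x =
        F i (x i) * ∏ i ∈ s, ∫⁻ z, F i z ∂μ i := by
      intro x
      rw [← ih x, lmarginal, lmarginal,
        ← lintegral_const_mul _ ((hm s).fun_comp measurable_updateFinset)]
      refine lintegral_congr fun y => ?_
      rw [Finset.prod_insert hi]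
      simp [Function.updateFinset, hi]
    rw [lmarginal_insert _ (hm _) hi, Finset.prod_insert hi]
    simp only [h, Function.update_self]
    rw [lintegral_mul_const _ (hF i)]

theorem pi_withDensity {ι : Type*} [Fintype ι] {π : ι → Type*} [∀ i, MeasurableSpace (π i)]
    (μ : ∀ i, Measure (π i)) [∀ i, SigmaFinite (μ i)] {F : ∀ i, π i → ℝ≥0∞}
    (hF : ∀ i, Measurable (F i)) [∀ i, SigmaFinite ((μ i).withDensity (F i))] :
    Measure.pi (fun i => (μ i).withDensity (F i)) =
      (Measure.pi μ).withDensity fun y => ∏ i, F i (y i) := by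
  classical
  refine Measure.pi_eq fun A hA => ?_
  rw [withDensity_apply _ (MeasurableSet.univ_pi hA), ← lintegral_indicator (MeasurableSet.univ_pi hA)]
  have h : (Set.univ.pi A).indicator (fun y : ∀ i, π i => ∏ i, F i (y i)) =
      fun y => ∏ i, (A i).indicator (F i) (y i) := by
    funext y
    by_cases hy : y ∈ Set.univ.pi A
    · rw [Set.indicator_of_mem hy]
      exact Finset.prod_congr rfl fun i _ => (Set.indicator_of_mem (hy i trivial) _).symm
    · rw [Set.indicator_of_notMem hy]
      obtain ⟨i, hi⟩ : ∃ i, y i ∉ A i := by simpa [Set.mem_pi] using hy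
      exact (Finset.prod_eq_zero (Finset.mem_univ i) (Set.indicator_of_notMem hi _)).symm
  rw [h]
  -- A marginal integral needs a base point. If the product is empty, some factor is empty and both
  -- sides are zero.
  by_cases hne : Nonempty (∀ i, π i)
  · obtain ⟨x⟩ := hne
    rw [lintegral_eq_lmarginal_univ x,
      lmarginal_prod μ (F := fun i => (A i).indicator (F i)) fun i => (hF i).indicator (hA i)]
    exact Finset.prod_congr rfl fun i _ => by
      rw [lintegral_indicator (hA i), withDensity_apply _ (hA i)]
  · have : IsEmpty (∀ i, π i) := not_nonempty_iff.1 hne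
    obtain ⟨i, hi⟩ : ∃ i, IsEmpty (π i) := by
      by_contra hcon
      push Not at hcon
      exact hne ⟨fun i => (hcon i).some⟩
    rw [Measure.eq_zero_of_isEmpty (Measure.pi μ), lintegral_zero_measure]
    exact (Finset.prod_eq_zero (Finset.mem_univ i)
      (by rw [Set.eq_empty_of_isEmpty (A i), measure_empty])).symm

/-- A parametrization of the coordinates in `s` computes the marginal integral. -/
theorem lintegral_updateFinset {s : Finset δ} {ζ : Type*} [MeasurableSpace ζ] (m : Measure ζ)
    {φ : ζ → ∀ i : s, π i} (hφ : Measurable φ)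
    (h : ∀ A : ∀ i : s, Set (π i), (∀ i, MeasurableSet (A i)) →
      m (φ ⁻¹' Set.univ.pi A) = ∏ i : s, μ i (A i))
    {f : (∀ i, π i) → ℝ≥0∞} (hf : Measurable f) (x : ∀ i, π i) :
    ∫⁻ z, f (Function.updateFinset x s (φ z)) ∂m = (∫⋯∫⁻_s, f ∂μ) x := by
  have : Measure.pi (fun i : s => μ i) = m.map φ := Measure.pi_eq fun A hA => by
    rw [Measure.map_apply hφ (MeasurableSet.univ_pi hA), h A hA]
  rw [lmarginal, this, lintegral_map (hf.fun_comp measurable_updateFinset) hφ]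

theorem lintegral_lmarginal_swap {α : Type*} [MeasurableSpace α] {ν : Measure α} [SFinite ν]
    (s : Finset δ) {f : α → (∀ i, π i) → ℝ≥0∞} (hf : Measurable (Function.uncurry f))
    (y : ∀ i, π i) :
    ∫⁻ x, (∫⋯∫⁻_s, f x ∂μ) y ∂ν = (∫⋯∫⁻_s, (fun z => ∫⁻ x, f x z ∂ν) ∂μ) y := by
  simp only [lmarginal]
  refine lintegral_lintegral_swap (Measurable.aemeasurable ?_)
  exact hf.comp (measurable_fst.prodMk (measurable_updateFinset.comp measurable_snd))

end Pi

/-! ### Integration of functions of independent variables -/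

/-- The joint law of `R` and `V` is a product measure, so this is Tonelli. Independence is assumed
of a whole σ-algebra `m` so that `R` can be any functional of the past. -/
theorem lintegral_of_indep {Ω ρ ζ : Type*} {m mΩ : MeasurableSpace Ω} {P : Measure Ω}
    [IsProbabilityMeasure P] [MeasurableSpace ρ] [MeasurableSpace ζ] (hm : m ≤ mΩ) {R : Ω → ρ}
    (hR : Measurable[m] R) {V : Ω → ζ} (hV : Measurable V)
    (h : Indep m (MeasurableSpace.comap V inferInstance) P) {G : ρ × ζ → ℝ≥0∞}
    (hG : Measurable G) :
    ∫⁻ ω, G (R ω, V ω) ∂P = ∫⁻ ω, ∫⁻ v, G (R ω, v) ∂(P.map V) ∂P := by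
  have hR' : Measurable R := hR.mono hm le_rfl
  have hind : IndepFun R V P := by
    rw [IndepFun_iff_Indep]
    exact indep_of_indep_of_le_left h hR.comap_le
  have := Measure.isProbabilityMeasure_map (μ := P) hV.aemeasurable
  have := Measure.isProbabilityMeasure_map (μ := P) hR'.aemeasurable
  rw [← lintegral_map hG (hR'.prodMk hV),
    (indepFun_iff_map_prod_eq_prod_map_map hR'.aemeasurable hV.aemeasurable).1 hind,
    lintegral_prod _ hG.aemeasurable, lintegral_map hG.lintegral_prod_right' hR']

namespace TeamModel

variable {T n K : ℕ} {Ω : Type uΩ} [MeasurableSpace Ω] {P : Measure Ω}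
  {X : ℕ → Type uX} {Y : ℕ → Fin K → Type uY} {U : ℕ → Fin K → Type uX}
  {W : ℕ → Type uW} {Z : ℕ → Fin K → Type uZ}
  [∀ t, MeasurableSpace (X t)] [∀ t j, MeasurableSpace (Y t j)]
  [∀ t j, MeasurableSpace (U t j)] [∀ t, MeasurableSpace (W t)]
  [∀ t j, MeasurableSpace (Z t j)]
  (M : TeamModel T n K P X Y U W Z)

/-! ### The noise processes -/

/-- The σ-algebras of the primitive random variables. -/
abbrev primitive : Unit ⊕ Fin T ⊕ Fin (T + 1) × Fin K → MeasurableSpace Ω :=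
  Sum.elim (fun _ : Unit => MeasurableSpace.comap M.x0 inferInstance)
    (Sum.elim (fun t : Fin T => MeasurableSpace.comap (M.w t) inferInstance)
      (fun p : Fin (T + 1) × Fin K => MeasurableSpace.comap (M.z p.1 p.2) inferInstance))

theorem primitive_le (i : Unit ⊕ Fin T ⊕ Fin (T + 1) × Fin K) :
    M.primitive i ≤ ‹MeasurableSpace Ω› := by
  rcases i with _ | s | p
  · exact M.measurable_x0.comap_le
  · exact (M.measurable_w s.1 s.2).comap_le
  · exact (M.measurable_z p.1.1 (Nat.le_of_lt_succ p.1.2) p.2).comap_le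

/-- Indices of `X_0`, of `W_s` for `s < a` and of `Z_s^j` for `s < b`. -/
def pastIndex (T K a b : ℕ) : Set (Unit ⊕ Fin T ⊕ Fin (T + 1) × Fin K) :=
  {i | Sum.elim (fun _ => True) (Sum.elim (fun s => s.1 < a) (fun p => p.1.1 < b)) i}

/-- The σ-algebra generated by `X_0`, by `W_s` for `s < a` and by `Z_s^j` for `s < b`. -/
@[reducible] def past (a b : ℕ) : MeasurableSpace Ω := ⨆ i ∈ pastIndex T K a b, M.primitive i

theorem past_le (a b : ℕ) : M.past a b ≤ ‹MeasurableSpace Ω› :=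
  iSup₂_le fun i _ => M.primitive_le i

theorem past_mono {a b a' b' : ℕ} (ha : a ≤ a') (hb : b ≤ b') : M.past a b ≤ M.past a' b' := by
  refine biSup_mono fun i hi => ?_
  rcases i with _ | s | p
  · trivial
  · exact lt_of_lt_of_le hi ha
  · exact lt_of_lt_of_le hi hb

theorem primitive_le_past {a b : ℕ} {i : Unit ⊕ Fin T ⊕ Fin (T + 1) × Fin K}
    (hi : i ∈ pastIndex T K a b) : M.primitive i ≤ M.past a b :=
  le_biSup (f := M.primitive) hi

theorem measurable_x0_past (a b : ℕ) : Measurable[M.past a b] M.x0 :=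
  (comap_measurable M.x0).mono (M.primitive_le_past (i := Sum.inl ()) trivial) le_rfl

theorem measurable_w_past {a b s : ℕ} (hs : s < T) (ha : s < a) : Measurable[M.past a b] (M.w s) :=
  (comap_measurable (M.w s)).mono
    (M.primitive_le_past (i := Sum.inr (Sum.inl ⟨s, hs⟩)) ha) le_rfl

theorem measurable_z_past {a b s : ℕ} (hs : s ≤ T) (hb : s < b) (j : Fin K) :
    Measurable[M.past a b] (M.z s j) :=
  (comap_measurable (M.z s j)).mono
    (M.primitive_le_past (i := Sum.inr (Sum.inr (⟨s, Nat.lt_succ_of_le hs⟩, j))) hb) le_rfl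

theorem indep_past_w {t : ℕ} (ht : t < T) (b : ℕ) :
    Indep (M.past t b) (MeasurableSpace.comap (M.w t) inferInstance) P := by
  have h := indep_iSup_of_disjoint (m := M.primitive) M.primitive_le M.indep
    (S := pastIndex T K t b) (T := {Sum.inr (Sum.inl ⟨t, ht⟩)}) (by
      rw [Set.disjoint_singleton_right]
      exact lt_irrefl t)
  rw [iSup_singleton] at h
  exact h

/-- The index `a` is free: observation noise at time `t` is independent of every `W`, as well as of
the earlier observation noises. The noises of all players at time `t` are treated as one block. -/
theorem indep_past_z {t : ℕ} (ht : t ≤ T) (a : ℕ) :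
    Indep (M.past a t) (MeasurableSpace.comap (fun ω j => M.z t j ω) inferInstance) P := by
  have h := indep_iSup_of_disjoint (m := M.primitive) M.primitive_le M.indep
    (S := pastIndex T K a t)
    (T := {i | ∃ j, i = Sum.inr (Sum.inr (⟨t, Nat.lt_succ_of_le ht⟩, j))}) (by
      rw [Set.disjoint_left]
      rintro _ hi ⟨j, rfl⟩
      exact lt_irrefl t hi)
  refine indep_of_indep_of_le_right h ?_
  have : Measurable[⨆ i ∈ {i | ∃ j, i = Sum.inr (Sum.inr (⟨t, Nat.lt_succ_of_le ht⟩, j))},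
      M.primitive i] fun ω j => M.z t j ω :=
    @measurable_pi_lambda _ _ _ (_) _ _ fun j => (comap_measurable (M.z t j)).mono
      (le_biSup (f := M.primitive) (i := Sum.inr (Sum.inr (⟨t, Nat.lt_succ_of_le ht⟩, j)))
        ⟨j, rfl⟩) le_rfl
  exact this.comap_le

theorem iIndepFun_z {t : ℕ} (ht : t ≤ T) : iIndepFun (fun j => M.z t j) P := by
  have h := M.indep.precomp
    (g := fun j : Fin K => Sum.inr (Sum.inr ((⟨t, Nat.lt_succ_of_le ht⟩ : Fin (T + 1)), j)))
    (fun a b hab => by simpa using hab)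
  exact h

/-! ### Laws of one step -/

variable [IsProbabilityMeasure P]

theorem measurable_zTuple {t : ℕ} (ht : t ≤ T) : Measurable fun ω j => M.z t j ω :=
  measurable_pi_iff.2 fun j => M.measurable_z t ht j

theorem lintegral_f {t : ℕ} (ht : t < T) (x : X t) (u : ∀ j, U t j) {G : X (t + 1) → ℝ≥0∞}
    (hG : Measurable G) :
    ∫⁻ w, G (M.f t x u w) ∂(P.map (M.w t)) = ∫⁻ x', (M.S t x' x u : ℝ≥0∞) * G x' ∂M.νX (t + 1) := by
  have hf : Measurable fun w => M.f t x u w :=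
    (M.measurable_f t ht).comp (measurable_const.prodMk (measurable_const.prodMk measurable_id))
  have hS : Measurable fun x' => (M.S t x' x u : ℝ≥0∞) :=
    ((M.measurable_S t ht).comp
      (measurable_id.prodMk (measurable_const.prodMk measurable_const))).coe_nnreal_ennreal
  rw [lintegral_map (hG.fun_comp hf) (M.measurable_w t ht),
    ← lintegral_map hG (hf.fun_comp (M.measurable_w t ht))]
  change ∫⁻ a, G a ∂(P.map fun ω => M.f t x u (M.w t ω)) = _
  rw [M.law_f t ht x u, lintegral_withDensity_eq_lintegral_mul _ hS hG]
  rfl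

theorem lintegral_h {t : ℕ} (ht : t ≤ T) (x : X t) {G : (∀ j, Y t j) → ℝ≥0∞}
    (hG : Measurable G) :
    ∫⁻ z, G (fun j => M.h t j x (z j)) ∂(P.map fun ω j => M.z t j ω) =
      ∫⁻ y, (∏ j, (M.Q t j (y j) x : ℝ≥0∞)) * G y ∂Measure.pi fun j => M.νY t j := by
  have := M.sigmaFinite_νY t ht
  have hh : ∀ j, Measurable fun z => M.h t j x z := fun j =>
    (M.measurable_h t ht j).comp (measurable_const.prodMk measurable_id)
  have hh' : Measurable fun (z : ∀ j, Z t j) j => M.h t j x (z j) :=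
    measurable_pi_iff.2 fun j => (hh j).comp (measurable_pi_apply j)
  have hQ : ∀ j, Measurable fun y => (M.Q t j y x : ℝ≥0∞) := fun j =>
    ((M.measurable_Q t ht j).comp (measurable_id.prodMk measurable_const)).coe_nnreal_ennreal
  have hlaw : P.map (fun ω j => M.h t j x (M.z t j ω)) =
      (Measure.pi fun j => M.νY t j).withDensity fun y => ∏ j, (M.Q t j (y j) x : ℝ≥0∞) := by
    have hi := (M.iIndepFun_z ht).comp (fun j z => M.h t j x z) hh
    -- A density with respect to a σ-finite measure need not define a σ-finite measure in general;
    -- here it is the law of an observation.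
    have hsf : ∀ j, SigmaFinite ((M.νY t j).withDensity fun y => (M.Q t j y x : ℝ≥0∞)) := fun j => by
      rw [← M.law_h t ht j x]
      have := Measure.isProbabilityMeasure_map (μ := P)
        ((hh j).comp (M.measurable_z t ht j)).aemeasurable
      change SigmaFinite (P.map ((fun z => M.h t j x z) ∘ M.z t j))
      infer_instance
    have h2 := hi.map_fun_eq_pi_map fun j => ((hh j).comp (M.measurable_z t ht j)).aemeasurable
    have h3 : ∀ j, P.map ((fun z => M.h t j x z) ∘ M.z t j) =
      (M.νY t j).withDensity fun y => (M.Q t j y x : ℝ≥0∞) := fun j => M.law_h t ht j x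
    simp only [h3] at h2
    rw [pi_withDensity _ hQ] at h2
    exact h2
  rw [lintegral_map (hG.fun_comp hh') (M.measurable_zTuple ht),
    ← lintegral_map hG (hh'.fun_comp (M.measurable_zTuple ht))]
  change ∫⁻ a, G a ∂(P.map fun ω j => M.h t j x (M.z t j ω)) = _
  rw [hlaw, lintegral_withDensity_eq_lintegral_mul _ (Finset.measurable_prod _ fun j _ =>
    (hQ j).fun_comp (measurable_pi_apply j)) hG]
  rfl

/-! ### Measurability of the closed-loop processes -/

variable {g : ∀ j, Strategy n Y U j}

/-- The claims are proved together because state, observations and actions feed each other. The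
indices record which noises have been used: X_t involves no noise of index `t`, while observations
and actions at time `t` may involve Z_t but not W_t. This is what the one-step independence
statements need. -/
theorem measurable_past (hg : ∀ j, Admissible T (g j)) (t : ℕ) :
    (t ≤ T → Measurable[M.past t t] (M.state g t)) ∧
    (t ≤ T → ∀ j, Measurable[M.past t (t + 1)] (M.obs g t j)) ∧
    (t < T → ∀ j, Measurable[M.past t (t + 1)] (M.act g t j)) := by
  have hn := M.one_le_delay
  induction t using Nat.strong_induction_on with
  | _ t ih =>
    have hs : t ≤ T → Measurable[M.past t t] (M.state g t) := by
      intro ht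
      cases t with
      | zero =>
        have : M.state g 0 = M.x0 := funext fun ω => M.state_zero g ω
        rw [this]
        exact M.measurable_x0_past 0 0
      | succ t =>
        have : M.state g (t + 1) = fun ω =>
            M.f t (M.state g t ω) (fun j => M.act g t j ω) (M.w t ω) :=
          funext fun ω => M.state_succ g t ω
        rw [this]
        obtain ⟨h1, -, h3⟩ := ih t (Nat.lt_succ_self t)
        refine (M.measurable_f t ht).comp (Measurable.prodMk ?_ (Measurable.prodMk ?_ ?_))
        · exact (h1 (by omega)).mono (M.past_mono (by omega) (by omega)) le_rfl
        · exact @measurable_pi_lambda _ _ _ (_) _ _ fun j =>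
            (h3 (by omega) j).mono (M.past_mono (by omega) le_rfl) le_rfl
        · exact M.measurable_w_past ht (Nat.lt_succ_self t)
    have ho : t ≤ T → ∀ j, Measurable[M.past t (t + 1)] (M.obs g t j) := by
      intro ht j
      exact (M.measurable_h t ht j).comp
        (((hs ht).mono (M.past_mono le_rfl (by omega)) le_rfl).prodMk
          (M.measurable_z_past ht (Nat.lt_succ_self t) j))
    refine ⟨hs, ho, fun ht j => ?_⟩
    have : M.act g t j = fun ω => g j t (M.shared g t ω) (M.priv g t j ω) :=
      funext fun ω => M.act_eq g t j ω
    rw [this]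
    have hle : ∀ s < t, M.past s (s + 1) ≤ M.past t (t + 1) :=
      fun s hst => M.past_mono (by omega) (by omega)
    refine (hg j t ht).comp (Measurable.prodMk ?_ ?_)
    · refine measurable_sharedOf_comp (y := fun ω s j => M.obs g s j ω)
        (u := fun ω s j => M.act g s j ω) (fun s hs' i => ?_) (fun s hs' i => ?_)
      · exact ((ih s (by omega)).2.1 (by omega) i).mono (hle s (by omega)) le_rfl
      · exact ((ih s (by omega)).2.2 (by omega) i).mono (hle s (by omega)) le_rfl
    · refine measurable_privateOf_comp (y := fun ω s j => M.obs g s j ω)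
        (u := fun ω s j => M.act g s j ω) (fun s _ hs' => ?_) (fun s _ hs' => ?_)
      · rcases Nat.lt_succ_iff_lt_or_eq.1 hs' with h | rfl
        · exact ((ih s (by omega)).2.1 (by omega) j).mono (hle s (by omega)) le_rfl
        · exact ho ht.le j
      · exact ((ih s (by omega)).2.2 (by omega) j).mono (hle s (by omega)) le_rfl

theorem measurable_state_past (hg : ∀ j, Admissible T (g j)) {t : ℕ} (ht : t ≤ T) {a b : ℕ}
    (ha : t ≤ a) (hb : t ≤ b) : Measurable[M.past a b] (M.state g t) :=
  ((M.measurable_past hg t).1 ht).mono (M.past_mono ha hb) le_rfl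

theorem measurable_obs_past (hg : ∀ j, Admissible T (g j)) {t : ℕ} (ht : t ≤ T) {a b : ℕ}
    (ha : t ≤ a) (hb : t < b) (j : Fin K) : Measurable[M.past a b] (M.obs g t j) :=
  ((M.measurable_past hg t).2.1 ht j).mono (M.past_mono ha hb) le_rfl

theorem measurable_act_past (hg : ∀ j, Admissible T (g j)) {t : ℕ} (ht : t < T) {a b : ℕ}
    (ha : t ≤ a) (hb : t < b) (j : Fin K) : Measurable[M.past a b] (M.act g t j) :=
  ((M.measurable_past hg t).2.2 ht j).mono (M.past_mono ha hb) le_rfl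

end TeamModel

namespace TeamModel

variable {T n K : ℕ} {Ω : Type uΩ} [MeasurableSpace Ω] {P : Measure Ω}
  {X : ℕ → Type uX} {Y : ℕ → Fin K → Type uY} {U : ℕ → Fin K → Type uX}
  {W : ℕ → Type uW} {Z : ℕ → Fin K → Type uZ}
  [∀ t, MeasurableSpace (X t)] [∀ t j, MeasurableSpace (Y t j)]
  [∀ t j, MeasurableSpace (U t j)] [∀ t, MeasurableSpace (W t)]
  [∀ t j, MeasurableSpace (Z t j)]
  (M : TeamModel T n K P X Y U W Z)

/-! ### Reference measures on paths of observations -/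

/-- The reference measures of the observations, extended by zero beyond the horizon. -/
noncomputable def refObs (p : ℕ × Fin K) : Measure (Y p.1 p.2) :=
  open Classical in if p.1 ≤ T then M.νY p.1 p.2 else 0

/-- Marginal integrals require σ-finiteness at every index, whereas the model grants it only within
the horizon; hence the zero measure at later times. -/
instance sigmaFinite_refObs (p : ℕ × Fin K) : SigmaFinite (M.refObs p) := by
  unfold refObs
  split_ifs with h
  · exact M.sigmaFinite_νY p.1 h p.2
  · infer_instance

/-- Indices of the observations at time `t`. -/
def obsSlice (K t : ℕ) : Finset (ℕ × Fin K) := {t} ×ˢ Finset.univ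

/-- Indices of the observations up to time `t`. -/
def obsPast (K t : ℕ) : Finset (ℕ × Fin K) := Finset.range (t + 1) ×ˢ Finset.univ

theorem obsPast_zero : obsPast K 0 = obsSlice K 0 := by
  simp [obsPast, obsSlice]

theorem obsPast_succ (t : ℕ) : obsPast K (t + 1) = obsPast K t ∪ obsSlice K (t + 1) := by
  ext p
  simp only [obsPast, obsSlice, Finset.mem_product, Finset.mem_range, Finset.mem_univ, and_true,
    Finset.mem_union, Finset.mem_singleton]
  omega

theorem disjoint_obsPast_obsSlice (t : ℕ) : Disjoint (obsPast K t) (obsSlice K (t + 1)) := by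
  rw [Finset.disjoint_left]
  intro p hp hp'
  simp only [obsPast, obsSlice, Finset.mem_product, Finset.mem_range, Finset.mem_singleton] at hp hp'
  omega

/-- Currying of paths of observations. -/
abbrev pathOf (z : ∀ p : ℕ × Fin K, Y p.1 p.2) : ∀ s j, Y s j := fun s j => z (s, j)

theorem measurable_pathOf : Measurable (pathOf (Y := Y)) := by
  unfold pathOf; fun_prop

theorem measurable_update_path (t : ℕ) :
    Measurable fun p : (∀ s j, Y s j) × (∀ j, Y t j) => Function.update p.1 t p.2 := by
  refine measurable_pi_iff.2 fun s => ?_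
  by_cases hs : s = t
  · subst hs; simpa using measurable_snd
  · simp only [Function.update_of_ne hs]; fun_prop

/-- Writing the integral over one time slice as a marginal integral of `refObs` makes the slices of
different times composable. -/
theorem lintegral_update_path {t : ℕ} (ht : t ≤ T) {f : (∀ s j, Y s j) → ℝ≥0∞}
    (hf : Measurable f) (z : ∀ p : ℕ × Fin K, Y p.1 p.2) :
    ∫⁻ y, f (Function.update (pathOf z) t y) ∂(Measure.pi fun j => M.νY t j) =
      (∫⋯∫⁻_obsSlice K t, (fun z => f (pathOf z)) ∂M.refObs) z := by
  have := M.sigmaFinite_νY t ht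
  have hmem : ∀ j, (t, j) ∈ obsSlice K t := fun j => by simp [obsSlice]
  let φ : (∀ j, Y t j) → ∀ p : obsSlice K t, Y p.1.1 p.1.2 := fun y p =>
    Function.update (pathOf z) t y p.1.1 p.1.2
  have hφ : Measurable φ := measurable_pi_iff.2 fun p => by
    have := (measurable_update_path t).comp
      (measurable_const.prodMk measurable_id : Measurable fun y : ∀ j, Y t j => (pathOf z, y))
    exact (measurable_pi_apply p.1.2).comp ((measurable_pi_apply p.1.1).comp this)
  have key := lintegral_updateFinset M.refObs (Measure.pi fun j => M.νY t j) hφ (fun A _ => ?_)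
    (hf.comp measurable_pathOf) z
  · refine Eq.trans (lintegral_congr fun y => ?_) key
    change f _ = f _
    congr 1
    funext s j
    simp only [pathOf, Function.updateFinset]
    split_ifs with h
    · rfl
    · rw [Function.update_of_ne]
      rintro rfl
      exact h (hmem j)
  · have hpre : φ ⁻¹' Set.univ.pi A = Set.univ.pi fun j => A ⟨(t, j), hmem j⟩ := by
      ext y
      simp only [Set.mem_preimage, Set.mem_pi, Set.mem_univ, true_imp_iff, φ]
      refine ⟨fun h j => by simpa using h ⟨(t, j), hmem j⟩, ?_⟩
      rintro h ⟨⟨s, j⟩, hs⟩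
      obtain rfl : t = s := by simpa [obsSlice, eq_comm] using hs
      simpa using h j
    rw [hpre, Measure.pi_pi]
    refine Fintype.prod_bijective (fun j => (⟨(t, j), hmem j⟩ : obsSlice K t)) ⟨?_, ?_⟩ _ _ ?_
    · intro a b hab; simpa using hab
    · rintro ⟨⟨s, j⟩, hs⟩
      obtain rfl : t = s := by simpa [obsSlice, eq_comm] using hs
      exact ⟨j, rfl⟩
    · intro j
      simp [refObs, ht]

/-! ### Closed-loop actions and densities along paths of observations -/

variable [∀ t j, Nonempty (Y t j)] [∀ t j, Nonempty (U t j)] {g : ∀ j, Strategy n Y U j} {k : Fin K}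

/-- The actions of all players along a path of observations. -/
noncomputable def actOf (g : ∀ j, Strategy n Y U j) (y : ∀ s j, Y s j) : ∀ s j, U s j :=
  fill M.one_le_delay (fun _ _ => True) g y fun _ _ => Classical.arbitrary _

theorem actOf_eq (y : ∀ s j, Y s j) (t : ℕ) (j : Fin K) :
    M.actOf g y t j = g j t (sharedOf y (M.actOf g y) t) (privateOf y (M.actOf g y) t j) :=
  fill_of_mem trivial

theorem eq_actOf {y y' : ∀ s j, Y s j} {v : ∀ s j, U s j} {m : ℕ}
    (hy : ∀ s < m, ∀ j, y' s j = y s j)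
    (hv : ∀ s < m, ∀ j, v s j = g j s (sharedOf y' v s) (privateOf y' v s j)) :
    ∀ s < m, ∀ j, v s j = M.actOf g y s j :=
  eq_fill hy (fun s hs j _ => hv s hs j) fun _ _ _ h => absurd trivial h

/-- Causality of the closed loop: actions before `m` are determined by observations before `m`. -/
theorem actOf_congr {y y' : ∀ s j, Y s j} {m : ℕ} (hy : ∀ s < m, ∀ j, y s j = y' s j) :
    ∀ s < m, ∀ j, M.actOf g y s j = M.actOf g y' s j :=
  M.eq_actOf hy fun s _ j => M.actOf_eq y s j

theorem act_eq_actOf {y : ∀ s j, Y s j} {ω : Ω} {m : ℕ}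
    (hy : ∀ s < m, ∀ j, M.obs g s j ω = y s j) :
    ∀ s < m, ∀ j, M.act g s j ω = M.actOf g y s j :=
  M.eq_actOf (y' := fun s j => M.obs g s j ω) (v := fun s j => M.act g s j ω) hy
    fun s _ j => M.act_eq g s j ω

theorem measurable_actOf (hg : ∀ j, Admissible T (g j)) {t : ℕ} (ht : t < T) (j : Fin K) :
    Measurable fun y => M.actOf g y t j :=
  (measurable_fill (fun s hs j _ => hg j s hs) ht j).comp (measurable_id.prodMk measurable_const)

/-- The path of observations up to time `t`. -/
noncomputable def obsPath (g : ∀ j, Strategy n Y U j) (t : ℕ) (ω : Ω) : ∀ s j, Y s j :=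
  fun s => if s ≤ t then fun j => M.obs g s j ω else fun _ => Classical.arbitrary _

theorem obsPath_of_le {s t : ℕ} (hs : s ≤ t) (ω : Ω) (j : Fin K) :
    M.obsPath g t ω s j = M.obs g s j ω := by
  simp [obsPath, hs]

theorem obsPath_zero (ω : Ω) :
    M.obsPath g 0 ω = Function.update (fun _ _ => Classical.arbitrary _) 0 fun j => M.obs g 0 j ω := by
  funext s
  by_cases hs : s = 0
  · subst hs; simp [obsPath]
  · simp [obsPath, hs]

theorem obsPath_succ (t : ℕ) (ω : Ω) :
    M.obsPath g (t + 1) ω =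
      Function.update (M.obsPath g t ω) (t + 1) fun j => M.obs g (t + 1) j ω := by
  funext s
  by_cases hs : s = t + 1
  · subst hs; simp [obsPath]
  · rw [Function.update_of_ne hs]
    have : s ≤ t + 1 ↔ s ≤ t := by omega
    simp only [obsPath, this]

theorem measurable_obsPath_past [IsProbabilityMeasure P] (hg : ∀ j, Admissible T (g j)) {t : ℕ} (ht : t ≤ T) {a b : ℕ}
    (ha : t ≤ a) (hb : t < b) : Measurable[M.past a b] (M.obsPath g t) := by
  refine @measurable_pi_lambda _ _ _ (_) _ _ fun s => ?_
  by_cases hs : s ≤ t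
  · simp only [obsPath, hs, if_true]
    exact @measurable_pi_lambda _ _ _ (_) _ _ fun j =>
      M.measurable_obs_past hg (by omega) (by omega) (by omega) j
  · simp only [obsPath, hs, if_false]
    exact @measurable_const _ _ _ (_) _

theorem act_eq_actOf_obsPath {s t : ℕ} (hs : s ≤ t) (ω : Ω) (j : Fin K) :
    M.act g s j ω = M.actOf g (M.obsPath g t ω) s j :=
  M.act_eq_actOf (m := t + 1) (fun r hr j => (M.obsPath_of_le (by omega) ω j).symm) s (by omega) j

/-- The joint density of the state and the observations along a path of observations. -/
noncomputable def pathPDF (g : ∀ j, Strategy n Y U j) (k : Fin K) (t : ℕ) (x : X t)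
    (y : ∀ s j, Y s j) : ℝ≥0∞ :=
  M.jointPDF (fun j : {j : Fin K // j ≠ k} => g j.1) t (infoOf y (M.actOf g y) t k)
    (x, othersOf y (M.actOf g y) t k)

theorem likelihood_othersOf (t : ℕ) (x : X t) (y : ∀ s j, Y s j) (u : ∀ s j, U s j) :
    M.likelihood t k (y t k) (x, othersOf y u t k) = ∏ j, (M.Q t j (y t j) x : ℝ≥0∞) := by
  rw [Fintype.prod_eq_mul_prod_subtype_ne _ k]
  rfl

theorem pathPDF_zero (x : X 0) (y : ∀ s j, Y s j) :
    M.pathPDF g k 0 x y = (∏ j, (M.Q 0 j (y 0 j) x : ℝ≥0∞)) * (M.p0 x : ℝ≥0∞) := by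
  rw [pathPDF, jointPDF, initPDF_infoOf]
  exact congrArg (· * (M.p0 x : ℝ≥0∞)) (M.likelihood_othersOf 0 x y _)

/-- Along a closed-loop path the actions prescribed by the strategies are the actual ones, so the
delta product is 1 and the Bayes step becomes the usual forward equation. The player `k` has
disappeared from the transition factors. -/
theorem pathPDF_succ (t : ℕ) (x : X (t + 1)) (y : ∀ s j, Y s j) :
    M.pathPDF g k (t + 1) x y = (∏ j, (M.Q (t + 1) j (y (t + 1) j) x : ℝ≥0∞)) *
      ∫⁻ x', (M.S t x x' (M.actOf g y t) : ℝ≥0∞) * M.pathPDF g k t x' y ∂M.νX t := by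
  have hact : ∀ j : {j : Fin K // j ≠ k}, g j.1 t (sharedOf y (M.actOf g y) t)
      (othersOf y (M.actOf g y) t k j) = M.actOf g y t j.1 := fun j => (M.actOf_eq y t j.1).symm
  rw [pathPDF, jointPDF, stepPDF_infoOf, bayesUnnormalized, likelihood_othersOf]
  simp only [prevOthers_othersOf, hact, join_eta, deltaProduct_othersOf (fun _ => rfl), mul_one]
  rfl

theorem pathPDF_congr {t : ℕ} (x : X t) {y y' : ∀ s j, Y s j}
    (hy : ∀ s < t + 1, ∀ j, y s j = y' s j) : M.pathPDF g k t x y = M.pathPDF g k t x y' := by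
  have hu := M.actOf_congr (g := g) hy
  rw [pathPDF, pathPDF, infoOf_congr (fun s hs j _ => hy s hs j)
      (fun s hs j _ => hu s (by omega) j) M.one_le_delay,
    othersOf_congr (fun s _ hs j _ => hy s hs j) (fun s _ hs j _ => hu s (by omega) j)]

theorem measurable_infoOf_actOf (hg : ∀ j, Admissible T (g j)) {t : ℕ} (ht : t ≤ T) :
    Measurable fun y => (infoOf y (M.actOf g y) t k : Shared n Y U t × Private n Y U t k) :=
  measurable_infoOf_comp M.one_le_delay (fun s _ j => by fun_prop)
    fun s hs j => M.measurable_actOf hg (by omega) j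

theorem measurable_othersOf_actOf (hg : ∀ j, Admissible T (g j)) {t : ℕ} (ht : t ≤ T) :
    Measurable fun y => (othersOf y (M.actOf g y) t k : PrivateOthers n Y U t k) :=
  measurable_othersOf_comp (fun s _ j => by fun_prop)
    fun s hs j => M.measurable_actOf hg (by omega) j

variable [∀ t j, StandardBorelSpace (U t j)]

theorem measurable_pathPDF (hg : ∀ j, Admissible T (g j)) {t : ℕ} (ht : t ≤ T) :
    Measurable fun p : X t × (∀ s j, Y s j) => M.pathPDF g k t p.1 p.2 :=
  (M.measurable_jointPDF (fun j => hg j.1) ht).comp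
    (((M.measurable_infoOf_actOf hg ht).comp measurable_snd).prodMk
      (measurable_fst.prodMk ((M.measurable_othersOf_actOf hg ht).comp measurable_snd)))

attribute [irreducible] pathPDF

/-! ### One-step expectations and the joint law of state and observations -/

variable [IsProbabilityMeasure P]

/-- X_{t+1} is a function of W_t and of quantities measurable with respect to `past t (t + 1)`, of
which W_t is independent. -/
theorem lintegral_state_succ (hg : ∀ j, Admissible T (g j)) {t : ℕ} (ht : t < T) {ρ : Type*}
    [MeasurableSpace ρ] {R : Ω → ρ} (hR : Measurable[M.past t (t + 1)] R)
    {G : ρ × X (t + 1) → ℝ≥0∞} (hG : Measurable G) :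
    ∫⁻ ω, G (R ω, M.state g (t + 1) ω) ∂P =
      ∫⁻ ω, ∫⁻ x', (M.S t x' (M.state g t ω) (fun j => M.act g t j ω) : ℝ≥0∞) * G (R ω, x')
        ∂M.νX (t + 1) ∂P := by
  simp only [state_succ]
  have hR' : Measurable[M.past t (t + 1)] fun ω => (R ω, M.state g t ω, fun j => M.act g t j ω) :=
    hR.prodMk ((M.measurable_state_past hg ht.le le_rfl (by omega)).prodMk
      (@measurable_pi_lambda _ _ _ (_) _ _ fun j =>
        M.measurable_act_past hg ht le_rfl (by omega) j))
  have hGm : Measurable fun p : (ρ × X t × ∀ j, U t j) × W t =>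
      G (p.1.1, M.f t p.1.2.1 p.1.2.2 p.2) :=
    hG.comp ((measurable_fst.comp measurable_fst).prodMk ((M.measurable_f t ht).comp
      (by fun_prop : Measurable fun p : (ρ × X t × ∀ j, U t j) × W t =>
        (p.1.2.1, p.1.2.2, p.2))))
  refine (lintegral_of_indep (M.past_le _ _) hR' (M.measurable_w t ht) (M.indep_past_w ht (t + 1))
    hGm).trans (lintegral_congr fun ω => ?_)
  exact M.lintegral_f ht _ _ (hG.comp (measurable_const.prodMk measurable_id))

theorem lintegral_obs (hg : ∀ j, Admissible T (g j)) {t : ℕ} (ht : t ≤ T) {ρ : Type*}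
    [MeasurableSpace ρ] {R : Ω → ρ} (hR : Measurable[M.past t t] R)
    {G : ρ × (∀ j, Y t j) → ℝ≥0∞} (hG : Measurable G) :
    ∫⁻ ω, G (R ω, fun j => M.obs g t j ω) ∂P =
      ∫⁻ ω, ∫⁻ y, (∏ j, (M.Q t j (y j) (M.state g t ω) : ℝ≥0∞)) * G (R ω, y)
        ∂(Measure.pi fun j => M.νY t j) ∂P := by
  have hR' : Measurable[M.past t t] fun ω => (R ω, M.state g t ω) :=
    hR.prodMk (M.measurable_state_past hg ht le_rfl le_rfl)
  have hGm : Measurable fun p : (ρ × X t) × (∀ j, Z t j) =>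
      G (p.1.1, fun j => M.h t j p.1.2 (p.2 j)) :=
    hG.comp ((measurable_fst.comp measurable_fst).prodMk (measurable_pi_iff.2 fun j =>
      (M.measurable_h t ht j).comp (by fun_prop : Measurable fun p : (ρ × X t) × (∀ j, Z t j) =>
        (p.1.2, p.2 j))))
  refine (lintegral_of_indep (M.past_le _ _) hR' (M.measurable_zTuple ht) (M.indep_past_z ht t)
    hGm).trans (lintegral_congr fun ω => ?_)
  exact M.lintegral_h ht _ (hG.comp (measurable_const.prodMk measurable_id))

theorem measurable_prod_Q {t : ℕ} (ht : t ≤ T) :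
    Measurable fun p : X t × (∀ j, Y t j) => ∏ j, (M.Q t j (p.2 j) p.1 : ℝ≥0∞) :=
  Finset.measurable_prod _ fun j _ => ((M.measurable_Q t ht j).comp
    (by fun_prop : Measurable fun p : X t × (∀ j, Y t j) => (p.2 j, p.1))).coe_nnreal_ennreal

/-- The expectation of the next observation. -/
noncomputable def obsIntegral (t : ℕ) (F : X t × (∀ s j, Y s j) → ℝ≥0∞)
    (p : X t × (∀ s j, Y s j)) : ℝ≥0∞ :=
  ∫⁻ y, (∏ j, (M.Q t j (y j) p.1 : ℝ≥0∞)) * F (p.1, Function.update p.2 t y)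
    ∂(Measure.pi fun j => M.νY t j)

theorem measurable_obsIntegral {t : ℕ} (ht : t ≤ T) {F : X t × (∀ s j, Y s j) → ℝ≥0∞}
    (hF : Measurable F) : Measurable (M.obsIntegral t F) := by
  have := M.sigmaFinite_νY t ht
  refine Measurable.lintegral_prod_right' (f := fun q : (X t × (∀ s j, Y s j)) × (∀ j, Y t j) =>
    (∏ j, (M.Q t j (q.2 j) q.1.1 : ℝ≥0∞)) * F (q.1.1, Function.update q.1.2 t q.2)) ?_
  refine Measurable.mul ((M.measurable_prod_Q ht).comp (by fun_prop : Measurable fun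
    q : (X t × (∀ s j, Y s j)) × (∀ j, Y t j) => (q.1.1, q.2))) (hF.comp ?_)
  exact (measurable_fst.comp measurable_fst).prodMk ((measurable_update_path t).comp
    (by fun_prop : Measurable fun
      q : (X t × (∀ s j, Y s j)) × (∀ j, Y t j) => (q.1.2, q.2)))

/-- The joint law of the state and the observations. -/
theorem lintegral_state_obsPath (hg : ∀ j, Admissible T (g j)) (k : Fin K) {t : ℕ} (ht : t ≤ T)
    {F : X t × (∀ s j, Y s j) → ℝ≥0∞} (hF : Measurable F) :
    ∫⁻ ω, F (M.state g t ω, M.obsPath g t ω) ∂P =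
      ∫⁻ x, (∫⋯∫⁻_obsPast K t, (fun z => M.pathPDF g k t x (pathOf z) * F (x, pathOf z)) ∂M.refObs)
        (fun _ => Classical.arbitrary _) ∂M.νX t := by
  have hFx : ∀ x, Measurable fun y => F (x, y) := fun x =>
    hF.comp (measurable_const.prodMk measurable_id)
  induction t with
  | zero =>
    have h1 := M.lintegral_obs hg ht (R := M.state g 0) (M.measurable_state_past hg ht le_rfl le_rfl)
      (G := fun p => F (p.1, Function.update (fun _ _ => Classical.arbitrary _) 0 p.2))
      (hF.comp (measurable_fst.prodMk ((measurable_update_path 0).comp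
        (measurable_const.prodMk measurable_snd))))
    simp only [obsPath_zero]
    rw [h1]
    simp only [state_zero]
    have h2 := M.measurable_obsIntegral ht hF
    have hp0 : Measurable fun x => (M.p0 x : ℝ≥0∞) := M.measurable_p0.coe_nnreal_ennreal
    have h3 : Measurable fun x => M.obsIntegral 0 F (x, fun _ _ => Classical.arbitrary _) :=
      h2.comp (measurable_id.prodMk measurable_const)
    change ∫⁻ ω, M.obsIntegral 0 F (M.x0 ω, fun _ _ => Classical.arbitrary _) ∂P = _
    rw [← lintegral_map (f := fun x => M.obsIntegral 0 F (x, fun _ _ => Classical.arbitrary _)) h3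
      M.measurable_x0, M.law_x0, lintegral_withDensity_eq_lintegral_mul _ hp0 h3]
    refine lintegral_congr fun x => ?_
    rw [obsPast_zero, ← M.lintegral_update_path ht (f := fun y => M.pathPDF g k 0 x y * F (x, y))
      (((M.measurable_pathPDF (k := k) hg ht).comp (measurable_const.prodMk measurable_id)).mul (hFx x))]
    simp only [Pi.mul_apply, obsIntegral]
    rw [← lintegral_const_mul' _ _ ENNReal.coe_ne_top]
    refine lintegral_congr fun y => ?_
    rw [pathPDF_zero, ← mul_assoc, mul_comm (M.p0 x : ℝ≥0∞), Function.update_self]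
  | succ t ih =>
    have ht' : t < T := ht
    have := M.sigmaFinite_νX t ht'.le
    have := M.sigmaFinite_νX (t + 1) ht
    have hK := M.measurable_obsIntegral ht hF
    have hS : Measurable fun q : (X t × (∀ s j, Y s j)) × X (t + 1) =>
        (M.S t q.2 q.1.1 (M.actOf g q.1.2 t) : ℝ≥0∞) :=
      ((M.measurable_S t ht').comp (measurable_snd.prodMk
        ((measurable_fst.comp measurable_fst).prodMk (measurable_pi_iff.2 fun j =>
          (M.measurable_actOf hg ht' j).comp
            (measurable_snd.comp measurable_fst))))).coe_nnreal_ennreal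
    have hK' : Measurable fun q : (X t × (∀ s j, Y s j)) × X (t + 1) =>
        M.obsIntegral (t + 1) F (q.2, q.1.2) :=
      hK.comp (measurable_snd.prodMk (measurable_snd.comp measurable_fst))
    have hH : Measurable fun p : X t × (∀ s j, Y s j) =>
        ∫⁻ x', (M.S t x' p.1 (M.actOf g p.2 t) : ℝ≥0∞) * M.obsIntegral (t + 1) F (x', p.2)
          ∂M.νX (t + 1) :=
      (hS.mul hK').lintegral_prod_right'
    have hp : Measurable fun q : (X t × (∀ s j, Y s j)) × X (t + 1) =>
        M.pathPDF g k t q.1.1 q.1.2 := (M.measurable_pathPDF (k := k) hg ht'.le).comp measurable_fst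
    -- conversion of the expectation
    have h1 := M.lintegral_obs hg ht (R := fun ω => (M.state g (t + 1) ω, M.obsPath g t ω))
      ((M.measurable_state_past hg ht le_rfl le_rfl).prodMk
        (M.measurable_obsPath_past hg ht'.le (by omega) (by omega)))
      (G := fun p => F (p.1.1, Function.update p.1.2 (t + 1) p.2))
      (hF.comp ((measurable_fst.comp measurable_fst).prodMk ((measurable_update_path (t + 1)).comp
        ((measurable_snd.comp measurable_fst).prodMk measurable_snd))))
    -- Once Y_{t+1} has been averaged out, X_{t+1} is averaged out using the independence of W_t
    -- from the path up to `t`.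
    have h2 := M.lintegral_state_succ hg ht' (R := M.obsPath g t)
      (M.measurable_obsPath_past hg ht'.le le_rfl (by omega))
      (G := fun p => M.obsIntegral (t + 1) F (p.2, p.1)) (hK.comp measurable_swap)
    -- What remains depends on X_t and the path only, U_t being a function of the path, so the
    -- induction hypothesis applies.
    have h3 := ih ht'.le hH fun x => hH.comp (measurable_const.prodMk measurable_id)
    simp only [obsPath_succ]
    refine h1.trans (h2.trans (Eq.trans ?_ (h3.trans ?_)))
    · refine lintegral_congr fun ω => lintegral_congr fun x' => ?_
      simp only [M.act_eq_actOf_obsPath le_rfl ω]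
    -- exchange of the integrals
    have hpath : Measurable fun q : X (t + 1) × (∀ p : ℕ × Fin K, Y p.1 p.2) =>
        (q.1, pathOf q.2) := measurable_fst.prodMk (measurable_pathOf.comp measurable_snd)
    have hpath' : Measurable fun q : X t × (∀ p : ℕ × Fin K, Y p.1 p.2) =>
        (q.1, pathOf q.2) := measurable_fst.prodMk (measurable_pathOf.comp measurable_snd)
    have hq : Measurable fun q : X (t + 1) × (∀ p : ℕ × Fin K, Y p.1 p.2) =>
        M.pathPDF g k (t + 1) q.1 (pathOf q.2) * F (q.1, pathOf q.2) :=
      Measurable.mul ((M.measurable_pathPDF (k := k) hg ht).comp hpath) (hF.comp hpath)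
    have hq' : Measurable fun q : X t × (∀ p : ℕ × Fin K, Y p.1 p.2) =>
        M.pathPDF g k t q.1 (pathOf q.2) *
          ∫⁻ x', (M.S t x' q.1 (M.actOf g (pathOf q.2) t) : ℝ≥0∞) *
            M.obsIntegral (t + 1) F (x', pathOf q.2) ∂M.νX (t + 1) :=
      Measurable.mul ((M.measurable_pathPDF (k := k) hg ht'.le).comp hpath') (hH.comp hpath')
    refine (lintegral_lmarginal_swap M.refObs (obsPast K t) hq' _).trans
      (Eq.trans ?_ (lintegral_lmarginal_swap M.refObs (obsPast K (t + 1)) hq _).symm)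
    have hq'' : Measurable fun z : ∀ p : ℕ × Fin K, Y p.1 p.2 =>
        ∫⁻ x, M.pathPDF g k (t + 1) x (pathOf z) * F (x, pathOf z) ∂M.νX (t + 1) :=
      (hq.comp measurable_swap).lintegral_prod_right'
    -- The observations up to `t` stay fixed from here on; only the slice at `t + 1` and the two
    -- states are integrated.
    rw [obsPast_succ, lmarginal_union _ _ hq'' (disjoint_obsPast_obsSlice t)]
    refine congrFun (congrArg (lmarginal M.refObs (obsPast K t)) ?_) _
    funext z
    have h4 := lintegral_lmarginal_swap M.refObs (obsSlice K (t + 1)) (ν := M.νX (t + 1)) (f := fun x z =>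
        M.pathPDF g k (t + 1) x (pathOf z) * F (x, pathOf z)) hq z
    rw [← h4]
    have h5 : ∀ x', (∫⋯∫⁻_obsSlice K (t + 1), (fun z => M.pathPDF g k (t + 1) x' (pathOf z) *
        F (x', pathOf z)) ∂M.refObs) z =
        ∫⁻ x, M.pathPDF g k t x (pathOf z) * ((M.S t x' x (M.actOf g (pathOf z) t) : ℝ≥0∞) *
          M.obsIntegral (t + 1) F (x', pathOf z)) ∂M.νX t := by
      intro x'
      have hm : Measurable fun x => (M.S t x' x (M.actOf g (pathOf z) t) : ℝ≥0∞) *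
          M.pathPDF g k t x (pathOf z) :=
        (hS.mul hp).comp ((measurable_id.prodMk measurable_const).prodMk measurable_const)
      have hm' : Measurable fun y : ∀ j, Y (t + 1) j => (∏ j, (M.Q (t + 1) j (y j) x' : ℝ≥0∞)) *
          F (x', Function.update (pathOf z) (t + 1) y) :=
        ((M.measurable_prod_Q ht).comp (measurable_const.prodMk measurable_id)).mul
          ((hFx x').comp ((measurable_update_path (t + 1)).comp
            (measurable_const.prodMk measurable_id)))
      rw [← M.lintegral_update_path ht (f := fun y => M.pathPDF g k (t + 1) x' y * F (x', y))
        (((M.measurable_pathPDF (k := k) hg ht).comp (measurable_const.prodMk measurable_id)).mul (hFx x'))]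
      -- The density at time `t` and the actions at time `t` ignore Y_{t+1}, so the integral over
      -- the old state factors out of the integral over the new observation.
      have hupd : ∀ (y : ∀ j, Y (t + 1) j) x,
          M.pathPDF g k t x (Function.update (pathOf z) (t + 1) y) = M.pathPDF g k t x (pathOf z) :=
        fun y x => M.pathPDF_congr x fun s hs j => by rw [Function.update_of_ne (by omega)]
      have hupd' : ∀ y : ∀ j, Y (t + 1) j,
          M.actOf g (Function.update (pathOf z) (t + 1) y) t = M.actOf g (pathOf z) t :=
        fun y => funext fun j => M.actOf_congr (m := t + 1)
          (fun s hs j => by rw [Function.update_of_ne (by omega)]) t (by omega) j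
      simp only [pathPDF_succ, hupd, hupd', Function.update_self]
      calc _ = ∫⁻ y, (∫⁻ x, (M.S t x' x (M.actOf g (pathOf z) t) : ℝ≥0∞) *
              M.pathPDF g k t x (pathOf z) ∂M.νX t) * ((∏ j, (M.Q (t + 1) j (y j) x' : ℝ≥0∞)) *
              F (x', Function.update (pathOf z) (t + 1) y))
              ∂(Measure.pi fun j => M.νY (t + 1) j) := lintegral_congr fun y => by ring
        _ = (∫⁻ x, (M.S t x' x (M.actOf g (pathOf z) t) : ℝ≥0∞) *
              M.pathPDF g k t x (pathOf z) ∂M.νX t) * M.obsIntegral (t + 1) F (x', pathOf z) :=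
            lintegral_const_mul _ hm'
        _ = _ := by
            rw [← lintegral_mul_const _ hm]
            exact lintegral_congr fun x => by ring
    simp only [h5]
    rw [← lintegral_lintegral_swap]
    · refine lintegral_congr fun x => ?_
      rw [lintegral_const_mul]
      have hc : Measurable fun x' : X (t + 1) => ((x, pathOf z), x') :=
        measurable_const.prodMk measurable_id
      exact Measurable.mul (hS.comp hc) (hK'.comp hc)
    · exact ((hp.mul (hS.mul hK')).comp
        ((measurable_fst.prodMk measurable_const).prodMk measurable_snd)).aemeasurable

end TeamModel

namespace TeamModel

variable {T n K : ℕ} {Ω : Type uΩ} [MeasurableSpace Ω] {P : Measure Ω}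
  {X : ℕ → Type uX} {Y : ℕ → Fin K → Type uY} {U : ℕ → Fin K → Type uX}
  {W : ℕ → Type uW} {Z : ℕ → Fin K → Type uZ}
  [∀ t, MeasurableSpace (X t)] [∀ t j, MeasurableSpace (Y t j)]
  [∀ t j, MeasurableSpace (U t j)] [∀ t, MeasurableSpace (W t)]
  [∀ t j, MeasurableSpace (Z t j)]
  (M : TeamModel T n K P X Y U W Z)

/-! ### Hidden and visible observations -/

/-- Indices of the observations hidden from player `k` at time `t`. -/
def hiddenIndex (n : ℕ) (t : ℕ) (k : Fin K) : Finset (ℕ × Fin K) :=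
  Finset.Ico (t + 1 - n) (t + 1) ×ˢ Finset.univ.erase k

theorem mem_hiddenIndex {t : ℕ} {k : Fin K} {p : ℕ × Fin K} :
    p ∈ hiddenIndex n t k ↔ (t + 1 - n ≤ p.1 ∧ p.1 < t + 1) ∧ p.2 ≠ k := by
  simp only [hiddenIndex, Finset.mem_product, Finset.mem_Ico, Finset.mem_erase, Finset.mem_univ,
    and_true]

theorem obsPast_eq_union (n t : ℕ) (k : Fin K) :
    obsPast K t = obsPast K t \ hiddenIndex n t k ∪ hiddenIndex n t k := by
  rw [Finset.sdiff_union_of_subset]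
  intro p hp
  have := mem_hiddenIndex.1 hp
  simp [obsPast]
  omega

/-- Replacement of the hidden observations in a path. -/
def setHidden {t : ℕ} {k : Fin K} (y : ∀ s j, Y s j) (h : HiddenObs n Y t k) : ∀ s j, Y s j :=
  fun s j => if hs : (t + 1 - n ≤ s ∧ s < t + 1) ∧ j ≠ k then
    h ⟨j, hs.2⟩ ⟨s, Finset.mem_Ico.2 hs.1⟩ else y s j

theorem setHidden_of_mem {t : ℕ} {k : Fin K} (y : ∀ s j, Y s j) (h : HiddenObs n Y t k) {s : ℕ}
    {j : Fin K} (hs : (t + 1 - n ≤ s ∧ s < t + 1) ∧ j ≠ k) :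
    setHidden y h s j = h ⟨j, hs.2⟩ ⟨s, Finset.mem_Ico.2 hs.1⟩ := dif_pos hs

theorem setHidden_of_notMem {t : ℕ} {k : Fin K} (y : ∀ s j, Y s j) (h : HiddenObs n Y t k) {s : ℕ}
    {j : Fin K} (hs : ¬ ((t + 1 - n ≤ s ∧ s < t + 1) ∧ j ≠ k)) :
    setHidden y h s j = y s j := dif_neg hs

/-- The nested product over players and times in `hiddenMeasure` is the flat product over
`hiddenIndex`, up to reindexing; all its times lie within the horizon. -/
theorem lintegral_setHidden {t : ℕ} (ht : t ≤ T) (k : Fin K) {f : (∀ s j, Y s j) → ℝ≥0∞}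
    (hf : Measurable f) (z : ∀ p : ℕ × Fin K, Y p.1 p.2) :
    ∫⁻ h, f (setHidden (pathOf z) h) ∂M.hiddenMeasure t k =
      (∫⋯∫⁻_hiddenIndex n t k, (fun z => f (pathOf z)) ∂M.refObs) z := by
  have := M.sigmaFinite_hidden ht k
  let φ : HiddenObs n Y t k → ∀ p : hiddenIndex n t k, Y p.1.1 p.1.2 := fun h p =>
    h ⟨p.1.2, (mem_hiddenIndex.1 p.2).2⟩ ⟨p.1.1, Finset.mem_Ico.2 (mem_hiddenIndex.1 p.2).1⟩
  have hφ : Measurable φ := by fun_prop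
  have hmem : ∀ (j : {j : Fin K // j ≠ k}) (s : Finset.Ico (t + 1 - n) (t + 1)),
      (s.1, j.1) ∈ hiddenIndex n t k := fun j s =>
    mem_hiddenIndex.2 ⟨Finset.mem_Ico.1 s.2, j.2⟩
  have key := lintegral_updateFinset M.refObs (M.hiddenMeasure t k) hφ (fun A _ => ?_)
    (hf.comp measurable_pathOf) z
  · refine Eq.trans (lintegral_congr fun h => ?_) key
    change f _ = f _
    congr 1
    funext s j
    simp only [pathOf, Function.updateFinset, setHidden, φ, mem_hiddenIndex]
  · have hpre : φ ⁻¹' Set.univ.pi A =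
        Set.univ.pi fun j => Set.univ.pi fun s => A ⟨(s.1, j.1), hmem j s⟩ := by
      ext h
      simp only [Set.mem_preimage, Set.mem_pi, Set.mem_univ, true_imp_iff, φ]
      exact ⟨fun H j s => H ⟨(s.1, j.1), hmem j s⟩, fun H p =>
        H ⟨p.1.2, (mem_hiddenIndex.1 p.2).2⟩ ⟨p.1.1, Finset.mem_Ico.2 (mem_hiddenIndex.1 p.2).1⟩⟩
    rw [hpre, hiddenMeasure, Measure.pi_pi]
    simp only [Measure.pi_pi]
    rw [← Fintype.prod_prod_type' (f := fun (j : {j : Fin K // j ≠ k})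
      (s : Finset.Ico (t + 1 - n) (t + 1)) => M.νY s.1 j.1 (A ⟨(s.1, j.1), hmem j s⟩))]
    refine Fintype.prod_bijective
      (fun q : {j : Fin K // j ≠ k} × Finset.Ico (t + 1 - n) (t + 1) =>
        (⟨(q.2.1, q.1.1), hmem q.1 q.2⟩ : hiddenIndex n t k)) ⟨?_, ?_⟩ _ _ ?_
    · rintro ⟨⟨a, ha⟩, ⟨b, hb⟩⟩ ⟨⟨c, hc⟩, ⟨d, hd⟩⟩ hab
      simp only [Subtype.mk.injEq, Prod.mk.injEq] at hab
      simp [hab.1, hab.2]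
    · rintro ⟨⟨s, j⟩, hs⟩
      exact ⟨(⟨j, (mem_hiddenIndex.1 hs).2⟩, ⟨s, Finset.mem_Ico.2 (mem_hiddenIndex.1 hs).1⟩), rfl⟩
    · rintro ⟨j, s⟩
      have hs : s.1 ≤ T := by have := (Finset.mem_Ico.1 s.2).2; omega
      simp [refObs, hs]

variable [∀ t j, Nonempty (Y t j)] [∀ t j, Nonempty (U t j)] {g : ∀ j, Strategy n Y U j} {k : Fin K}

/-- The visible actions do not depend on the hidden observations. -/
theorem actOf_setHidden {t : ℕ} (y : ∀ s j, Y s j) (h : HiddenObs n Y t k) :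
    ∀ s < t, ∀ j, (s < t + 1 - n ∨ j = k) →
      M.actOf g (setHidden y h) s j = M.actOf g y s j := by
  have hn := M.one_le_delay
  have hsh : ∀ s < t + 1 - n, ∀ j, M.actOf g (setHidden y h) s j = M.actOf g y s j :=
    M.actOf_congr fun s hs j => setHidden_of_notMem y h fun hc => by omega
  intro s
  induction s using Nat.strong_induction_on with
  | _ s ih =>
    intro hs j hj
    by_cases hs' : s < t + 1 - n
    · exact hsh s hs' j
    -- After the shared times, the visible actions are those of player `k`, computed from shared
    -- data and from his own earlier data, none of which is altered.
    obtain rfl := hj.resolve_left hs'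
    rw [actOf_eq, actOf_eq,
      sharedOf_congr (fun r hr i => setHidden_of_notMem y h fun hc => by omega)
        (fun r hr i => hsh r (by omega) i),
      privateOf_congr (fun r _ hr => setHidden_of_notMem y h fun hc => hc.2 rfl)
        (fun r _ hr => ih r (by omega) (by omega) j (Or.inr rfl))]

theorem infoOf_setHidden {t : ℕ} (y : ∀ s j, Y s j) (h : HiddenObs n Y t k) :
    (infoOf (setHidden y h) (M.actOf g (setHidden y h)) t k :
      Shared n Y U t × Private n Y U t k) = infoOf y (M.actOf g y) t k :=
  infoOf_congr (fun _ _ _ hj => setHidden_of_notMem y h fun hc => by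
      rcases hj with hj | hj
      · omega
      · exact hc.2 hj)
    (M.actOf_setHidden y h) M.one_le_delay

theorem othersOf_setHidden_fst {t : ℕ} (y : ∀ s j, Y s j) (h : HiddenObs n Y t k)
    (u : ∀ s j, U s j) (j : {j : Fin K // j ≠ k}) :
    ((othersOf (setHidden y h) u t k : PrivateOthers n Y U t k) j).1 = h j := by
  funext s
  exact setHidden_of_mem y h ⟨Finset.mem_Ico.1 s.2, j.2⟩

/-- On the support, the hidden actions are generated by the strategies. -/
theorem eq_othersOf_of_consistentSupport {t : ℕ}
    {F : Shared n Y U t × Private n Y U t k → X t × PrivateOthers n Y U t k → ℝ≥0∞}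
    (hF : ConsistentSupport (fun j => g j.1) t F) (y : ∀ s j, Y s j) (x : X t)
    (h : HiddenObs n Y t k) (u : HiddenAct n U t k)
    (hne : F (infoOf y (M.actOf g y) t k) (x, fun j => (h j, u j)) ≠ 0) :
    u = fun j => ((othersOf (setHidden y h) (M.actOf g (setHidden y h)) t k :
      PrivateOthers n Y U t k) j).2 := by
  set y' := setHidden y h with hy'
  -- The given hidden actions are completed by closed-loop actions, so that the support condition,
  -- which speaks of paths, can be applied.
  let v : ∀ s j, U s j := fun s j => if hs : (t + 1 - n ≤ s ∧ s < t) ∧ j ≠ k then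
    u ⟨j, hs.2⟩ ⟨s, Finset.mem_Ico.2 hs.1⟩ else M.actOf g y' s j
  have hv : ∀ s j, ¬ ((t + 1 - n ≤ s ∧ s < t) ∧ j ≠ k) → v s j = M.actOf g y' s j :=
    fun s j hs => dif_neg hs
  have hi : (infoOf y' v t k : Shared n Y U t × Private n Y U t k) =
      infoOf y (M.actOf g y) t k := by
    rw [← M.infoOf_setHidden y h]
    exact infoOf_congr (fun _ _ _ _ => rfl) (fun s hs j hj => hv s j fun hc => by
      rcases hj with hj | hj
      · omega
      · exact hc.2 hj) M.one_le_delay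
  have ho : (othersOf y' v t k : PrivateOthers n Y U t k) = fun j => (h j, u j) := by
    funext j
    refine Prod.ext (othersOf_setHidden_fst y h v j) ?_
    funext s
    exact dif_pos (⟨Finset.mem_Ico.1 s.2, j.2⟩ : (t + 1 - n ≤ s.1 ∧ s.1 < t) ∧ j.1 ≠ k)
  have hc := hF x y' v (by rwa [hi, ho])
  -- Both `v` and the closed-loop actions follow the strategies at the hidden indices and agree
  -- elsewhere, so both equal the same `fill`.
  have h1 := eq_fill (hn := M.one_le_delay) (g := g)
    (A := fun s j => (t + 1 - n ≤ s ∧ s < t) ∧ j ≠ k) (y := y') (y' := y')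
    (u := M.actOf g y') (v := v) (m := t) (fun _ _ _ => rfl)
    (fun s _ j hs => hc s hs.1.1 hs.1.2 ⟨j, hs.2⟩) (fun s _ j hs => hv s j hs)
  have h2 := eq_fill (hn := M.one_le_delay) (g := g)
    (A := fun s j => (t + 1 - n ≤ s ∧ s < t) ∧ j ≠ k) (y := y') (y' := y')
    (u := M.actOf g y') (v := M.actOf g y') (m := t) (fun _ _ _ => rfl)
    (fun s _ j _ => M.actOf_eq y' s j) (fun _ _ _ _ => rfl)
  funext j s
  have hs := Finset.mem_Ico.1 s.2
  have h3 : v s.1 j.1 = u j s := dif_pos (⟨hs, j.2⟩ : (t + 1 - n ≤ s.1 ∧ s.1 < t) ∧ j.1 ≠ k)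
  rw [← h3, h1 s.1 hs.2 j.1, ← h2 s.1 hs.2 j.1]
  rfl

/-- The integral over extended states at fixed information becomes an integral over closed-loop
paths with varying hidden observations, because such a change leaves the information fixed. -/
theorem integralExt_infoOf {t : ℕ}
    {F : Shared n Y U t × Private n Y U t k → X t × PrivateOthers n Y U t k → ℝ≥0∞}
    (hF : ConsistentSupport (fun j => g j.1) t F) (y : ∀ s j, Y s j) :
    M.integralExt t k (F (infoOf y (M.actOf g y) t k)) =
      ∫⁻ x, ∫⁻ h, F (infoOf (setHidden y h) (M.actOf g (setHidden y h)) t k)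
        (x, othersOf (setHidden y h) (M.actOf g (setHidden y h)) t k)
        ∂M.hiddenMeasure t k ∂M.νX t := by
  rw [M.integralExt_eq_of_support _ (M.eq_othersOf_of_consistentSupport hF y)]
  refine lintegral_congr fun x => lintegral_congr fun h => ?_
  rw [infoOf_setHidden]
  congr 2
  funext j
  exact Prod.ext (othersOf_setHidden_fst y h _ j).symm rfl

/-! ### The joint density of information and extended state -/

variable [∀ t j, StandardBorelSpace (U t j)] [IsProbabilityMeasure P]

theorem info_eq (t : ℕ) (ω : Ω) :
    M.info g t k ω = infoOf (M.obsPath g t ω) (M.actOf g (M.obsPath g t ω)) t k := by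
  refine Eq.trans (b := infoOf (fun s j => M.obs g s j ω) (fun s j => M.act g s j ω) t k) rfl ?_
  exact infoOf_congr (fun s hs j _ => (M.obsPath_of_le (by omega) ω j).symm)
    (fun s hs j _ => M.act_eq_actOf_obsPath (by omega) ω j) M.one_le_delay

theorem extState_eq (t : ℕ) (ω : Ω) :
    M.extState g t k ω =
      (M.state g t ω, othersOf (M.obsPath g t ω) (M.actOf g (M.obsPath g t ω)) t k) := by
  refine Eq.trans (b := (M.state g t ω,
    othersOf (fun s j => M.obs g s j ω) (fun s j => M.act g s j ω) t k)) rfl ?_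
  refine congrArg (Prod.mk _) ?_
  exact othersOf_congr (fun s _ hs j _ => (M.obsPath_of_le (by omega) ω j).symm)
    (fun s _ hs j _ => M.act_eq_actOf_obsPath (by omega) ω j)

theorem measurable_info (hg : ∀ j, Admissible T (g j)) (k : Fin K) {t : ℕ} (ht : t ≤ T) :
    Measurable (M.info g t k) := by
  have : M.info g t k = fun ω =>
      infoOf (M.obsPath g t ω) (M.actOf g (M.obsPath g t ω)) t k := funext fun ω => M.info_eq t ω
  rw [this]
  exact (M.measurable_infoOf_actOf hg ht).comp
    ((M.measurable_obsPath_past hg ht le_rfl (Nat.lt_succ_self t)).mono (M.past_le _ _) le_rfl)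

theorem measurable_extState (hg : ∀ j, Admissible T (g j)) (k : Fin K) {t : ℕ} (ht : t ≤ T) :
    Measurable (M.extState g t k) := by
  have : M.extState g t k = fun ω =>
      (M.state g t ω, othersOf (M.obsPath g t ω) (M.actOf g (M.obsPath g t ω)) t k) :=
    funext fun ω => M.extState_eq t ω
  rw [this]
  exact ((M.measurable_state_past hg ht le_rfl le_rfl).mono (M.past_le _ _) le_rfl).prodMk
    ((M.measurable_othersOf_actOf hg ht).comp
    ((M.measurable_obsPath_past hg ht le_rfl (Nat.lt_succ_self t)).mono (M.past_le _ _) le_rfl))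

/-- `jointPDF` is the joint density of the information and the extended state, with respect to a
reference measure on the space of the information. -/
theorem exists_lintegral_info_extState (hg : ∀ j, Admissible T (g j)) (k : Fin K) {t : ℕ}
    (ht : t ≤ T) :
    ∃ μ : Measure (Shared n Y U t × Private n Y U t k),
      ∀ F : (Shared n Y U t × Private n Y U t k) × (X t × PrivateOthers n Y U t k) → ℝ≥0∞,
        Measurable F → ∫⁻ ω, F (M.info g t k ω, M.extState g t k ω) ∂P =
          ∫⁻ i, M.integralExt t k (fun e => M.jointPDF (fun j => g j.1) t i e * F (i, e)) ∂μ := by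
  have := M.sigmaFinite_νX t ht
  let base : ∀ p : ℕ × Fin K, Y p.1 p.2 := fun _ => Classical.arbitrary _
  let V := obsPast K t \ hiddenIndex n t k
  let I : (∀ s j, Y s j) → Shared n Y U t × Private n Y U t k := fun y =>
    infoOf y (M.actOf g y) t k
  have hI : Measurable I := M.measurable_infoOf_actOf hg ht
  have hO : Measurable fun y => (othersOf y (M.actOf g y) t k : PrivateOthers n Y U t k) :=
    M.measurable_othersOf_actOf hg ht
  have hIV : Measurable fun w : ∀ p : V, Y p.1.1 p.1.2 =>
      I (pathOf (Function.updateFinset base V w)) :=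
    hI.comp (measurable_pathOf.comp measurable_updateFinset)
  -- The measure is the image of the visible reference measure under the information map. Freezing
  -- the hidden observations at `base` is harmless, since the information does not depend on them.
  refine ⟨(Measure.pi fun p : V => M.refObs p.1).map fun w =>
    I (pathOf (Function.updateFinset base V w)), fun F hF => ?_⟩
  have hsupp : ConsistentSupport (fun j : {j : Fin K // j ≠ k} => g j.1) t
      fun i e => M.jointPDF (fun j => g j.1) t i e * F (i, e) := fun x y u h =>
    M.consistentSupport_jointPDF t x y u (left_ne_zero_of_mul h)
  have hjm : Measurable (Function.uncurry fun i e =>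
      M.jointPDF (fun j : {j : Fin K // j ≠ k} => g j.1) t i e * F (i, e)) :=
    (M.measurable_jointPDF (fun j => hg j.1) ht).mul hF
  rw [lintegral_map (hsupp.measurable_integralExt M (fun j => hg j.1) ht hjm) hIV]
  have hF' : Measurable fun p : X t × (∀ s j, Y s j) =>
      F (I p.2, (p.1, othersOf p.2 (M.actOf g p.2) t k)) :=
    hF.comp ((hI.comp measurable_snd).prodMk (measurable_fst.prodMk (hO.comp measurable_snd)))
  simp only [info_eq, extState_eq]
  refine (M.lintegral_state_obsPath hg k ht hF').trans ?_
  have hpath : Measurable fun q : X t × (∀ p : ℕ × Fin K, Y p.1 p.2) =>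
      (q.1, pathOf q.2) := measurable_fst.prodMk (measurable_pathOf.comp measurable_snd)
  have hq : Measurable fun q : X t × (∀ p : ℕ × Fin K, Y p.1 p.2) =>
      M.pathPDF g k t q.1 (pathOf q.2) *
        F (I (pathOf q.2), (q.1, othersOf (pathOf q.2) (M.actOf g (pathOf q.2)) t k)) :=
    Measurable.mul ((M.measurable_pathPDF hg ht).comp hpath) (hF'.comp hpath)
  have hq' : Measurable fun z : ∀ p : ℕ × Fin K, Y p.1 p.2 => ∫⁻ x, M.pathPDF g k t x (pathOf z) *
      F (I (pathOf z), (x, othersOf (pathOf z) (M.actOf g (pathOf z)) t k)) ∂M.νX t :=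
    (hq.comp measurable_swap).lintegral_prod_right'
  refine (lintegral_lmarginal_swap M.refObs (obsPast K t) (ν := M.νX t) (f := fun x z =>
    M.pathPDF g k t x (pathOf z) *
      F (I (pathOf z), (x, othersOf (pathOf z) (M.actOf g (pathOf z)) t k))) hq _).trans ?_
  rw [obsPast_eq_union n t k, lmarginal_union _ _ hq' Finset.sdiff_disjoint]
  refine lintegral_congr fun w => ?_
  refine (lintegral_lmarginal_swap M.refObs (hiddenIndex n t k) (ν := M.νX t) (f := fun x z =>
    M.pathPDF g k t x (pathOf z) *
      F (I (pathOf z), (x, othersOf (pathOf z) (M.actOf g (pathOf z)) t k))) hq _).symm.trans ?_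
  -- Both sides are now integrals over the state and the hidden observations, along the same
  -- closed-loop paths.
  rw [M.integralExt_infoOf hsupp]
  refine lintegral_congr fun x => ?_
  refine (M.lintegral_setHidden ht k (f := fun y => M.pathPDF g k t x y *
      F (I y, (x, othersOf y (M.actOf g y) t k)))
    (Measurable.mul ((M.measurable_pathPDF hg ht).comp (measurable_const.prodMk measurable_id))
      (hF'.comp (measurable_const.prodMk measurable_id))) _).symm.trans ?_
  refine lintegral_congr fun h => ?_
  rw [pathPDF]

end TeamModel

namespace TeamModel

variable {T n K : ℕ} {Ω : Type uΩ} [MeasurableSpace Ω] {P : Measure Ω}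
  {X : ℕ → Type uX} {Y : ℕ → Fin K → Type uY} {U : ℕ → Fin K → Type uX}
  {W : ℕ → Type uW} {Z : ℕ → Fin K → Type uZ}
  [∀ t, MeasurableSpace (X t)] [∀ t j, MeasurableSpace (Y t j)]
  [∀ t j, MeasurableSpace (U t j)] [∀ t, MeasurableSpace (W t)]
  [∀ t j, MeasurableSpace (Z t j)]
  (M : TeamModel T n K P X Y U W Z)
  [∀ t j, Nonempty (Y t j)] [∀ t j, Nonempty (U t j)] {g : ∀ j, Strategy n Y U j} {k : Fin K}

/-! ### Measures with a density -/

/-- The measure on the space of extended states with density `F i`. -/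
noncomputable def pdfMeasure {t : ℕ} (gm : ∀ j : {j : Fin K // j ≠ k}, Strategy n Y U j.1)
    (F : Shared n Y U t × Private n Y U t k → X t × PrivateOthers n Y U t k → ℝ≥0∞)
    (i : Shared n Y U t × Private n Y U t k) : Measure (X t × PrivateOthers n Y U t k) :=
  let ψ : X t × HiddenObs n Y t k → X t × PrivateOthers n Y U t k := fun p =>
    (p.1, fun j => (p.2 j, hiddenAct M.one_le_delay t k gm i p.2 j))
  (((M.νX t).prod (M.hiddenMeasure t k)).withDensity fun p => F i (ψ p)).map ψ

/-- Supported densities do define measures: the action sum is replaced by transport along the graph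
of `hiddenAct`, which avoids exchanging uncountable sums with integrals. -/
theorem pdfMeasure_apply {t : ℕ} (ht : t ≤ T)
    {gm : ∀ j : {j : Fin K // j ≠ k}, Strategy n Y U j.1} (hgm : ∀ j, Admissible T (gm j))
    {F : Shared n Y U t × Private n Y U t k → X t × PrivateOthers n Y U t k → ℝ≥0∞}
    (hF : ConsistentSupport gm t F) (hFm : Measurable (Function.uncurry F))
    (i : Shared n Y U t × Private n Y U t k) {A : Set (X t × PrivateOthers n Y U t k)}
    (hA : MeasurableSet A) :
    M.pdfMeasure gm F i A = M.integralExt t k (A.indicator (F i)) := by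
  have := M.sigmaFinite_νX t ht
  have := M.sigmaFinite_hiddenMeasure ht k
  have ha : Measurable (hiddenAct M.one_le_delay t k gm i) :=
    (measurable_hiddenAct (hn := M.one_le_delay) ht hgm).comp
      (measurable_const.prodMk measurable_id)
  let ψ : X t × HiddenObs n Y t k → X t × PrivateOthers n Y U t k := fun p =>
    (p.1, fun j => (p.2 j, hiddenAct M.one_le_delay t k gm i p.2 j))
  have hψ : Measurable ψ := by
    have := ha.comp (measurable_snd : Measurable (Prod.snd : X t × HiddenObs n Y t k → _))
    exact measurable_fst.prodMk (measurable_pi_iff.2 fun j =>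
      ((measurable_pi_apply j).comp measurable_snd).prodMk ((measurable_pi_apply j).comp this))
  have hFi : Measurable (F i) := hFm.comp (measurable_const.prodMk measurable_id)
  rw [M.integralExt_eq_of_support (hiddenAct M.one_le_delay t k gm i) fun x y u h =>
    hF.eq_hiddenAct i x y u fun h0 => h (by simp [Set.indicator, h0])]
  change ((((M.νX t).prod (M.hiddenMeasure t k)).withDensity fun p => F i (ψ p)).map ψ) A = _
  rw [Measure.map_apply hψ hA, withDensity_apply _ (hψ hA), ← lintegral_indicator (hψ hA)]
  have h1 : Measurable fun p => A.indicator (F i) (ψ p) := (hFi.indicator hA).comp hψ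
  exact lintegral_prod (fun p => A.indicator (F i) (ψ p)) h1.aemeasurable

theorem measurable_pdfMeasure {t : ℕ} (ht : t ≤ T)
    {gm : ∀ j : {j : Fin K // j ≠ k}, Strategy n Y U j.1} (hgm : ∀ j, Admissible T (gm j))
    {F : Shared n Y U t × Private n Y U t k → X t × PrivateOthers n Y U t k → ℝ≥0∞}
    (hF : ConsistentSupport gm t F) (hFm : Measurable (Function.uncurry F)) :
    Measurable (M.pdfMeasure gm F) := by
  refine Measure.measurable_of_measurable_coe _ fun A hA => ?_
  simp only [M.pdfMeasure_apply ht hgm hF hFm _ hA]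
  refine ConsistentSupport.measurable_integralExt M hgm ht (F := fun i => A.indicator (F i)) ?_ ?_
  · exact fun x y u h => hF x y u fun h0 => h (by simp [Set.indicator, h0])
  · exact hFm.indicator (measurable_snd hA)

/-- Equality fails when the normalizer is 0 or ∞, so for exceptional information the kernel is only
finite, not Markov. Finiteness is enough for the uniqueness of conditional distributions. -/
theorem integralExt_normalize_le_one (t : ℕ) (q : X t × PrivateOthers n Y U t k → ℝ≥0∞) :
    M.integralExt t k (M.normalize t k q) ≤ 1 := by
  by_cases h : M.integralExt t k q = 0
  · have : M.normalize t k q = fun s => 0 * q s := by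
      funext s; simp [normalize, h]
    rw [this, M.integralExt_const_mul ENNReal.zero_ne_top]
    simp
  · have : M.normalize t k q = fun s => (M.integralExt t k q)⁻¹ * q s := by
      funext s; simp [normalize, h, ENNReal.div_eq_inv_mul]
    rw [this, M.integralExt_const_mul (ENNReal.inv_ne_top.2 h)]
    exact ENNReal.inv_mul_le_one _

variable [∀ t j, StandardBorelSpace (U t j)]

/-- The kernel with density `posteriorPDF`. -/
noncomputable def pdfKernel {t : ℕ} (ht : t ≤ T)
    (gm : ∀ j : {j : Fin K // j ≠ k}, Strategy n Y U j.1) (hgm : ∀ j, Admissible T (gm j)) :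
    Kernel (Shared n Y U t × Private n Y U t k) (X t × PrivateOthers n Y U t k) where
  toFun := M.pdfMeasure gm (M.posteriorPDF gm t)
  measurable' := M.measurable_pdfMeasure ht hgm (M.consistentSupport_posteriorPDF t)
    (M.measurable_posteriorPDF hgm ht)

theorem pdfKernel_apply {t : ℕ} (ht : t ≤ T)
    {gm : ∀ j : {j : Fin K // j ≠ k}, Strategy n Y U j.1} (hgm : ∀ j, Admissible T (gm j))
    (i : Shared n Y U t × Private n Y U t k) {A : Set (X t × PrivateOthers n Y U t k)}
    (hA : MeasurableSet A) :
    M.pdfKernel ht gm hgm i A = M.integralExt t k (A.indicator (M.posteriorPDF gm t i)) :=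
  M.pdfMeasure_apply ht hgm (M.consistentSupport_posteriorPDF t)
    (M.measurable_posteriorPDF hgm ht) i hA

instance isFiniteKernel_pdfKernel {t : ℕ} (ht : t ≤ T)
    (gm : ∀ j : {j : Fin K // j ≠ k}, Strategy n Y U j.1) (hgm : ∀ j, Admissible T (gm j)) :
    IsFiniteKernel (M.pdfKernel ht gm hgm) := by
  refine ⟨1, ENNReal.one_lt_top, fun i => ?_⟩
  rw [M.pdfKernel_apply ht hgm i MeasurableSet.univ, Set.indicator_univ]
  cases t <;> exact M.integralExt_normalize_le_one _ _

/-! ### The posterior -/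

variable [IsProbabilityMeasure P]

/-- The information at an earlier time, as a function of the present information. -/
noncomputable def pastInfo {t : ℕ} (i : Shared n Y U t × Private n Y U t k) (s : ℕ) :
    Shared n Y U s × Private n Y U s k :=
  infoOf (pathObs i (Classical.arbitrary _)) (pathAct i (Classical.arbitrary _)) s k

theorem measurable_pastInfo (hn : 1 ≤ n) (t s : ℕ) :
    Measurable fun i : Shared n Y U t × Private n Y U t k => pastInfo i s := by
  have hy : Measurable fun i : Shared n Y U t × Private n Y U t k =>
      pathObs i (Classical.arbitrary _) :=
    (measurable_pathObs t k).comp (measurable_id.prodMk measurable_const)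
  have hu : Measurable fun i : Shared n Y U t × Private n Y U t k =>
      pathAct i (Classical.arbitrary _) :=
    (measurable_pathAct t k).comp (measurable_id.prodMk measurable_const)
  exact measurable_infoOf_comp hn (fun s _ j => by fun_prop) (fun s _ j => by fun_prop)

/-- Perfect recall: a coordinate visible to player `k` at time `s` is still visible at any later
time. -/
theorem pastInfo_info {s t : ℕ} (hs : s ≤ t) (ω : Ω) :
    pastInfo (M.info g t k ω) s = M.info g s k ω :=
  infoOf_congr
    (fun r hr j hj => pathObs_infoOf (fun s j => M.obs g s j ω) (fun s j => M.act g s j ω) _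
      (by omega) (by omega))
    (fun r hr j hj => pathAct_infoOf (fun s j => M.obs g s j ω) (fun s j => M.act g s j ω) _
      (by omega) (by omega)) M.one_le_delay

/-- The law of the information has density `∫ jointPDF`. -/
theorem map_info_eq_withDensity (hg : ∀ j, Admissible T (g j)) {t : ℕ} (ht : t ≤ T)
    {μ : Measure (Shared n Y U t × Private n Y U t k)}
    (hμ : ∀ F : (Shared n Y U t × Private n Y U t k) × (X t × PrivateOthers n Y U t k) → ℝ≥0∞,
        Measurable F → ∫⁻ ω, F (M.info g t k ω, M.extState g t k ω) ∂P =
          ∫⁻ i, M.integralExt t k (fun e => M.jointPDF (fun j => g j.1) t i e * F (i, e)) ∂μ) :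
    P.map (M.info g t k) =
      μ.withDensity fun i => M.integralExt t k (M.jointPDF (fun j => g j.1) t i) := by
  ext B hB
  have h := hμ (fun p => B.indicator (fun _ => 1) p.1)
    ((measurable_const.indicator hB).comp measurable_fst)
  rw [Measure.map_apply (M.measurable_info hg k ht) hB,
    ← lintegral_indicator_one (M.measurable_info hg k ht hB), withDensity_apply _ hB,
    ← lintegral_indicator hB]
  refine Eq.trans ?_ (h.trans ?_)
  · rfl
  · refine lintegral_congr fun i => ?_
    by_cases hi : i ∈ B
    · simp [hi]
    · simp only [hi, not_false_eq_true, Set.indicator_of_notMem, mul_zero]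
      have := M.integralExt_const_mul (t := t) (k := k) (c := 0) (by simp) (fun _ => 0)
      simpa using this

/-- The normalizer is the density of the law of the information. A density is nonzero almost
everywhere for the measure it defines, and it is finite almost everywhere because that measure is
finite. -/
theorem ae_normalizer_ne (hg : ∀ j, Admissible T (g j)) (k : Fin K) {t : ℕ} (ht : t ≤ T) :
    ∀ᵐ ω ∂P, M.integralExt t k (M.jointPDF (fun j => g j.1) t (M.info g t k ω)) ≠ 0 ∧
      M.integralExt t k (M.jointPDF (fun j => g j.1) t (M.info g t k ω)) ≠ ∞ := by
  obtain ⟨μ, hμ⟩ := M.exists_lintegral_info_extState hg k ht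
  have hlaw := M.map_info_eq_withDensity hg ht hμ
  have hZ := M.measurable_integralExt_jointPDF (k := k) (gm := fun j => g j.1) (fun j => hg j.1) ht
  have hI := M.measurable_info hg k ht
  refine ae_of_ae_map hI.aemeasurable (p := fun i =>
    M.integralExt t k (M.jointPDF (fun j => g j.1) t i) ≠ 0 ∧
      M.integralExt t k (M.jointPDF (fun j => g j.1) t i) ≠ ∞) ?_
  rw [hlaw, ae_withDensity_iff hZ]
  have hfin : ∫⁻ i, M.integralExt t k (M.jointPDF (fun j => g j.1) t i) ∂μ ≠ ∞ := by
    have h1 := congrArg (fun m => m Set.univ) hlaw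
    simp only [withDensity_apply _ MeasurableSet.univ, Measure.restrict_univ] at h1
    rw [← h1, Measure.map_apply hI MeasurableSet.univ]
    exact measure_ne_top _ _
  filter_upwards [ae_lt_top hZ hfin] with i hi hi0
  exact ⟨hi0, hi.ne⟩

/-- By perfect recall, all earlier normalizers are functions of the present information, so one null
set of information values excludes every degenerate normalizer. -/
theorem ae_posteriorPDF_eq (hg : ∀ j, Admissible T (g j)) (k : Fin K) {t : ℕ} (ht : t ≤ T) :
    ∀ᵐ i ∂(P.map (M.info g t k)), M.posteriorPDF (fun j => g j.1) t i =
      M.normalize t k (M.jointPDF (fun j => g j.1) t i) := by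
  have hI := M.measurable_info hg k ht
  have hZ : ∀ s ≤ t, Measurable fun i : Shared n Y U t × Private n Y U t k =>
      M.integralExt s k (M.jointPDF (fun j => g j.1) s (pastInfo i s)) := fun s hs =>
    (M.measurable_integralExt_jointPDF (k := k) (gm := fun j => g j.1) (fun j => hg j.1)
      (hs.trans ht)).comp (measurable_pastInfo M.one_le_delay t s)
  have hae : ∀ᵐ i ∂(P.map (M.info g t k)), ∀ s < t,
      M.integralExt s k (M.jointPDF (fun j => g j.1) s (pastInfo i s)) ≠ 0 ∧
      M.integralExt s k (M.jointPDF (fun j => g j.1) s (pastInfo i s)) ≠ ∞ := by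
    rw [ae_all_iff]
    intro s
    by_cases hs : s < t
    · simp only [hs, true_imp_iff]
      rw [ae_map_iff hI.aemeasurable]
      · simp only [M.pastInfo_info hs.le]
        exact M.ae_normalizer_ne hg k (hs.le.trans ht)
      · exact ((hZ s hs.le) (measurableSet_singleton 0)).compl.inter
          ((hZ s hs.le) (measurableSet_singleton ∞)).compl
    · simp [hs]
  filter_upwards [hae] with i hi
  have h := M.posteriorPDF_eq_normalize (gm := fun j => g j.1)
    (pathObs i (Classical.arbitrary _)) (pathAct i (Classical.arbitrary _)) t
    (fun s hs => (hi s hs).1) fun s hs => (hi s hs).2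
  rwa [infoOf_path] at h

/-- Bayes' formula: the joint density is the density of the information times its own normalization.
The reference measure, the only object depending on the strategy of player `k`, drops out. -/
theorem map_info_extState_eq_compProd (hg : ∀ j, Admissible T (g j)) (k : Fin K) {t : ℕ}
    (ht : t ≤ T) :
    P.map (fun ω => (M.info g t k ω, M.extState g t k ω)) =
      P.map (M.info g t k) ⊗ₘ M.pdfKernel ht (fun j => g j.1) (fun j => hg j.1) := by
  obtain ⟨μ, hμ⟩ := M.exists_lintegral_info_extState hg k ht
  have hlaw := M.map_info_eq_withDensity hg ht hμ
  have hZ := M.measurable_integralExt_jointPDF (k := k) (gm := fun j => g j.1) (fun j => hg j.1) ht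
  have hI := M.measurable_info hg k ht
  have hE := M.measurable_extState hg k ht
  have hgood := M.ae_posteriorPDF_eq hg k ht
  rw [hlaw, ae_withDensity_iff hZ] at hgood
  have hfin : ∫⁻ i, M.integralExt t k (M.jointPDF (fun j => g j.1) t i) ∂μ ≠ ∞ := by
    have h1 := congrArg (fun m => m Set.univ) hlaw
    simp only [withDensity_apply _ MeasurableSet.univ, Measure.restrict_univ] at h1
    rw [← h1, Measure.map_apply hI MeasurableSet.univ]
    exact measure_ne_top _ _
  have := Measure.isProbabilityMeasure_map (μ := P) hI.aemeasurable
  ext S hS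
  rw [Measure.compProd_apply hS, hlaw, lintegral_withDensity_eq_lintegral_mul _ hZ
    (Kernel.measurable_kernel_prodMk_left hS), Measure.map_apply (hI.prodMk hE) hS,
    ← lintegral_indicator_one ((hI.prodMk hE) hS)]
  refine (hμ (S.indicator fun _ => 1) (measurable_const.indicator hS)).trans ?_
  refine lintegral_congr_ae ?_
  filter_upwards [hgood, ae_lt_top hZ hfin] with i hi hi'
  have hSi : MeasurableSet (Prod.mk i ⁻¹' S) := measurable_prodMk_left hS
  rw [Pi.mul_apply, pdfKernel_apply _ _ _ _ hSi]
  have hind : (fun e => M.jointPDF (fun j => g j.1) t i e * S.indicator (fun _ => 1) (i, e)) =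
      (Prod.mk i ⁻¹' S).indicator (M.jointPDF (fun j => g j.1) t i) := by
    funext e
    by_cases he : (i, e) ∈ S
    · simp [Set.indicator, he]
    · simp [Set.indicator, he]
  rw [hind]
  -- The comparison of `posteriorPDF` with the normalized joint density is known only where the
  -- normalizer is nonzero; where it vanishes, both integrands are zero.
  by_cases h0 : M.integralExt t k (M.jointPDF (fun j => g j.1) t i) = 0
  · rw [h0, zero_mul]
    refine le_antisymm (le_trans (M.integralExt_mono fun s => ?_) h0.le) bot_le
    exact Set.indicator_le_self _ _ s
  · rw [hi h0]
    have hn : (Prod.mk i ⁻¹' S).indicator (M.normalize t k (M.jointPDF (fun j => g j.1) t i)) =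
        fun s => (M.integralExt t k (M.jointPDF (fun j => g j.1) t i))⁻¹ *
          (Prod.mk i ⁻¹' S).indicator (M.jointPDF (fun j => g j.1) t i) s := by
      funext s
      by_cases hs : s ∈ Prod.mk i ⁻¹' S
      · simp only [Set.indicator_of_mem hs, normalize, h0, if_false, ENNReal.div_eq_inv_mul]
      · simp only [Set.indicator_of_notMem hs, mul_zero]
    rw [hn, M.integralExt_const_mul (ENNReal.inv_ne_top.2 h0), ← mul_assoc,
      ENNReal.mul_inv_cancel h0 hi'.ne, one_mul]

variable [∀ t, StandardBorelSpace (X t)] [∀ t, Nonempty (X t)] [∀ t j, StandardBorelSpace (Y t j)]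

theorem ae_isPDF_posteriorPDF (hg : ∀ j, Admissible T (g j)) (k : Fin K) {t : ℕ} (ht : t ≤ T) :
    ∀ᵐ i ∂(P.map (M.info g t k)),
      M.IsPDF t k (M.posterior g t k i) (M.posteriorPDF (fun j => g j.1) t i) := by
  have h := condDistrib_ae_eq_of_measure_eq_compProd_of_measurable (M.measurable_info hg k ht)
    (M.measurable_extState hg k ht) (M.map_info_extState_eq_compProd hg k ht)
  filter_upwards [h] with i hi
  refine ⟨(M.measurable_posteriorPDF (fun j => hg j.1) ht).comp
    (measurable_const.prodMk measurable_id), fun A hA => ?_⟩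
  rw [posterior, hi, pdfKernel_apply _ _ _ _ hA]

end TeamModel

/-! ### Conditional probabilities -/

/-- Passage from identities between `ℝ≥0∞`-valued integrals to real conditional expectations; the
bound by 1 supplies integrability. -/
theorem condExp_indicator_ae_eq_toReal {Ω : Type*} {m mΩ : MeasurableSpace Ω} {P : Measure Ω}
    [IsProbabilityMeasure P] (hm : m ≤ mΩ) {A : Set Ω} (hA : MeasurableSet A) {q : Ω → ℝ≥0∞}
    (hq : Measurable[m] q) (hq1 : ∀ ω, q ω ≤ 1)
    (h : ∀ C, MeasurableSet[m] C → P (A ∩ C) = ∫⁻ ω in C, q ω ∂P) :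
    P⟦A | m⟧ =ᵐ[P] fun ω => (q ω).toReal := by
  have hq' : Measurable q := hq.mono hm le_rfl
  have hint : Integrable (fun ω => (q ω).toReal) P := by
    refine integrable_toReal_of_lintegral_ne_top hq'.aemeasurable ?_
    refine ne_top_of_le_ne_top ENNReal.one_ne_top ((lintegral_mono hq1).trans ?_)
    simp
  refine (ae_eq_condExp_of_forall_setIntegral_eq hm ((integrable_const 1).indicator hA)
    (fun C _ _ => hint.integrableOn) (fun C hC _ => ?_)
    (hq.ennreal_toReal.stronglyMeasurable.aestronglyMeasurable)).symm
  rw [integral_toReal hq'.aemeasurable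
    (Filter.Eventually.of_forall fun ω => (hq1 ω).trans_lt ENNReal.one_lt_top), ← h C hC,
    setIntegral_indicator hA, setIntegral_const, smul_eq_mul, mul_one, Set.inter_comm]
  rfl

/-! ### Insertion of the newly shared data into a path -/

section Insert

variable {K n : ℕ} {V : ℕ → Fin K → Type*}

/-- Insertion of data of the players other than `k` at the newly shared time. -/
def insertAt {t : ℕ} {k : Fin K} (v : ∀ s j, V s j)
    (c : (s : Finset.Ico (t + 1 - n) (t + 1 + 1 - n)) → (j : {j : Fin K // j ≠ k}) → V s.1 j.1) :
    ∀ s j, V s j := fun s =>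
  if h : t + 1 - n ≤ s ∧ s < t + 1 + 1 - n then join k (v s k) (c ⟨s, Finset.mem_Ico.2 h⟩) else v s

theorem measurable_insertAt [∀ s j, MeasurableSpace (V s j)] (t : ℕ) (k : Fin K) :
    Measurable fun p : (∀ s j, V s j) × ((s : Finset.Ico (t + 1 - n) (t + 1 + 1 - n)) →
      (j : {j : Fin K // j ≠ k}) → V s.1 j.1) => insertAt p.1 p.2 := by
  refine measurable_pi_iff.2 fun s => ?_
  by_cases h : t + 1 - n ≤ s ∧ s < t + 1 + 1 - n
  · simp only [insertAt, h]
    exact (measurable_join k).comp (Measurable.prodMk (by fun_prop) (by fun_prop))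
  · simp only [insertAt, h, dite_false]; fun_prop

theorem insertAt_eq {t : ℕ} {k : Fin K} {v v' : ∀ s j, V s j} {s : ℕ} {j : Fin K}
    (h : (t + 1 - n ≤ s ∧ s < t + 1 + 1 - n) ∧ j ≠ k ∨ v s j = v' s j) :
    insertAt (n := n) (t := t) (k := k) v (fun s j => v' s.1 j.1) s j = v' s j := by
  by_cases hs : t + 1 - n ≤ s ∧ s < t + 1 + 1 - n
  · simp only [insertAt, hs, and_self, dite_true]
    by_cases hj : j = k
    · subst hj
      rw [join_self]
      exact h.resolve_left fun hc => hc.2 rfl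
    · rw [join_of_ne _ _ _ hj]
  · simp only [insertAt, hs, dite_false]
    exact h.resolve_left fun hc => hs hc.1

end Insert

namespace TeamModel

variable {T n K : ℕ} {Ω : Type uΩ} [MeasurableSpace Ω] {P : Measure Ω}
  {X : ℕ → Type uX} {Y : ℕ → Fin K → Type uY} {U : ℕ → Fin K → Type uX}
  {W : ℕ → Type uW} {Z : ℕ → Fin K → Type uZ}
  [∀ t, MeasurableSpace (X t)] [∀ t j, MeasurableSpace (Y t j)]
  [∀ t j, MeasurableSpace (U t j)] [∀ t, MeasurableSpace (W t)]
  [∀ t j, MeasurableSpace (Z t j)]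
  (M : TeamModel T n K P X Y U W Z)
  [∀ t j, Nonempty (Y t j)] [∀ t j, Nonempty (U t j)] {g : ∀ j, Strategy n Y U j} {k : Fin K}

/-! ### The transition of the private posterior -/

theorem measurable_update_act (t : ℕ) :
    Measurable fun p : (∀ s j, U s j) × (∀ j, U t j) => Function.update p.1 t p.2 := by
  refine measurable_pi_iff.2 fun s => ?_
  by_cases hs : s = t
  · subst hs; simpa using measurable_snd
  · simp only [Function.update_of_ne hs]; fun_prop

/-- The newly observed data of player `k` at time `t + 1`. -/
abbrev NewData (n : ℕ) (Y : ℕ → Fin K → Type uY) (U : ℕ → Fin K → Type uX) (t : ℕ) (k : Fin K) :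
    Type (max uX uY) :=
  Y (t + 1) k × Newly n Y U t k

/-- Actions up to time `t`, from the common information, the extended state and the action of
player `k`. -/
noncomputable def nextAct {t : ℕ} (gm : ∀ j : {j : Fin K // j ≠ k}, Strategy n Y U j.1)
    (d : Shared n Y U t) (uk : U t k) (l : PrivateOthers n Y U t k) : ∀ s j, U s j :=
  -- The private data of player `k` may be arbitrary here: what `nextPair` uses of this path is the
  -- hidden data of the others and the actions at time `t`.
  Function.update (pathAct (d, Classical.arbitrary _) l) t (join k uk fun j => gm j t d (l j))

/-- The next state. -/
noncomputable def nextState {t : ℕ} (gm : ∀ j : {j : Fin K // j ≠ k}, Strategy n Y U j.1)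
    (d : Shared n Y U t) (uk : U t k) (e : X t × PrivateOthers n Y U t k) (w : W t) : X (t + 1) :=
  M.f t e.1 (nextAct gm d uk e.2 t) w

/-- Observations up to time `t + 1`. -/
noncomputable def nextObs {t : ℕ} (gm : ∀ j : {j : Fin K // j ≠ k}, Strategy n Y U j.1)
    (d : Shared n Y U t) (uk : U t k) (e : X t × PrivateOthers n Y U t k) (w : W t)
    (z : ∀ j, Z (t + 1) j) : ∀ s j, Y s j :=
  Function.update (pathObs (d, Classical.arbitrary _) e.2) (t + 1)
    fun j => M.h (t + 1) j (M.nextState gm d uk e w) (z j)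

/-- The new data of player `k` and the next extended state. -/
noncomputable def nextPair {t : ℕ} (gm : ∀ j : {j : Fin K // j ≠ k}, Strategy n Y U j.1)
    (d : Shared n Y U t) (uk : U t k) (e : X t × PrivateOthers n Y U t k) (w : W t)
    (z : ∀ j, Z (t + 1) j) :
    NewData n Y U t k × (X (t + 1) × PrivateOthers n Y U (t + 1) k) :=
  ((M.nextObs gm d uk e w z (t + 1) k, newlyOf (M.nextObs gm d uk e w z) (nextAct gm d uk e.2) t k),
    (M.nextState gm d uk e w, othersOf (M.nextObs gm d uk e w z) (nextAct gm d uk e.2) (t + 1) k))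

/-- The new data of player `k` at time `t + 1`. -/
def newData (g : ∀ j, Strategy n Y U j) (t : ℕ) (k : Fin K) (ω : Ω) : NewData n Y U t k :=
  (M.obs g (t + 1) k ω, newlyOf (fun s j => M.obs g s j ω) (fun s j => M.act g s j ω) t k)

/-- This is why (Ξ_t, Δ_t, U_t^k) suffices. The newly shared data of the others are part of
Λ_t^{-k}, except for U_t^{-k} when `n = 1`, and that is generated by `gm` from Δ_t and Λ_t^{-k}. The
private data of player `k` matter only through his action. -/
theorem nextPair_eq {gm : ∀ j : {j : Fin K // j ≠ k}, Strategy n Y U j.1}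
    (hgg : ∀ j : {j : Fin K // j ≠ k}, g j.1 = gm j) (t : ℕ) (ω : Ω) :
    M.nextPair gm (M.shared g t ω) (M.act g t k ω) (M.extState g t k ω) (M.w t ω)
      (fun j => M.z (t + 1) j ω) = (M.newData g t k ω, M.extState g (t + 1) k ω) := by
  have hn := M.one_le_delay
  have hjoin : (join k (M.act g t k ω) fun j =>
      gm j t (M.shared g t ω) ((M.extState g t k ω).2 j)) = fun j => M.act g t j ω := by
    refine Eq.trans ?_ (join_eta k fun j => M.act g t j ω)
    congr 1
    funext j
    rw [M.act_eq g t j.1 ω, hgg j]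
    rfl
  have hu : ∀ s, t + 1 - n ≤ s → s < t + 1 → ∀ j ≠ k,
      nextAct gm (M.shared g t ω) (M.act g t k ω) (M.extState g t k ω).2 s j = M.act g s j ω := by
    intro s hs hst j hj
    rcases Nat.lt_succ_iff_lt_or_eq.1 hst with hlt | rfl
    · rw [nextAct, Function.update_of_ne hlt.ne]
      exact pathAct_othersOf (fun s j => M.obs g s j ω) (fun s j => M.act g s j ω) _ hlt hs hj
    · rw [nextAct, Function.update_self, hjoin]
  have hx : M.nextState gm (M.shared g t ω) (M.act g t k ω) (M.extState g t k ω) (M.w t ω) =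
      M.state g (t + 1) ω := by
    rw [nextState, nextAct, Function.update_self, hjoin, state_succ]
    rfl
  have hy1 : ∀ j, M.nextObs gm (M.shared g t ω) (M.act g t k ω) (M.extState g t k ω) (M.w t ω)
      (fun j => M.z (t + 1) j ω) (t + 1) j = M.obs g (t + 1) j ω := by
    intro j
    rw [nextObs, Function.update_self, hx]
    rfl
  have hy : ∀ s, t + 1 - n ≤ s → s < t + 1 + 1 → ∀ j ≠ k,
      M.nextObs gm (M.shared g t ω) (M.act g t k ω) (M.extState g t k ω) (M.w t ω)
      (fun j => M.z (t + 1) j ω) s j = M.obs g s j ω := by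
    intro s hs hst j hj
    rcases Nat.lt_succ_iff_lt_or_eq.1 hst with hlt | rfl
    · rw [nextObs, Function.update_of_ne hlt.ne]
      exact pathObs_othersOf (fun s j => M.obs g s j ω) (fun s j => M.act g s j ω) _ hlt hs hj
    · exact hy1 j
  refine Prod.ext (Prod.ext (hy1 k) ?_) (Prod.ext hx ?_)
  · exact newlyOf_congr (fun s hs hs' => hy s hs (by omega)) (fun s hs hs' => hu s hs (by omega))
  · exact othersOf_congr (fun s hs hs' => hy s (by omega) hs') (fun s hs hs' => hu s (by omega) hs')

theorem measurable_nextPair {t : ℕ} (ht : t < T)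
    {gm : ∀ j : {j : Fin K // j ≠ k}, Strategy n Y U j.1} (hgm : ∀ j, Admissible T (gm j)) :
    Measurable fun p : (Shared n Y U t × U t k) × ((X t × PrivateOthers n Y U t k) ×
      (W t × (∀ j, Z (t + 1) j))) => M.nextPair gm p.1.1 p.1.2 p.2.1 p.2.2.1 p.2.2.2 := by
  have hl : Measurable fun p : (Shared n Y U t × U t k) × ((X t × PrivateOthers n Y U t k) ×
      (W t × (∀ j, Z (t + 1) j))) =>
      (((p.1.1, Classical.arbitrary _), p.2.1.2) :
        (Shared n Y U t × Private n Y U t k) × PrivateOthers n Y U t k) := by fun_prop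
  have hjoin : Measurable fun p : (Shared n Y U t × U t k) × ((X t × PrivateOthers n Y U t k) ×
      (W t × (∀ j, Z (t + 1) j))) => join k p.1.2 fun j => gm j t p.1.1 (p.2.1.2 j) := by
    refine (measurable_join k).comp (Measurable.prodMk (by fun_prop) (measurable_pi_iff.2 fun j => ?_))
    exact (hgm j t ht).comp (by fun_prop : Measurable fun p : (Shared n Y U t × U t k) ×
      ((X t × PrivateOthers n Y U t k) × (W t × (∀ j, Z (t + 1) j))) => (p.1.1, p.2.1.2 j))
  have hu : Measurable fun p : (Shared n Y U t × U t k) × ((X t × PrivateOthers n Y U t k) ×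
      (W t × (∀ j, Z (t + 1) j))) => nextAct gm p.1.1 p.1.2 p.2.1.2 :=
    (measurable_update_act t).comp (((measurable_pathAct t k).comp hl).prodMk hjoin)
  have hx : Measurable fun p : (Shared n Y U t × U t k) × ((X t × PrivateOthers n Y U t k) ×
      (W t × (∀ j, Z (t + 1) j))) => M.nextState gm p.1.1 p.1.2 p.2.1 p.2.2.1 :=
    (M.measurable_f t ht).comp (Measurable.prodMk (by fun_prop)
      (Measurable.prodMk ((measurable_pi_apply t).comp hu) (by fun_prop)))
  have hy : Measurable fun p : (Shared n Y U t × U t k) × ((X t × PrivateOthers n Y U t k) ×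
      (W t × (∀ j, Z (t + 1) j))) => M.nextObs gm p.1.1 p.1.2 p.2.1 p.2.2.1 p.2.2.2 :=
    (measurable_update_path (t + 1)).comp (((measurable_pathObs t k).comp hl).prodMk
      (measurable_pi_iff.2 fun j => (M.measurable_h (t + 1) ht j).comp
        (hx.prodMk (by fun_prop))))
  have hy' : ∀ s j, Measurable fun p : (Shared n Y U t × U t k) × ((X t × PrivateOthers n Y U t k) ×
      (W t × (∀ j, Z (t + 1) j))) => M.nextObs gm p.1.1 p.1.2 p.2.1 p.2.2.1 p.2.2.2 s j :=
    fun s j => (measurable_pi_apply j).comp ((measurable_pi_apply s).comp hy)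
  have hu' : ∀ s j, Measurable fun p : (Shared n Y U t × U t k) × ((X t × PrivateOthers n Y U t k) ×
      (W t × (∀ j, Z (t + 1) j))) => nextAct gm p.1.1 p.1.2 p.2.1.2 s j :=
    fun s j => (measurable_pi_apply j).comp ((measurable_pi_apply s).comp hu)
  exact ((hy' (t + 1) k).prodMk ((measurable_newlyOf t k).comp (hy.prodMk hu))).prodMk
    (hx.prodMk (measurable_othersOf_comp (fun s _ j => hy' s j) fun s _ j => hu' s j))

/-! ### The noise entering in one step -/

variable [IsProbabilityMeasure P]

/-- The law of the noise entering between the times `t` and `t + 1`. -/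
noncomputable def noiseLaw (t : ℕ) : Measure (W t × (∀ j, Z (t + 1) j)) :=
  (P.map (M.w t)).prod (P.map fun ω j => M.z (t + 1) j ω)

theorem isProbabilityMeasure_noiseLaw {t : ℕ} (ht : t < T) : IsProbabilityMeasure (M.noiseLaw t) := by
  have := Measure.isProbabilityMeasure_map (μ := P) (M.measurable_w t ht).aemeasurable
  have := Measure.isProbabilityMeasure_map (μ := P) (M.measurable_zTuple (Nat.succ_le_of_lt ht)).aemeasurable
  unfold noiseLaw
  infer_instance

/-- Z_{t+1} is averaged out first, being independent of W_t together with the past; then W_t is. -/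
theorem lintegral_noise {t : ℕ} (ht : t < T) {ρ : Type*} [MeasurableSpace ρ] {R : Ω → ρ}
    (hR : Measurable[M.past t (t + 1)] R) {G : ρ × (W t × (∀ j, Z (t + 1) j)) → ℝ≥0∞}
    (hG : Measurable G) :
    ∫⁻ ω, G (R ω, (M.w t ω, fun j => M.z (t + 1) j ω)) ∂P =
      ∫⁻ ω, ∫⁻ v, G (R ω, v) ∂M.noiseLaw t ∂P := by
  have := Measure.isProbabilityMeasure_map (μ := P) (M.measurable_zTuple (Nat.succ_le_of_lt ht)).aemeasurable
  have hG' : Measurable fun p : (ρ × W t) × (∀ j, Z (t + 1) j) => G (p.1.1, (p.1.2, p.2)) :=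
    hG.comp (by fun_prop)
  have h1 := lintegral_of_indep (M.past_le (t + 1) (t + 1)) (R := fun ω => (R ω, M.w t ω))
    ((hR.mono (M.past_mono (by omega) le_rfl) le_rfl).prodMk
      (M.measurable_w_past ht (Nat.lt_succ_self t)))
    (M.measurable_zTuple (Nat.succ_le_of_lt ht)) (M.indep_past_z (Nat.succ_le_of_lt ht) (t + 1)) hG'
  have h2 := lintegral_of_indep (M.past_le t (t + 1)) hR (M.measurable_w t ht)
    (M.indep_past_w ht (t + 1))
    (Measurable.lintegral_prod_right' (ν := P.map fun ω j => M.z (t + 1) j ω) hG')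
  refine h1.trans (h2.trans (lintegral_congr fun ω => ?_))
  exact (lintegral_prod (fun v => G (R ω, v))
    (hG.comp (measurable_const.prodMk measurable_id)).aemeasurable).symm

end TeamModel

namespace TeamModel

variable {T n K : ℕ} {Ω : Type uΩ} [MeasurableSpace Ω] {P : Measure Ω}
  {X : ℕ → Type uX} {Y : ℕ → Fin K → Type uY} {U : ℕ → Fin K → Type uX}
  {W : ℕ → Type uW} {Z : ℕ → Fin K → Type uZ}
  [∀ t, MeasurableSpace (X t)] [∀ t j, MeasurableSpace (Y t j)]
  [∀ t j, MeasurableSpace (U t j)] [∀ t, MeasurableSpace (W t)]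
  [∀ t j, MeasurableSpace (Z t j)]
  (M : TeamModel T n K P X Y U W Z)
  [∀ t j, Nonempty (Y t j)] [∀ t j, Nonempty (U t j)] {g : ∀ j, Strategy n Y U j} {k : Fin K}

/-! ### The one-step law and its disintegration -/

variable [IsProbabilityMeasure P]
  [∀ t, StandardBorelSpace (X t)] [∀ t, Nonempty (X t)]
  [∀ t j, StandardBorelSpace (Y t j)] [∀ t j, StandardBorelSpace (U t j)]

/-- Probability measures, with an arbitrary value at the other measures. -/
noncomputable def priorKernel (n : ℕ) (X : ℕ → Type uX) (Y : ℕ → Fin K → Type uY)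
    (U : ℕ → Fin K → Type uX)
    [∀ t, MeasurableSpace (X t)] [∀ t j, MeasurableSpace (Y t j)] [∀ t j, MeasurableSpace (U t j)]
    [∀ t, Nonempty (X t)] [∀ t j, Nonempty (Y t j)] [∀ t j, Nonempty (U t j)] (t : ℕ) (k : Fin K) :
    Kernel (Measure (X t × PrivateOthers n Y U t k) × Shared n Y U t × U t k)
      (X t × PrivateOthers n Y U t k) where
  -- The transition kernel must be Markov on the space of all measures. Posteriors are probability
  -- measures, so the default value is never met along the process.
  toFun a := open Classical in if a.1 Set.univ = 1 then a.1 else Measure.dirac (Classical.arbitrary _)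
  measurable' := Measurable.ite
    (((Measure.measurable_coe MeasurableSet.univ).comp measurable_fst) (measurableSet_singleton 1))
    measurable_fst measurable_const

theorem priorKernel_apply {t : ℕ}
    (a : Measure (X t × PrivateOthers n Y U t k) × Shared n Y U t × U t k)
    [h : IsProbabilityMeasure a.1] : priorKernel n X Y U t k a = a.1 :=
  if_pos h.measure_univ

instance isMarkovKernel_priorKernel (t : ℕ) : IsMarkovKernel (priorKernel n X Y U t k) := by
  refine ⟨fun a => ?_⟩
  change IsProbabilityMeasure (if a.1 Set.univ = 1 then a.1 else Measure.dirac (Classical.arbitrary _))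
  split_ifs with h
  · exact ⟨h⟩
  · infer_instance

/-- The law of the new data and of the next extended state, given the posterior, the common
information and the action of player `k`. -/
noncomputable def jointKernel (t : ℕ) (gm : ∀ j : {j : Fin K // j ≠ k}, Strategy n Y U j.1) :
    Kernel (Measure (X t × PrivateOthers n Y U t k) × Shared n Y U t × U t k)
      (NewData n Y U t k × (X (t + 1) × PrivateOthers n Y U (t + 1) k)) :=
  (Kernel.id ×ₖ (priorKernel n X Y U t k ×ₖ Kernel.const _ (M.noiseLaw t))).map
    fun p => M.nextPair gm p.1.2.1 p.1.2.2 p.2.1 p.2.2.1 p.2.2.2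

theorem measurable_nextPair' {t : ℕ} (ht : t < T)
    {gm : ∀ j : {j : Fin K // j ≠ k}, Strategy n Y U j.1} (hgm : ∀ j, Admissible T (gm j)) :
    Measurable fun p : (Measure (X t × PrivateOthers n Y U t k) × Shared n Y U t × U t k) ×
      ((X t × PrivateOthers n Y U t k) × (W t × (∀ j, Z (t + 1) j))) =>
        M.nextPair gm p.1.2.1 p.1.2.2 p.2.1 p.2.2.1 p.2.2.2 :=
  (M.measurable_nextPair ht hgm).comp ((measurable_snd.comp measurable_fst).prodMk measurable_snd)

theorem isMarkovKernel_jointKernel {t : ℕ} (ht : t < T)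
    {gm : ∀ j : {j : Fin K // j ≠ k}, Strategy n Y U j.1} (hgm : ∀ j, Admissible T (gm j)) :
    IsMarkovKernel (M.jointKernel t gm) := by
  have := M.isProbabilityMeasure_noiseLaw ht
  exact Kernel.IsMarkovKernel.map _ (M.measurable_nextPair' ht hgm)

theorem lintegral_jointKernel {t : ℕ} (ht : t < T)
    {gm : ∀ j : {j : Fin K // j ≠ k}, Strategy n Y U j.1} (hgm : ∀ j, Admissible T (gm j))
    (a : Measure (X t × PrivateOthers n Y U t k) × Shared n Y U t × U t k)
    [IsProbabilityMeasure a.1]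
    {G : NewData n Y U t k × (X (t + 1) × PrivateOthers n Y U (t + 1) k) → ℝ≥0∞}
    (hG : Measurable G) :
    ∫⁻ p, G p ∂M.jointKernel t gm a =
      ∫⁻ e, ∫⁻ v, G (M.nextPair gm a.2.1 a.2.2 e v.1 v.2) ∂M.noiseLaw t ∂a.1 := by
  have := M.isProbabilityMeasure_noiseLaw ht
  have hm := hG.fun_comp (M.measurable_nextPair' ht hgm)
  rw [jointKernel, Kernel.lintegral_map _ (M.measurable_nextPair' ht hgm) _ hG,
    Kernel.lintegral_id_prod hm]
  have hm' : Measurable fun c : (X t × PrivateOthers n Y U t k) × (W t × (∀ j, Z (t + 1) j)) =>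
      G (M.nextPair gm a.2.1 a.2.2 c.1 c.2.1 c.2.2) :=
    hm.comp (measurable_const.prodMk measurable_id)
  refine (Kernel.lintegral_prod _ _ _ hm').trans ?_
  rw [Kernel.const_apply, priorKernel_apply]

/-- The conditional law of the next extended state given the new data. -/
noncomputable def bayesKernel {t : ℕ} (ht : t < T)
    (gm : ∀ j : {j : Fin K // j ≠ k}, Strategy n Y U j.1) (hgm : ∀ j, Admissible T (gm j)) :
    Kernel ((Measure (X t × PrivateOthers n Y U t k) × Shared n Y U t × U t k) × NewData n Y U t k)
      (X (t + 1) × PrivateOthers n Y U (t + 1) k) :=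
  have := M.isMarkovKernel_jointKernel ht hgm
  (M.jointKernel t gm).condKernel

instance isMarkovKernel_bayesKernel {t : ℕ} (ht : t < T)
    (gm : ∀ j : {j : Fin K // j ≠ k}, Strategy n Y U j.1) (hgm : ∀ j, Admissible T (gm j)) :
    IsMarkovKernel (M.bayesKernel ht gm hgm) := by
  have := M.isMarkovKernel_jointKernel ht hgm
  unfold bayesKernel
  infer_instance

/-- Disintegration of the joint law over the new data. The conditional kernel is measurable jointly
in the prior measure and the data, as a kernel acting on random posteriors must be. -/
theorem lintegral_jointKernel_eq_bayesKernel {t : ℕ} (ht : t < T)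
    {gm : ∀ j : {j : Fin K // j ≠ k}, Strategy n Y U j.1} (hgm : ∀ j, Admissible T (gm j))
    (a : Measure (X t × PrivateOthers n Y U t k) × Shared n Y U t × U t k)
    {G : NewData n Y U t k × (X (t + 1) × PrivateOthers n Y U (t + 1) k) → ℝ≥0∞}
    (hG : Measurable G) :
    ∫⁻ p, G p ∂M.jointKernel t gm a =
      ∫⁻ p, ∫⁻ e, G (p.1, e) ∂M.bayesKernel ht gm hgm (a, p.1) ∂M.jointKernel t gm a := by
  have := M.isMarkovKernel_jointKernel ht hgm
  have hm : Measurable fun b => ∫⁻ e, G (b, e) ∂M.bayesKernel ht gm hgm (a, b) := by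
    have h1 : Measurable fun p : NewData n Y U t k => (a, p) := measurable_const.prodMk measurable_id
    exact Measurable.lintegral_kernel_prod_right'
      (κ := (M.bayesKernel ht gm hgm).comap (fun b => (a, b)) h1) hG
  have h := (M.jointKernel t gm).disintegrate (M.jointKernel t gm).condKernel
  conv_lhs => rw [← h]
  rw [Kernel.lintegral_compProd _ _ _ hG, Kernel.fst_apply]
  exact lintegral_map hm measurable_fst

/-- The transition kernel of the private posterior. -/
noncomputable def posteriorKernel {t : ℕ} (ht : t < T)
    (gm : ∀ j : {j : Fin K // j ≠ k}, Strategy n Y U j.1) (hgm : ∀ j, Admissible T (gm j)) :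
    Kernel (Measure (X t × PrivateOthers n Y U t k) × Shared n Y U t × U t k)
      (Measure (X (t + 1) × PrivateOthers n Y U (t + 1) k)) :=
  (Kernel.id ×ₖ (M.jointKernel t gm).fst).map (M.bayesKernel ht gm hgm)

theorem isMarkovKernel_posteriorKernel {t : ℕ} (ht : t < T)
    (gm : ∀ j : {j : Fin K // j ≠ k}, Strategy n Y U j.1) (hgm : ∀ j, Admissible T (gm j)) :
    IsMarkovKernel (M.posteriorKernel ht gm hgm) := by
  have := M.isMarkovKernel_jointKernel ht hgm
  exact Kernel.IsMarkovKernel.map _ (M.bayesKernel ht gm hgm).measurable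

theorem posteriorKernel_apply {t : ℕ} (ht : t < T)
    {gm : ∀ j : {j : Fin K // j ≠ k}, Strategy n Y U j.1} (hgm : ∀ j, Admissible T (gm j))
    (a : Measure (X t × PrivateOthers n Y U t k) × Shared n Y U t × U t k)
    {B : Set (Measure (X (t + 1) × PrivateOthers n Y U (t + 1) k))} (hB : MeasurableSet B) :
    M.posteriorKernel ht gm hgm a B =
      M.jointKernel t gm a {p | M.bayesKernel ht gm hgm (a, p.1) ∈ B} := by
  have := M.isMarkovKernel_jointKernel ht hgm
  have hR := (M.bayesKernel ht gm hgm).measurable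
  have hS : MeasurableSet {b | M.bayesKernel ht gm hgm (a, b) ∈ B} :=
    (hR.comp (measurable_const.prodMk measurable_id)) hB
  rw [posteriorKernel, Kernel.map_apply' _ hR _ hB, Kernel.prod_apply, Kernel.id_apply,
    Measure.dirac_prod, Measure.map_apply measurable_prodMk_left (hR hB)]
  exact Kernel.fst_apply' _ _ hS

variable {gm : ∀ j : {j : Fin K // j ≠ k}, Strategy n Y U j.1}

instance isMarkovKernel_posterior (t : ℕ) : IsMarkovKernel (M.posterior g t k) := by
  unfold posterior; infer_instance

/-- `markovState` as a function of the information. -/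
noncomputable def markovOf (g : ∀ j, Strategy n Y U j) (t : ℕ) (k : Fin K)
    (i : Shared n Y U t × Private n Y U t k) :
    Measure (X t × PrivateOthers n Y U t k) × Shared n Y U t × U t k :=
  (M.posterior g t k i, i.1, g k t i.1 i.2)

theorem markovState_eq (t : ℕ) (ω : Ω) :
    M.markovState g t k ω = M.markovOf g t k (M.info g t k ω) := by
  rw [markovState, act_eq]
  rfl

theorem measurable_markovOf (hg : ∀ j, Admissible T (g j)) {t : ℕ} (ht : t < T) :
    Measurable (M.markovOf g t k) :=
  (M.posterior g t k).measurable.prodMk (measurable_fst.prodMk (hg k t ht))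

theorem measurable_info_past (hg : ∀ j, Admissible T (g j)) {t : ℕ} (ht : t < T) :
    Measurable[M.past t (t + 1)] fun ω => (M.info g t k ω, M.extState g t k ω) := by
  simp only [info_eq, extState_eq]
  have h := M.measurable_obsPath_past hg ht.le le_rfl (Nat.lt_succ_self t)
  exact ((M.measurable_infoOf_actOf hg ht.le).comp h).prodMk
    ((M.measurable_state_past hg ht.le le_rfl (by omega)).prodMk
      ((M.measurable_othersOf_actOf hg ht.le).comp h))

/-- Given the information, the extended state has the posterior law and the noise is independent of
both. By `nextPair_eq` the new data and the next extended state are functions of these, so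
`jointKernel` is their conditional law. -/
theorem lintegral_info_newData (hg : ∀ j, Admissible T (g j)) (hgm : ∀ j, Admissible T (gm j))
    (hgg : ∀ j : {j : Fin K // j ≠ k}, g j.1 = gm j) {t : ℕ} (ht : t < T)
    {G : (Shared n Y U t × Private n Y U t k) ×
      (NewData n Y U t k × (X (t + 1) × PrivateOthers n Y U (t + 1) k)) → ℝ≥0∞}
    (hG : Measurable G) :
    ∫⁻ ω, G (M.info g t k ω, (M.newData g t k ω, M.extState g (t + 1) k ω)) ∂P =
      ∫⁻ ω, ∫⁻ p, G (M.info g t k ω, p) ∂M.jointKernel t gm (M.markovState g t k ω) ∂P := by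
  have := M.isProbabilityMeasure_noiseLaw ht
  have hI := M.measurable_info hg k ht.le
  have hE := M.measurable_extState hg k ht.le
  let H : ((Shared n Y U t × Private n Y U t k) × (X t × PrivateOthers n Y U t k)) ×
      (W t × (∀ j, Z (t + 1) j)) → ℝ≥0∞ := fun p =>
    G (p.1.1, M.nextPair gm p.1.1.1 (g k t p.1.1.1 p.1.1.2) p.1.2 p.2.1 p.2.2)
  have hH : Measurable H := by
    have hφ : Measurable fun p : ((Shared n Y U t × Private n Y U t k) ×
        (X t × PrivateOthers n Y U t k)) × (W t × (∀ j, Z (t + 1) j)) =>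
          ((p.1.1.1, g k t p.1.1.1 p.1.1.2), (p.1.2, p.2)) :=
      Measurable.prodMk ((measurable_fst.comp (measurable_fst.comp measurable_fst)).prodMk
        ((hg k t ht).comp (measurable_fst.comp measurable_fst)))
        ((measurable_snd.comp measurable_fst).prodMk measurable_snd)
    exact hG.comp ((measurable_fst.comp measurable_fst).prodMk
      ((M.measurable_nextPair ht hgm).comp hφ))
  have h1 := M.lintegral_noise ht (M.measurable_info_past (k := k) hg ht) hH
  have h2 := compProd_map_condDistrib (mβ := inferInstance) (μ := P) (X := M.info g t k) (Y := M.extState g t k)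
    hE.aemeasurable
  have hHi := Measurable.lintegral_prod_right' (ν := M.noiseLaw t) hH
  calc _ = ∫⁻ ω, H ((M.info g t k ω, M.extState g t k ω),
          (M.w t ω, fun j => M.z (t + 1) j ω)) ∂P := by
        refine lintegral_congr fun ω => ?_
        rw [← M.nextPair_eq hgg t ω, act_eq]
        rfl
    _ = ∫⁻ q, ∫⁻ v, H (q, v) ∂M.noiseLaw t
          ∂(P.map fun ω => (M.info g t k ω, M.extState g t k ω)) :=
        h1.trans (lintegral_map hHi (hI.prodMk hE)).symm
    _ = ∫⁻ i, ∫⁻ e, ∫⁻ v, H ((i, e), v) ∂M.noiseLaw t ∂M.posterior g t k i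
          ∂(P.map (M.info g t k)) := by
        rw [← h2, Measure.lintegral_compProd hHi]
        rfl
    _ = ∫⁻ ω, ∫⁻ e, ∫⁻ v, H ((M.info g t k ω, e), v) ∂M.noiseLaw t
          ∂M.posterior g t k (M.info g t k ω) ∂P := by
        refine lintegral_map ?_ hI
        exact Measurable.lintegral_kernel_prod_right' (κ := M.posterior g t k) hHi
    _ = _ := by
        refine lintegral_congr fun ω => ?_
        have : IsProbabilityMeasure (M.markovState g t k ω).1 :=
          (M.isMarkovKernel_posterior t).isProbabilityMeasure _
        refine Eq.trans ?_ (M.lintegral_jointKernel ht hgm (M.markovState g t k ω)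
          (hG.comp (measurable_const.prodMk measurable_id))).symm
        rw [markovState_eq]
        rfl

end TeamModel

namespace TeamModel

variable {T n K : ℕ} {Ω : Type uΩ} [MeasurableSpace Ω] {P : Measure Ω}
  {X : ℕ → Type uX} {Y : ℕ → Fin K → Type uY} {U : ℕ → Fin K → Type uX}
  {W : ℕ → Type uW} {Z : ℕ → Fin K → Type uZ}
  [∀ t, MeasurableSpace (X t)] [∀ t j, MeasurableSpace (Y t j)]
  [∀ t j, MeasurableSpace (U t j)] [∀ t, MeasurableSpace (W t)]
  [∀ t j, MeasurableSpace (Z t j)]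
  (M : TeamModel T n K P X Y U W Z)
  [∀ t j, Nonempty (Y t j)] [∀ t j, Nonempty (U t j)] {g : ∀ j, Strategy n Y U j} {k : Fin K}

/-! ### Updating the information of player `k` -/

/-- The information at time `t + 1`, from the information, the action of player `k` and the new
data. -/
noncomputable def nextInfo {t : ℕ} (i : Shared n Y U t × Private n Y U t k) (uk : U t k)
    (b : NewData n Y U t k) : Shared n Y U (t + 1) × Private n Y U (t + 1) k :=
  infoOf
    (Function.update (insertAt (pathObs i (Classical.arbitrary _)) fun s j => (b.2 s j).1) (t + 1)
      (join k b.1 (Classical.arbitrary _)))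
    -- For `n = 1` the newly shared time is `t` itself: the action of player `k` is set first, and
    -- the insertion preserves it while overwriting those of the others.
    (insertAt (Function.update (pathAct i (Classical.arbitrary _)) t
      (join k uk (Classical.arbitrary _))) fun s j => (b.2 s j).2) (t + 1) k

theorem nextInfo_newData (t : ℕ) (ω : Ω) :
    nextInfo (M.info g t k ω) (M.act g t k ω) (M.newData g t k ω) = M.info g (t + 1) k ω := by
  have hn := M.one_le_delay
  refine infoOf_congr (fun s hs j hj => ?_) (fun s hs j hj => ?_) hn
  · by_cases h : s = t + 1
    · subst h
      obtain rfl := hj.resolve_left (by omega)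
      simp [newData]
    · rw [Function.update_of_ne h]
      refine insertAt_eq (v' := fun s j => M.obs g s j ω) ?_
      by_cases hjs : s < t + 1 - n ∨ j = k
      · exact Or.inr (pathObs_infoOf (fun s j => M.obs g s j ω) (fun s j => M.act g s j ω) _
          (by omega) hjs)
      · exact Or.inl (by omega)
  · refine insertAt_eq (v' := fun s j => M.act g s j ω) ?_
    by_cases hjs : s < t + 1 - n ∨ j = k
    · refine Or.inr ?_
      by_cases h : s = t
      · subst h
        obtain rfl := hjs.resolve_left (by omega)
        simp
      · rw [Function.update_of_ne h]
        exact pathAct_infoOf (fun s j => M.obs g s j ω) (fun s j => M.act g s j ω) _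
          (by omega) hjs
    · exact Or.inl (by omega)

theorem measurable_nextInfo (hn : 1 ≤ n) (t : ℕ) :
    Measurable fun p : (Shared n Y U t × Private n Y U t k) × U t k × NewData n Y U t k =>
      nextInfo p.1 p.2.1 p.2.2 := by
  have hcy : Measurable fun p : (Shared n Y U t × Private n Y U t k) × U t k × NewData n Y U t k =>
      (fun s j => (p.2.2.2 s j).1 : (s : Finset.Ico (t + 1 - n) (t + 1 + 1 - n)) →
        (j : {j : Fin K // j ≠ k}) → Y s.1 j.1) := by fun_prop
  have hcu : Measurable fun p : (Shared n Y U t × Private n Y U t k) × U t k × NewData n Y U t k =>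
      (fun s j => (p.2.2.2 s j).2 : (s : Finset.Ico (t + 1 - n) (t + 1 + 1 - n)) →
        (j : {j : Fin K // j ≠ k}) → U s.1 j.1) := by fun_prop
  have hy : Measurable fun p : (Shared n Y U t × Private n Y U t k) × U t k × NewData n Y U t k =>
      insertAt (pathObs p.1 (Classical.arbitrary _)) fun s j => (p.2.2.2 s j).1 :=
    (measurable_insertAt t k).comp (Measurable.prodMk
      ((measurable_pathObs t k).comp (measurable_fst.prodMk measurable_const)) hcy)
  have hu : Measurable fun p : (Shared n Y U t × Private n Y U t k) × U t k × NewData n Y U t k =>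
      insertAt (Function.update (pathAct p.1 (Classical.arbitrary _)) t
        (join k p.2.1 (Classical.arbitrary _))) fun s j => (p.2.2.2 s j).2 :=
    (measurable_insertAt t k).comp (Measurable.prodMk
      ((measurable_update_act t).comp (Measurable.prodMk
        ((measurable_pathAct t k).comp (measurable_fst.prodMk measurable_const))
        ((measurable_join k).comp
          ((measurable_fst.comp measurable_snd).prodMk measurable_const)))) hcu)
  refine measurable_infoOf_comp hn (fun s _ j => ?_) (fun s _ j => ?_)
  · by_cases h : s = t + 1
    · subst h
      simp only [Function.update_self]
      exact (measurable_pi_apply j).comp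
        ((measurable_join k).comp ((measurable_fst.comp
          (measurable_snd.comp measurable_snd)).prodMk measurable_const))
    · simp only [Function.update_of_ne h]
      exact (measurable_pi_apply j).comp ((measurable_pi_apply s).comp hy)
  · exact (measurable_pi_apply j).comp ((measurable_pi_apply s).comp hu)

/-- The new data of player `k`, from the information at time `t + 1`. -/
noncomputable def newDataOf {t : ℕ} (i : Shared n Y U (t + 1) × Private n Y U (t + 1) k) :
    NewData n Y U t k :=
  (pathObs i (Classical.arbitrary _) (t + 1) k,
    newlyOf (pathObs i (Classical.arbitrary _)) (pathAct i (Classical.arbitrary _)) t k)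

theorem newDataOf_info (t : ℕ) (ω : Ω) :
    newDataOf (M.info g (t + 1) k ω) = M.newData g t k ω := by
  have hn := M.one_le_delay
  refine Prod.ext ?_ ?_
  · exact pathObs_infoOf (fun s j => M.obs g s j ω) (fun s j => M.act g s j ω) _
      (by omega) (Or.inr rfl)
  · change newlyOf _ _ t k = newlyOf (fun s j => M.obs g s j ω) (fun s j => M.act g s j ω) t k
    refine newlyOf_congr (fun s _ hs j _ => ?_) (fun s _ hs j _ => ?_)
    · exact pathObs_infoOf (fun s j => M.obs g s j ω) (fun s j => M.act g s j ω) _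
        (by omega) (Or.inl hs)
    · exact pathAct_infoOf (fun s j => M.obs g s j ω) (fun s j => M.act g s j ω) _
        (by omega) (Or.inl hs)

theorem measurable_newDataOf (t : ℕ) :
    Measurable fun i : Shared n Y U (t + 1) × Private n Y U (t + 1) k => newDataOf i := by
  have hy : Measurable fun i : Shared n Y U (t + 1) × Private n Y U (t + 1) k =>
      pathObs i (Classical.arbitrary _) :=
    (measurable_pathObs (t + 1) k).comp (measurable_id.prodMk measurable_const)
  have hu : Measurable fun i : Shared n Y U (t + 1) × Private n Y U (t + 1) k =>
      pathAct i (Classical.arbitrary _) :=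
    (measurable_pathAct (t + 1) k).comp (measurable_id.prodMk measurable_const)
  exact ((measurable_pi_apply k).comp ((measurable_pi_apply (t + 1)).comp hy)).prodMk
    ((measurable_newlyOf t k).comp (hy.prodMk hu))

/-! ### The conditional Markov property -/

variable [IsProbabilityMeasure P]
  [∀ t, StandardBorelSpace (X t)] [∀ t, Nonempty (X t)]
  [∀ t j, StandardBorelSpace (Y t j)] [∀ t j, StandardBorelSpace (U t j)]
  {gm : ∀ j : {j : Fin K // j ≠ k}, Strategy n Y U j.1}

theorem measurable_newData (hg : ∀ j, Admissible T (g j)) {t : ℕ} (ht : t < T) :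
    Measurable (M.newData g t k) := by
  have := (measurable_newDataOf t).comp (M.measurable_info hg k (Nat.succ_le_of_lt ht))
  exact (funext fun ω => M.newDataOf_info t ω : newDataOf ∘ M.info g (t + 1) k = _) ▸ this

theorem measurable_bayesKernel_info (hg : ∀ j, Admissible T (g j)) {t : ℕ} (ht : t < T) :
    Measurable fun i : Shared n Y U (t + 1) × Private n Y U (t + 1) k =>
      (M.markovOf g t k (pastInfo i t), newDataOf i) :=
  ((M.measurable_markovOf hg ht).comp (measurable_pastInfo M.one_le_delay (t + 1) t)).prodMk
    (measurable_newDataOf t)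

theorem measurable_nextInfo_act (hg : ∀ j, Admissible T (g j)) {t : ℕ} (ht : t < T) (hn : 1 ≤ n) :
    Measurable fun p : (Shared n Y U t × Private n Y U t k) × NewData n Y U t k =>
      nextInfo p.1 (g k t p.1.1 p.1.2) p.2 :=
  (measurable_nextInfo hn t).comp
    (measurable_fst.prodMk (((hg k t ht).comp measurable_fst).prodMk measurable_snd))

theorem measurable_lintegral_bayesKernel (hg : ∀ j, Admissible T (g j))
    (hgm : ∀ j, Admissible T (gm j)) {t : ℕ} (ht : t < T)
    {F : ((Shared n Y U t × Private n Y U t k) × NewData n Y U t k) ×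
      (X (t + 1) × PrivateOthers n Y U (t + 1) k) → ℝ≥0∞} (hF : Measurable F) :
    Measurable fun p : (Shared n Y U t × Private n Y U t k) × NewData n Y U t k =>
      ∫⁻ e, F (p, e) ∂M.bayesKernel ht gm hgm (M.markovOf g t k p.1, p.2) := by
  have hR : Measurable fun p : (Shared n Y U t × Private n Y U t k) × NewData n Y U t k =>
      (M.markovOf g t k p.1, p.2) :=
    ((M.measurable_markovOf hg ht).comp measurable_fst).prodMk measurable_snd
  exact Measurable.lintegral_kernel_prod_right' (κ := (M.bayesKernel ht gm hgm).comap _ hR) hF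

/-- The next information is a function of the present information and the new data, so conditioning
on it reduces to disintegrating over the new data with the present information fixed. -/
theorem lintegral_nextInfo (hg : ∀ j, Admissible T (g j)) (hgm : ∀ j, Admissible T (gm j))
    (hgg : ∀ j : {j : Fin K // j ≠ k}, g j.1 = gm j) {t : ℕ} (ht : t < T)
    {G : (Shared n Y U (t + 1) × Private n Y U (t + 1) k) ×
      (X (t + 1) × PrivateOthers n Y U (t + 1) k) → ℝ≥0∞} (hG : Measurable G) :
    ∫⁻ ω, G (M.info g (t + 1) k ω, M.extState g (t + 1) k ω) ∂P =
      ∫⁻ ω, ∫⁻ e, G (M.info g (t + 1) k ω, e)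
        ∂M.bayesKernel ht gm hgm (M.markovState g t k ω, M.newData g t k ω) ∂P := by
  let N : (Shared n Y U t × Private n Y U t k) × NewData n Y U t k →
      Shared n Y U (t + 1) × Private n Y U (t + 1) k := fun p =>
    nextInfo p.1 (g k t p.1.1 p.1.2) p.2
  have hN : Measurable N := measurable_nextInfo_act hg ht M.one_le_delay
  have hN' : ∀ ω, M.info g (t + 1) k ω = N (M.info g t k ω, M.newData g t k ω) := fun ω => by
    rw [← M.nextInfo_newData, act_eq]
    rfl
  clear_value N
  have hF : Measurable fun q : ((Shared n Y U t × Private n Y U t k) × NewData n Y U t k) ×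
      (X (t + 1) × PrivateOthers n Y U (t + 1) k) => G (N q.1, q.2) :=
    hG.comp ((hN.comp measurable_fst).prodMk measurable_snd)
  have hG1 : Measurable fun p : (Shared n Y U t × Private n Y U t k) ×
      (NewData n Y U t k × (X (t + 1) × PrivateOthers n Y U (t + 1) k)) =>
        G (N (p.1, p.2.1), p.2.2) :=
    hG.comp ((hN.comp (measurable_fst.prodMk (measurable_fst.comp measurable_snd))).prodMk
      (measurable_snd.comp measurable_snd))
  have hG2 := M.measurable_lintegral_bayesKernel hg hgm ht hF
  have hG3 : Measurable fun p : (Shared n Y U t × Private n Y U t k) ×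
      (NewData n Y U t k × (X (t + 1) × PrivateOthers n Y U (t + 1) k)) =>
        ∫⁻ e, G (N (p.1, p.2.1), e) ∂M.bayesKernel ht gm hgm (M.markovOf g t k p.1, p.2.1) :=
    hG2.comp (measurable_fst.prodMk (measurable_fst.comp measurable_snd))
  simp only [hN', markovState_eq]
  refine (M.lintegral_info_newData hg hgm hgg ht hG1).trans
    (Eq.trans (lintegral_congr fun ω => ?_) (M.lintegral_info_newData hg hgm hgg ht hG3).symm)
  rw [markovState_eq]
  exact M.lintegral_jointKernel_eq_bayesKernel ht hgm (M.markovOf g t k (M.info g t k ω))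
    (G := fun p => G (N (M.info g t k ω, p.1), p.2))
    (hG1.comp (measurable_const.prodMk measurable_id))

/-- Both sides are conditional distributions of the next extended state given the next information,
hence agree almost surely. The kernel on the right is built from `gm` only, the same for every
strategy of player `k`. -/
theorem ae_randomPosterior_eq (hg : ∀ j, Admissible T (g j)) (hgm : ∀ j, Admissible T (gm j))
    (hgg : ∀ j : {j : Fin K // j ≠ k}, g j.1 = gm j) {t : ℕ} (ht : t < T) :
    ∀ᵐ ω ∂P, M.randomPosterior g (t + 1) k ω =
      M.bayesKernel ht gm hgm (M.markovState g t k ω, M.newData g t k ω) := by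
  have hI := M.measurable_info hg k (Nat.succ_le_of_lt ht)
  have hE := M.measurable_extState hg k (Nat.succ_le_of_lt ht)
  -- The present Markov state and the new data can be read off the next information, which turns the
  -- right-hand side into a kernel on it.
  let η : Kernel (Shared n Y U (t + 1) × Private n Y U (t + 1) k)
      (X (t + 1) × PrivateOthers n Y U (t + 1) k) :=
    (M.bayesKernel ht gm hgm).comap _ (M.measurable_bayesKernel_info (k := k) hg ht)
  have hη : ∀ ω, η (M.info g (t + 1) k ω) =
      M.bayesKernel ht gm hgm (M.markovState g t k ω, M.newData g t k ω) := fun ω => by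
    change M.bayesKernel ht gm hgm (M.markovOf g t k (pastInfo (M.info g (t + 1) k ω) t),
      newDataOf (M.info g (t + 1) k ω)) = _
    rw [M.pastInfo_info (Nat.le_succ t), M.newDataOf_info, M.markovState_eq]
  have h : P.map (fun ω => (M.info g (t + 1) k ω, M.extState g (t + 1) k ω)) =
      P.map (M.info g (t + 1) k) ⊗ₘ η := by
    refine Measure.ext_of_lintegral _ fun G hG => ?_
    rw [lintegral_map hG (hI.prodMk hE), Measure.lintegral_compProd hG, lintegral_map ?_ hI,
      M.lintegral_nextInfo hg hgm hgg ht hG]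
    · simp only [hη]
    · exact Measurable.lintegral_kernel_prod_right' (κ := η) hG
  filter_upwards [ae_of_ae_map hI.aemeasurable
    (condDistrib_ae_eq_of_measure_eq_compProd_of_measurable hI hE h)] with ω hω
  exact hω.trans (hη ω)

theorem measure_randomPosterior_inter (hg : ∀ j, Admissible T (g j))
    (hgm : ∀ j, Admissible T (gm j)) (hgg : ∀ j : {j : Fin K // j ≠ k}, g j.1 = gm j)
    {t : ℕ} (ht : t < T) {B : Set (Measure (X (t + 1) × PrivateOthers n Y U (t + 1) k))}
    (hB : MeasurableSet B) {C : Set (Shared n Y U t × Private n Y U t k)} (hC : MeasurableSet C) :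
    P (M.randomPosterior g (t + 1) k ⁻¹' B ∩ M.info g t k ⁻¹' C) =
      ∫⁻ ω in M.info g t k ⁻¹' C, M.posteriorKernel ht gm hgm (M.markovState g t k ω) B ∂P := by
  have hI := M.measurable_info hg k ht.le
  have hS : MeasurableSet {p : (Shared n Y U t × Private n Y U t k) × (NewData n Y U t k ×
      (X (t + 1) × PrivateOthers n Y U (t + 1) k)) |
        M.bayesKernel ht gm hgm (M.markovOf g t k p.1, p.2.1) ∈ B ∧ p.1 ∈ C} := by
    refine MeasurableSet.inter ?_ (measurable_fst hC)
    exact ((M.bayesKernel ht gm hgm).measurable.comp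
      (((M.measurable_markovOf hg ht).comp measurable_fst).prodMk
        (measurable_fst.comp measurable_snd))) hB
  have h := M.lintegral_info_newData hg hgm hgg ht (measurable_one.indicator hS)
  have hleft : P (M.randomPosterior g (t + 1) k ⁻¹' B ∩ M.info g t k ⁻¹' C) =
      ∫⁻ ω, Set.indicator {p : (Shared n Y U t × Private n Y U t k) × (NewData n Y U t k ×
      (X (t + 1) × PrivateOthers n Y U (t + 1) k)) |
        M.bayesKernel ht gm hgm (M.markovOf g t k p.1, p.2.1) ∈ B ∧ p.1 ∈ C} 1
          (M.info g t k ω, (M.newData g t k ω, M.extState g (t + 1) k ω)) ∂P := by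
    have hφ : Measurable fun ω => (M.info g t k ω, (M.newData g t k ω, M.extState g (t + 1) k ω)) :=
      hI.prodMk ((M.measurable_newData hg ht).prodMk (M.measurable_extState hg k ht))
    refine Eq.trans ?_ (lintegral_indicator_one (hφ hS)).symm
    refine measure_congr ?_
    filter_upwards [M.ae_randomPosterior_eq hg hgm hgg ht] with ω hω
    refine propext ?_
    change (M.randomPosterior g (t + 1) k ω ∈ B ∧ _) ↔ (_ ∈ B ∧ _)
    rw [hω, markovState_eq]
    rfl
  rw [hleft, h, ← lintegral_indicator (hI hC)]
  refine lintegral_congr fun ω => ?_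
  by_cases hω : M.info g t k ω ∈ C
  · rw [Set.indicator_of_mem (show ω ∈ M.info g t k ⁻¹' C from hω), M.posteriorKernel_apply ht hgm _ hB]
    have hS' : MeasurableSet {p : NewData n Y U t k × (X (t + 1) × PrivateOthers n Y U (t + 1) k) |
        M.bayesKernel ht gm hgm (M.markovState g t k ω, p.1) ∈ B} :=
      ((M.bayesKernel ht gm hgm).measurable.comp (measurable_const.prodMk measurable_fst)) hB
    rw [← lintegral_indicator_one hS']
    refine lintegral_congr fun p => ?_
    rw [markovState_eq]
    exact Set.indicator_const_eq_indicator_const (and_iff_left hω)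
  · rw [Set.indicator_of_notMem (show ω ∉ M.info g t k ⁻¹' C from hω)]
    exact (lintegral_congr fun p => Set.indicator_of_notMem (fun hc => hω hc.2) _).trans
      lintegral_zero

/-- The conditioning σ-algebra may be anything between those of the Markov state and of the
information: the first inclusion makes the candidate measurable, the second makes the test sets
admissible. The two conditional probabilities of the theorem are the extreme cases. -/
theorem condExp_randomPosterior (hg : ∀ j, Admissible T (g j))
    (hgm : ∀ j, Admissible T (gm j)) (hgg : ∀ j : {j : Fin K // j ≠ k}, g j.1 = gm j)
    {t : ℕ} (ht : t < T) {B : Set (Measure (X (t + 1) × PrivateOthers n Y U (t + 1) k))}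
    (hB : MeasurableSet B) {ρ : Type*} [MeasurableSpace ρ] {R : Ω → ρ}
    (hR : MeasurableSpace.comap R inferInstance ≤
      MeasurableSpace.comap (M.info g t k) inferInstance)
    (hR' : Measurable[MeasurableSpace.comap R inferInstance] (M.markovState g t k)) :
    P⟦M.randomPosterior g (t + 1) k ⁻¹' B | MeasurableSpace.comap R inferInstance⟧
      =ᵐ[P] fun ω => (M.posteriorKernel ht gm hgm (M.markovState g t k ω)).real B := by
  have := M.isMarkovKernel_posteriorKernel ht gm hgm
  refine condExp_indicator_ae_eq_toReal (hR.trans (M.measurable_info hg k ht.le).comap_le)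
    (((M.posterior g (t + 1) k).measurable.comp (M.measurable_info hg k ht)) hB)
    (((M.posteriorKernel ht gm hgm).measurable_coe hB).comp hR') (fun ω => prob_le_one)
    fun C hC => ?_
  obtain ⟨D, hD, rfl⟩ := hR C hC
  exact M.measure_randomPosterior_inter hg hgm hgg ht hB hD

/-- Perfect recall recovers the earlier information from the present one, and the actions of player
`k` are measurable functions of his information. -/
theorem historyAlgebra_eq (hg : ∀ j, Admissible T (g j)) {t : ℕ} (ht : t < T) :
    M.historyAlgebra g t k = MeasurableSpace.comap (M.info g t k) inferInstance := by
  refine le_antisymm ?_ ?_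
  · refine Measurable.comap_le (m₁ := MeasurableSpace.comap (M.info g t k) inferInstance) ?_
    have hI : @Measurable _ _ (MeasurableSpace.comap (M.info g t k) inferInstance) _
      (M.info g t k) := comap_measurable _
    refine @measurable_pi_lambda _ _ _ (_) _ _ fun s => ?_
    have hs := Finset.mem_range.1 s.2
    have h : @Measurable _ _ (MeasurableSpace.comap (M.info g t k) inferInstance) _
        (M.info g s.1 k) := by
      have := (measurable_pastInfo M.one_le_delay t s.1).comp hI
      exact (funext fun ω => M.pastInfo_info (Nat.le_of_lt_succ hs) ω :
        (fun i => pastInfo i s.1) ∘ M.info g t k = _) ▸ this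
    simp only [act_eq]
    exact (measurable_fst.comp h).prodMk ((measurable_snd.comp h).prodMk
      ((hg k s.1 (by omega)).comp h))
  · refine Measurable.comap_le (m₁ := M.historyAlgebra g t k) ?_
    have h : @Measurable _ _ (M.historyAlgebra g t k) _
      (fun ω (s : Finset.range (t + 1)) => (M.shared g s.1 ω, M.priv g s.1 k ω, M.act g s.1 k ω)) :=
      comap_measurable _
    have h' := (measurable_pi_apply (⟨t, Finset.self_mem_range_succ t⟩ : Finset.range (t + 1))).comp h
    exact (measurable_fst.comp h').prodMk (measurable_fst.comp (measurable_snd.comp h'))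

theorem comap_markovState_le (hg : ∀ j, Admissible T (g j)) {t : ℕ} (ht : t < T) :
    MeasurableSpace.comap (M.markovState g t k) inferInstance ≤
      MeasurableSpace.comap (M.info g t k) inferInstance := by
  refine Measurable.comap_le (m₁ := MeasurableSpace.comap (M.info g t k) inferInstance) ?_
  have hI : @Measurable _ _ (MeasurableSpace.comap (M.info g t k) inferInstance) _
    (M.info g t k) := comap_measurable _
  exact (funext fun ω => (M.markovState_eq t ω).symm : M.markovOf g t k ∘ M.info g t k = _) ▸
    (M.measurable_markovOf hg ht).comp hI

end TeamModel

/-! ### The theorem -/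

theorem mainTheorem1 {T n K : ℕ} {Ω : Type uΩ} [MeasurableSpace Ω] {P : Measure Ω}
    [IsProbabilityMeasure P]
    {X : ℕ → Type uX} {Y : ℕ → Fin K → Type uY} {U : ℕ → Fin K → Type uX}
    {W : ℕ → Type uW} {Z : ℕ → Fin K → Type uZ}
    [∀ t, MeasurableSpace (X t)] [∀ t, StandardBorelSpace (X t)] [∀ t, Nonempty (X t)]
    [∀ t j, MeasurableSpace (Y t j)] [∀ t j, StandardBorelSpace (Y t j)]
    [∀ t j, Nonempty (Y t j)]
    [∀ t j, MeasurableSpace (U t j)] [∀ t j, StandardBorelSpace (U t j)]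
    [∀ t j, Nonempty (U t j)]
    [∀ t, MeasurableSpace (W t)] [∀ t j, MeasurableSpace (Z t j)]
    (M : TeamModel T n K P X Y U W Z) (k : Fin K)
    (gm : ∀ j : {j : Fin K // j ≠ k}, Strategy n Y U j.1) (hgm : ∀ j, Admissible T (gm j)) :
    -- the PDFs `ξ_t[δ_t, λ_t^k]`, chosen before the strategy `gk` of player `k`
    (∃ ξ : (t : ℕ) → Shared n Y U t → Private n Y U t k →
        X t × PrivateOthers n Y U t k → ℝ≥0∞,
      (∀ t ≤ T, Measurable
        fun p : (Shared n Y U t × Private n Y U t k) × (X t × PrivateOthers n Y U t k) =>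
          ξ t p.1.1 p.1.2 p.2) ∧
      -- whatever the strategy of player `k`, they are PDFs of the posterior
      (∀ gk : Strategy n Y U k, Admissible T gk → ∀ t ≤ T,
        ∀ᵐ i ∂(P.map (M.info (join k gk gm) t k)),
          M.IsPDF t k (M.posterior (join k gk gm) t k i) (ξ t i.1 i.2)) ∧
      -- initial condition
      (∀ (y : ∀ s j, Y s j) (u : ∀ s j, U s j),
        ξ 0 (sharedOf y u 0) (privateOf y u 0 k) = M.initialPDF k (y 0 k)) ∧
      -- recursion
      (∀ t < T, ∀ (y : ∀ s j, Y s j) (u : ∀ s j, U s j),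
        ξ (t + 1) (sharedOf y u (t + 1)) (privateOf y u (t + 1) k) =
          M.bayesOperator t k (y (t + 1) k) (u t k) (fun j => gm j t (sharedOf y u t))
            (newlyOf y u t k) (ξ t (sharedOf y u t) (privateOf y u t k)))) ∧
    -- conditional Markov property, with a transition kernel chosen before `gk`
    (∀ t < T, ∃ κ : Kernel (Measure (X t × PrivateOthers n Y U t k) × Shared n Y U t × U t k)
        (Measure (X (t + 1) × PrivateOthers n Y U (t + 1) k)),
      IsMarkovKernel κ ∧
      ∀ gk : Strategy n Y U k, Admissible T gk →
        ∀ B : Set (Measure (X (t + 1) × PrivateOthers n Y U (t + 1) k)), MeasurableSet B →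
          P⟦M.randomPosterior (join k gk gm) (t + 1) k ⁻¹' B |
              M.historyAlgebra (join k gk gm) t k⟧
            =ᵐ[P] (fun ω => (κ (M.markovState (join k gk gm) t k ω)).real B) ∧
          P⟦M.randomPosterior (join k gk gm) (t + 1) k ⁻¹' B |
              MeasurableSpace.comap (M.markovState (join k gk gm) t k) inferInstance⟧
            =ᵐ[P] (fun ω => (κ (M.markovState (join k gk gm) t k ω)).real B)) := by
  have hg : ∀ gk : Strategy n Y U k, Admissible T gk →
      ∀ j, Admissible T ((join k gk gm : ∀ j, Strategy n Y U j) j) := fun gk hgk j => by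
    by_cases hj : j = k
    · subst hj; rwa [join_self]
    · rw [join_of_ne _ _ _ hj]; exact hgm ⟨j, hj⟩
  have hgg : ∀ (gk : Strategy n Y U k) (j : {j : Fin K // j ≠ k}),
      (join k gk gm : ∀ j, Strategy n Y U j) j.1 = gm j := fun gk => join_val k gk gm
  refine ⟨⟨fun t d l => M.posteriorPDF gm t (d, l), fun t ht => M.measurable_posteriorPDF hgm ht,
    fun gk hgk t ht => ?_, fun y u => ?_, fun t ht y u => ?_⟩, fun t ht =>
    ⟨M.posteriorKernel ht gm hgm, M.isMarkovKernel_posteriorKernel ht gm hgm,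
      fun gk hgk B hB => ⟨?_, ?_⟩⟩⟩
  · have h := M.ae_isPDF_posteriorPDF (hg gk hgk) k ht
    simpa only [hgg] using h
  · exact congrArg (M.normalize 0 k) (M.initPDF_infoOf y u)
  · exact congrArg (M.normalize (t + 1) k)
      (M.stepPDF_infoOf t (M.posteriorPDF gm t) y u)
  · rw [M.historyAlgebra_eq (hg gk hgk) ht]
    exact M.condExp_randomPosterior (hg gk hgk) hgm (hgg gk) ht hB le_rfl
      ((comap_measurable _).mono (M.comap_markovState_le (hg gk hgk) ht) le_rfl)
  · exact M.condExp_randomPosterior (hg gk hgk) hgm (hgg gk) ht hB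
      (M.comap_markovState_le (hg gk hgk) ht) (comap_measurable _)
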